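/- Let $n\ge 2$ and $a_{00},\dots,a_{nn}\in\mathbb C$. Write $\langle A,B\rangle=\operatorname{tr}AB$ on $\mathfrak{sl}(2,\mathbb C)$. For $a\in\mathbb C$ let the quadric $Q_a$ be the set of pairs $(A,\ell)$, where $A\in\mathfrak{sl}(2,\mathbb C)$ satisfies $\langle A,A\rangle=a$ and $\ell\ni A$ is a line spanned by a non-zero $B\in\mathfrak{sl}(2,\mathbb C)$ with $\langle B,B\rangle=a$ (so $Q_a$ is the orbit if $a\neq0$, and the cone $\langle A,A\rangle=0$ with blown-up vertex if $a=0$). With $A=\begin{pmatrix}X_3&X_1\\X_2&-X_3\end{pmatrix}$ and $\rho^2=a/2$, $Q_a$ is a complex symplectic surface, covered by the two charts $(p,q)=\left(\frac{X_3-\rho}{X_1},X_1\right)$ and $(p',q')=\left(\frac{X_1}{X_3-\rho},X_2\right)$ with values in $\mathbb C^2$ (extended to the locus where these quotients are $0/0$; for $a=0$ by $p=x_3/x_1$, $p'=-x_3/x_2$, where $\ell$ is spanned by $\begin{pmatrix}x_3&x_1\\x_2&-x_3\end{pmatrix}$), with the Lie–Poisson form $\omega_{LP}=dp\wedge dq=dp'\wedge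 dq'=dX_3\wedge d\log X_1$. On $Q_{a_{00}}\times\dots\times Q_{a_{nn}}$ consider $\widetilde{\widetilde\omega}=\sum_{k=0}^n\omega^{(k)}$, the sum of the forms of the factors. Let $\widetilde M$ be the set of points $((A^{(k)},\ell^{(k)}))_k$ of this product such that $\sum_kA^{(k)}=0$ and the matrices $A^{(k)}$ are not simultaneously triangularizable; $SL(2,\mathbb C)$ acts on $\widetilde M$ by simultaneous conjugation. Let $M=\widetilde M/SL(2,\mathbb C)$ and $\tilde\pi:\widetilde M\to M$ the quotient map. Fix square roots $s_k$, $s_k^2=2a_{kk}$. For $(A,\ell)\in Q_{a_{kk}}$ and $s=\pm s_k$ let $(\sigma^{(s)})$ be the line $\{\sigma\in\mathfrak{sl}(2,\mathbb C):[A,\sigma]=s\sigma\}$ if $A\ne0$, and $\ell$ if $A=0$. For distinct $i,j\in\{1,\dots,n\}$ let $\widetilde{\mathcal U}_{ij}=\widetilde{\mathcal U}(-s_0//s_i/j)\subset\widetilde M$ be the set where $(\sigma^{(-s_0)})$ of $A^{(0)}$ is orthogonal neither to $(\sigma^{(s_i)})$ of $A^{(i)}$ nor to $A^{(j)}$, and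 $\mathcal U_{ij}=\tilde\pi(\widetilde{\mathcal U}_{ij})$. At each point of $\widetilde{\mathcal U}_{ij}$ there is a unique basis $\sigma_\pm,\sigma_3$ of $\mathfrak{sl}(2,\mathbb C)$ with $\langle\sigma_\pm,\sigma_\pm\rangle=\langle\sigma_\pm,\sigma_3\rangle=0$, $\langle\sigma_+,\sigma_-\rangle=1$, $[\sigma_+,\sigma_-]=\sigma_3$, $\sigma_-\in(\sigma^{(-s_0)})$, $\sigma_+\in(\sigma^{(s_i)})$, $\langle\sigma_-,A^{(j)}\rangle=1$. Let $$\pi_{0ij}:\mathcal U_{ij}\to\prod_{k\ne0,i,j}Q_{a_{kk}}$$ send a point to the matrices $\begin{pmatrix}\beta_k&q_k\\q_k'&-\beta_k\end{pmatrix}$, $\beta_k=\tfrac12\langle\sigma_3,A^{(k)}\rangle$, $q_k=\langle\sigma_-,A^{(k)}\rangle$, $q'_k=\langle\sigma_+,A^{(k)}\rangle$, of $A^{(k)}$ ($k\neq0,i,j$) in this basis, with the lines transformed in the same way; let $\widetilde{\widetilde\omega}_{0ij}$ be the sum of the forms of the factors of the target. Then the forms $\widetilde{\widetilde\omega}$ and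 $\widetilde{\widetilde\omega}_{0ij}$ are symplectic, and: 1. For any choice of the roots and all distinct $i,j\in\{1,\dots,n\}$ (in particular $i=n-1$, $j=n$), on $\widetilde{\mathcal U}_{ij}$ $$\tilde\pi^*\pi_{0ij}^*\,\widetilde{\widetilde\omega}_{0ij}=\widetilde{\widetilde\omega}|_{\widetilde M}.$$ 2. $\widetilde M$ is a complex submanifold of dimension $2n-1$ of the product, and $M$ (with the quotient topology) is a Hausdorff, second countable complex manifold of dimension $2(n-2)$ such that $\tilde\pi$ is a holomorphic submersion. There is a (holomorphic) symplectic form $\omega$ on $M$ with $\tilde\pi^*\omega=\widetilde{\widetilde\omega}|_{\widetilde M}$. 3. For any choice of the roots, the sets $\mathcal U_{ij}$ cover $M$, and $\tilde\pi^{-1}(\mathcal U_{ij})=\widetilde{\mathcal U}_{ij}$. Each $\pi_{0ij}$ is a symplectomorphism of the open set $\mathcal U_{ij}$ onto the open subset of the product of $n-2$ quadrics $\prod_{k\ne0,i,j}Q_{a_{kk}}$ that consists of the points for which the matrices $$A^{(0)}=\begin{pmatrix}\frac{s_0}2&0\\-(q'_\Sigma+q'_j)&-\frac{s_0}2\end{pmatrix},\quad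 A^{(i)}=\begin{pmatrix}\frac{s_i}2&-(q_\Sigma+1)\\0&-\frac{s_i}2\end{pmatrix},\quad A^{(j)}=\begin{pmatrix}\beta_j&1\\q'_j&-\beta_j\end{pmatrix},\quad A^{(k)}=\begin{pmatrix}\beta_k&q_k\\q'_k&-\beta_k\end{pmatrix}\ (k\ne0,i,j)$$ are not simultaneously triangularizable; here $\beta_\Sigma,q_\Sigma,q'_\Sigma$ are the sums of $\beta_k,q_k,q_k'$ over $k\neq0,i,j$, $\beta_j=-(\frac{s_0}2+\frac{s_i}2+\beta_\Sigma)$ and $q'_j=\frac{a_{jj}}2-\beta_j^2$. If no sum $\sum_{k=0}^n\pm s_k$ vanishes, this subset is the whole product of $n-2$ quadrics. -/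

import Mathlib

open scoped Manifold ContDiff Topology

noncomputable section

namespace Garnier

/-- Complex `2 × 2` matrices. Elements of `sl(2, ℂ)` are the traceless ones; the entries of
`(X₃ X₁; X₂ -X₃)` are `A 0 0 = X₃`, `A 0 1 = X₁`, `A 1 0 = X₂`. -/
abbrev Mat : Type := Matrix (Fin 2) (Fin 2) ℂ

/-- The group `SL(2, ℂ)`. -/
abbrev SL2 : Type := Matrix.SpecialLinearGroup (Fin 2) ℂ

/-- The form `⟨A, B⟩ = tr (A B)`. -/
def pair (A B : Mat) : ℂ := (A * B).trace

/-- The (co)adjoint orbit of non-zero elements `A` of `sl(2, ℂ)` with `⟨A, A⟩ = a`. -/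
def orbitSet (a : ℂ) : Set Mat := {A | A ≠ 0 ∧ A.trace = 0 ∧ pair A A = a}

/-- The quadric `SL|A⟩'`, `⟨A, A⟩ = a`: pairs of an affine component `A` with `⟨A, A⟩ = a` and a
projective component (a line spanned by an element of the orbit, i.e. a point of the
projectivization of the orbit), such that `A` lies on the line.
For `a ≠ 0` the line is spanned by `A`, so this is the orbit; for `a = 0` it is the
cone `⟨A, A⟩ = 0` with blown up vertex. -/
@[ext]
structure Quad (a : ℂ) where
  /-- the affine component -/
  A : Mat
  /-- the projective component -/
  line : Submodule ℂ Mat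
  line_mem : ∃ B ∈ orbitSet a, line = Submodule.span ℂ {B}
  mem_line : A ∈ line
  pair_self : pair A A = a

/-! ### The complex manifold structure of the quadric: two charts `(p, q)`, `(p', q')` -/

/-- A square root of `a / 2`. -/
def root (a : ℂ) : ℂ := (a / 2) ^ (((2 : ℕ) : ℂ)⁻¹)

lemma root_sq (a : ℂ) : root a ^ 2 = a / 2 := Complex.cpow_nat_inv_pow _ two_ne_zero

lemma root_eq_zero {a : ℂ} : root a = 0 ↔ a = 0 := by
  rw [← pow_eq_zero_iff (two_ne_zero), root_sq]; simp

lemma root_sq' (a : ℂ) : 2 * root a ^ 2 = a := by rw [root_sq]; ring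

/-- `(X₃ X₁; X₂ -X₃)` with `X₁ = q`, `X₃ = p q + ρ`, `X₂ = -p (p q + 2 ρ)`,
so that `p = (X₃ - ρ) / X₁` and `q = X₁`. -/
def mat₁ (ρ p q : ℂ) : Mat := !![p * q + ρ, q; -p * (p * q + 2 * ρ), -(p * q + ρ)]

/-- `(X₃ X₁; X₂ -X₃)` with `X₂ = q'`, `X₃ = -p' q' - ρ`, `X₁ = -p' (p' q' + 2 ρ)`,
so that `p' = X₁ / (X₃ - ρ)` and `q' = X₂`. -/
def mat₂ (ρ p q : ℂ) : Mat := !![-(p * q + ρ), -p * (p * q + 2 * ρ); q, p * q + ρ]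

lemma mat₁_zero (p q : ℂ) : mat₁ 0 p q = q • mat₁ 0 p 1 := by
  ext i j; fin_cases i <;> fin_cases j <;> simp [mat₁] <;> ring

lemma mat₂_zero (p q : ℂ) : mat₂ 0 p q = q • mat₂ 0 p 1 := by
  ext i j; fin_cases i <;> fin_cases j <;> simp [mat₂] <;> ring

lemma pair_mat₁ (ρ p q : ℂ) : pair (mat₁ ρ p q) (mat₁ ρ p q) = 2 * ρ ^ 2 := by
  simp [pair, mat₁, Matrix.trace_fin_two]; ring

lemma pair_mat₂ (ρ p q : ℂ) : pair (mat₂ ρ p q) (mat₂ ρ p q) = 2 * ρ ^ 2 := by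
  simp [pair, mat₂, Matrix.trace_fin_two]; ring

lemma mat₁_mem_orbitSet {ρ p q : ℂ} (h : ρ ≠ 0 ∨ q ≠ 0) : mat₁ ρ p q ∈ orbitSet (2 * ρ ^ 2) := by
  refine ⟨fun h0 => ?_, by simp [mat₁, Matrix.trace_fin_two], pair_mat₁ ρ p q⟩
  have h1 : q = 0 := by simpa [mat₁] using congrFun (congrFun h0 0) 1
  have h2 : p * q + ρ = 0 := by simpa [mat₁] using congrFun (congrFun h0 0) 0
  simp_all

lemma mat₂_mem_orbitSet {ρ p q : ℂ} (h : ρ ≠ 0 ∨ q ≠ 0) : mat₂ ρ p q ∈ orbitSet (2 * ρ ^ 2) := by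
  refine ⟨fun h0 => ?_, by simp [mat₂, Matrix.trace_fin_two], pair_mat₂ ρ p q⟩
  have h1 : q = 0 := by simpa [mat₂] using congrFun (congrFun h0 1) 0
  have h2 : p * q + ρ = 0 := by simpa [mat₂] using congrFun (congrFun h0 1) 1
  simp_all

open Classical in
/-- The point of the quadric with coordinates `(p, q)`. Its projective component is spanned by the
affine one if `a ≠ 0`, and it is `x₃ : x₁ : x₂ = p : 1 : -p²` if `a = 0`. -/
def par₁ (a : ℂ) (z : ℂ × ℂ) : Quad a where
  A := mat₁ (root a) z.1 z.2
  line := Submodule.span ℂ {mat₁ (root a) z.1 (if a = 0 then 1 else z.2)}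
  line_mem := by
    refine ⟨_, ?_, rfl⟩
    have := mat₁_mem_orbitSet (ρ := root a) (p := z.1) (q := if a = 0 then 1 else z.2)
      (by by_cases h : a = 0 <;> simp [h, root_eq_zero])
    rwa [root_sq'] at this
  mem_line := by
    by_cases h : a = 0
    · subst h
      simp only [if_true, (root_eq_zero (a := 0)).2 rfl]
      exact Submodule.mem_span_singleton.2 ⟨z.2, (mat₁_zero _ _).symm⟩
    · simp only [h, if_false]
      exact Submodule.mem_span_singleton_self _
  pair_self := by rw [pair_mat₁, root_sq']

open Classical in
/-- The point of the quadric with coordinates `(p', q')`. Its projective component is spanned by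
the affine one if `a ≠ 0`, and it is `x₃ : x₁ : x₂ = -p' : -p'² : 1` if `a = 0`. -/
def par₂ (a : ℂ) (z : ℂ × ℂ) : Quad a where
  A := mat₂ (root a) z.1 z.2
  line := Submodule.span ℂ {mat₂ (root a) z.1 (if a = 0 then 1 else z.2)}
  line_mem := by
    refine ⟨_, ?_, rfl⟩
    have := mat₂_mem_orbitSet (ρ := root a) (p := z.1) (q := if a = 0 then 1 else z.2)
      (by by_cases h : a = 0 <;> simp [h, root_eq_zero])
    rwa [root_sq'] at this
  mem_line := by
    by_cases h : a = 0
    · subst h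
      simp only [if_true, (root_eq_zero (a := 0)).2 rfl]
      exact Submodule.mem_span_singleton.2 ⟨z.2, (mat₂_zero _ _).symm⟩
    · simp only [h, if_false]
      exact Submodule.mem_span_singleton_self _
  pair_self := by rw [pair_mat₂, root_sq']

/-- For `a ≠ 0` the projective component is determined by the affine one. -/
lemma Quad.line_eq {a : ℂ} (ha : a ≠ 0) (x : Quad a) : x.line = Submodule.span ℂ {x.A} := by
  obtain ⟨B, -, hl⟩ := x.line_mem
  have hm := x.mem_line
  rw [hl] at hm ⊢
  obtain ⟨c, hc⟩ := Submodule.mem_span_singleton.1 hm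
  have hc0 : c ≠ 0 := by
    rintro rfl
    have := x.pair_self
    rw [← hc] at this
    simp [pair] at this
    exact ha this.symm
  rw [← hc, Submodule.span_singleton_smul_eq (IsUnit.mk0 c hc0)]

lemma Quad.ext_of_ne {a : ℂ} (ha : a ≠ 0) {x y : Quad a} (h : x.A = y.A) : x = y :=
  Quad.ext h (by rw [x.line_eq ha, y.line_eq ha, h])

lemma root_zero : root 0 = 0 := root_eq_zero.2 rfl

lemma par₁_zero_line (z : ℂ × ℂ) : (par₁ 0 z).line = Submodule.span ℂ {mat₁ 0 z.1 1} := by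
  simp [par₁, root_zero]

lemma par₂_zero_line (z : ℂ × ℂ) : (par₂ 0 z).line = Submodule.span ℂ {mat₂ 0 z.1 1} := by
  simp [par₂, root_zero]

lemma par₁_injective (a : ℂ) : Function.Injective (par₁ a) := by
  rintro ⟨p, q⟩ ⟨p', q'⟩ h
  have hA : mat₁ (root a) p q = mat₁ (root a) p' q' := congrArg Quad.A h
  have h1 : q = q' := by simpa [mat₁] using congrFun (congrFun hA 0) 1
  subst h1
  have h2 : p * q = p' * q := by simpa [mat₁] using congrFun (congrFun hA 0) 0
  have h3 : p * (p * q + 2 * root a) = p' * (p' * q + 2 * root a) := by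
    simpa [mat₁] using congrFun (congrFun hA 1) 0
  suffices p = p' by rw [this]
  by_cases ha : a = 0
  · subst ha
    have hl := congrArg Quad.line h
    rw [par₁_zero_line, par₁_zero_line] at hl
    have hm : mat₁ 0 p 1 ∈ Submodule.span ℂ {mat₁ 0 p' 1} :=
      hl ▸ Submodule.mem_span_singleton_self _
    obtain ⟨c, hc⟩ := Submodule.mem_span_singleton.1 hm
    have e1 : c = 1 := by simpa [mat₁] using congrFun (congrFun hc 0) 1
    have e2 : c * p' = p := by simpa [mat₁] using congrFun (congrFun hc 0) 0
    rw [← e2, e1, one_mul]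
  · have hr : root a ≠ 0 := fun hr => ha (root_eq_zero.1 hr)
    by_cases hq : q = 0
    · subst hq
      have : root a * (p - p') = 0 := by linear_combination h3 / 2
      rcases mul_eq_zero.1 this with h | h
      · exact absurd h hr
      · exact sub_eq_zero.1 h
    · exact mul_right_cancel₀ hq h2

lemma par₂_injective (a : ℂ) : Function.Injective (par₂ a) := by
  rintro ⟨p, q⟩ ⟨p', q'⟩ h
  have hA : mat₂ (root a) p q = mat₂ (root a) p' q' := congrArg Quad.A h
  have h1 : q = q' := by simpa [mat₂] using congrFun (congrFun hA 1) 0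
  subst h1
  have h2 : p * q = p' * q := by simpa [mat₂] using congrFun (congrFun hA 1) 1
  have h3 : p * (p * q + 2 * root a) = p' * (p' * q + 2 * root a) := by
    simpa [mat₂] using congrFun (congrFun hA 0) 1
  suffices p = p' by rw [this]
  by_cases ha : a = 0
  · subst ha
    have hl := congrArg Quad.line h
    rw [par₂_zero_line, par₂_zero_line] at hl
    have hm : mat₂ 0 p 1 ∈ Submodule.span ℂ {mat₂ 0 p' 1} :=
      hl ▸ Submodule.mem_span_singleton_self _
    obtain ⟨c, hc⟩ := Submodule.mem_span_singleton.1 hm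
    have e1 : c = 1 := by simpa [mat₂] using congrFun (congrFun hc 1) 0
    have e2 : c * p' = p := by simpa [mat₂] using congrFun (congrFun hc 1) 1
    rw [← e2, e1, one_mul]
  · have hr : root a ≠ 0 := fun hr => ha (root_eq_zero.1 hr)
    by_cases hq : q = 0
    · subst hq
      have : root a * (p - p') = 0 := by linear_combination h3 / 2
      rcases mul_eq_zero.1 this with h | h
      · exact absurd h hr
      · exact sub_eq_zero.1 h
    · exact mul_right_cancel₀ hq h2

/-- The transition function `p' = 1 / p`, `q' = -p (p q + 2 ρ)`. -/
def trans (a : ℂ) (z : ℂ × ℂ) : ℂ × ℂ := (1 / z.1, -z.1 * (z.1 * z.2 + 2 * root a))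

lemma par₂_trans (a : ℂ) (z : ℂ × ℂ) (hz : z.1 ≠ 0) : par₂ a (trans a z) = par₁ a z := by
  have hA : mat₂ (root a) (trans a z).1 (trans a z).2 = mat₁ (root a) z.1 z.2 := by
    ext i j
    fin_cases i <;> fin_cases j <;> simp [mat₁, mat₂, trans] <;> field_simp <;> ring
  by_cases ha : a = 0
  · subst ha
    refine Quad.ext hA ?_
    rw [par₁_zero_line, par₂_zero_line]
    have : mat₁ 0 z.1 1 = (-z.1 ^ 2) • mat₂ 0 (trans 0 z).1 1 := by
      ext i j
      fin_cases i <;> fin_cases j <;> simp [mat₁, mat₂, trans] <;> field_simp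
    rw [this, Submodule.span_singleton_smul_eq]
    exact IsUnit.mk0 _ (by simpa using hz)
  · exact Quad.ext_of_ne ha hA

lemma par₁_trans (a : ℂ) (z : ℂ × ℂ) (hz : z.1 ≠ 0) : par₁ a (trans a z) = par₂ a z := by
  have h := par₂_trans a (trans a z) (by simpa [trans] using hz)
  rw [← h]
  congr 1
  ext
  · simp [trans]
  · simp [trans]; field_simp; ring

lemma par_ne {a : ℂ} {z w : ℂ × ℂ} (h : par₁ a z = par₂ a w) : z.1 ≠ 0 ∧ w.1 ≠ 0 := by
  obtain ⟨p, q⟩ := z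
  obtain ⟨p', q'⟩ := w
  have hA : mat₁ (root a) p q = mat₂ (root a) p' q' := congrArg Quad.A h
  have h1 : q = -p' * (p' * q' + 2 * root a) := by
    simpa [mat₁, mat₂] using congrFun (congrFun hA 0) 1
  have h2 : p * q + root a = -(p' * q' + root a) := by
    simpa [mat₁, mat₂] using congrFun (congrFun hA 0) 0
  have h3 : -p * (p * q + 2 * root a) = q' := by
    simpa [mat₁, mat₂] using congrFun (congrFun hA 1) 0
  by_cases ha : a = 0
  · subst ha
    have hl := congrArg Quad.line h
    rw [par₁_zero_line, par₂_zero_line] at hl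
    have hm : mat₁ 0 p 1 ∈ Submodule.span ℂ {mat₂ 0 p' 1} :=
      hl ▸ Submodule.mem_span_singleton_self _
    obtain ⟨c, hc⟩ := Submodule.mem_span_singleton.1 hm
    have e1 : -(c * (p' * p')) = 1 := by simpa [mat₁, mat₂] using congrFun (congrFun hc 0) 1
    have e2 : c = -(p * p) := by simpa [mat₁, mat₂] using congrFun (congrFun hc 1) 0
    refine ⟨?_, ?_⟩
    · rintro rfl
      simp_all
    · rintro rfl
      simp_all
  · have hr : root a ≠ 0 := fun hr => ha (root_eq_zero.1 hr)
    refine ⟨?_, ?_⟩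
    · rintro rfl
      have : q' = 0 := by rw [← h3]; simp
      subst this
      exact hr (by linear_combination h2 / 2)
    · rintro rfl
      have : q = 0 := by rw [h1]; simp
      subst this
      exact hr (by linear_combination h2 / 2)

lemma mem_range_par {a : ℂ} (x : Quad a) : x ∈ Set.range (par₁ a) ∨ x ∈ Set.range (par₂ a) := by
  obtain ⟨B, ⟨hB0, hBt, hBB⟩, hl⟩ := x.line_mem
  obtain ⟨c, hc⟩ := Submodule.mem_span_singleton.1 (hl ▸ x.mem_line)
  have t1 : B 1 1 = -B 0 0 := by
    rw [Matrix.trace_fin_two] at hBt; linear_combination hBt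
  have n1 : 2 * (B 0 0 ^ 2 + B 0 1 * B 1 0) = a := by
    rw [← hBB]
    simp [pair, Matrix.trace_fin_two, Matrix.mul_apply, Fin.sum_univ_two, t1]; ring
  by_cases ha : a = 0
  · subst ha
    have n2 : B 0 0 ^ 2 + B 0 1 * B 1 0 = 0 := by linear_combination n1 / 2
    by_cases h01 : B 0 1 = 0
    · have h00 : B 0 0 = 0 := by simpa [h01] using n2
      have h10 : B 1 0 ≠ 0 := by
        intro h10
        apply hB0
        ext i j; fin_cases i <;> fin_cases j <;> simp [*]
      have hBm : B = B 1 0 • mat₂ 0 0 1 := by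
        ext i j; fin_cases i <;> fin_cases j <;> simp [mat₂, h01, h00, t1]
      refine Or.inr ⟨(0, c * B 1 0), Quad.ext ?_ ?_⟩
      · change mat₂ (root 0) 0 (c * B 1 0) = x.A
        rw [root_zero, mat₂_zero, mul_smul, ← hBm, hc]
      · rw [par₂_zero_line, hl]
        conv_rhs => rw [hBm]
        rw [Submodule.span_singleton_smul_eq (IsUnit.mk0 _ h10)]
    · have hBm : B = B 0 1 • mat₁ 0 (B 0 0 / B 0 1) 1 := by
        ext i j; fin_cases i <;> fin_cases j <;> simp [mat₁, t1] <;> field_simp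
        linear_combination n2
      refine Or.inl ⟨(B 0 0 / B 0 1, c * B 0 1), Quad.ext ?_ ?_⟩
      · change mat₁ (root 0) (B 0 0 / B 0 1) (c * B 0 1) = x.A
        rw [root_zero, mat₁_zero, mul_smul, ← hBm, hc]
      · rw [par₁_zero_line, hl]
        conv_rhs => rw [hBm]
        rw [Submodule.span_singleton_smul_eq (IsUnit.mk0 _ h01)]
  · have hr : root a ≠ 0 := fun hr => ha (root_eq_zero.1 hr)
    have tA : x.A 1 1 = -x.A 0 0 := by rw [← hc]; simp [t1]
    have nA : x.A 0 0 ^ 2 + x.A 0 1 * x.A 1 0 = root a ^ 2 := by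
      have := x.pair_self
      simp [pair, Matrix.trace_fin_two, Matrix.mul_apply, Fin.sum_univ_two, tA] at this
      rw [root_sq]; linear_combination this / 2
    by_cases h01 : x.A 0 1 = 0
    · have h2 : (x.A 0 0 - root a) * (x.A 0 0 + root a) = 0 := by
        rw [h01] at nA; linear_combination nA
      rcases mul_eq_zero.1 h2 with h | h
      · have h00 : x.A 0 0 = root a := sub_eq_zero.1 h
        refine Or.inl ⟨(-x.A 1 0 / (2 * root a), 0), Quad.ext_of_ne ha ?_⟩
        ext i j; fin_cases i <;> fin_cases j <;> simp [par₁, mat₁, tA, h00, h01]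
        field_simp
      · have h00 : x.A 0 0 = -root a := eq_neg_of_add_eq_zero_left h
        refine Or.inr ⟨(0, x.A 1 0), Quad.ext_of_ne ha ?_⟩
        ext i j; fin_cases i <;> fin_cases j <;> simp [par₂, mat₂, tA, h00, h01]
    · refine Or.inl ⟨((x.A 0 0 - root a) / x.A 0 1, x.A 0 1), Quad.ext_of_ne ha ?_⟩
      have e0 : (x.A 0 0 - root a) / x.A 0 1 * x.A 0 1 = x.A 0 0 - root a := div_mul_cancel₀ _ h01
      ext i j; fin_cases i <;> fin_cases j <;> simp [par₁, mat₁, tA, e0]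
      field_simp
      linear_combination -nA

/-- The chart inverse to an injective parametrization. -/
def chartOf {a : ℂ} (f : ℂ × ℂ → Quad a) (hf : Function.Injective f) :
    PartialEquiv (Quad a) (ℂ × ℂ) where
  toFun := Function.invFun f
  invFun := f
  source := Set.range f
  target := Set.univ
  map_source' := fun _ _ => Set.mem_univ _
  map_target' := fun z _ => Set.mem_range_self z
  left_inv' := by
    rintro _ ⟨z, rfl⟩
    rw [Function.leftInverse_invFun hf z]
  right_inv' := fun z _ => Function.leftInverse_invFun hf z

/-- The chart `(p, q)`. -/
def chart₁ (a : ℂ) : PartialEquiv (Quad a) (ℂ × ℂ) := chartOf (par₁ a) (par₁_injective a)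

/-- The chart `(p', q')`. -/
def chart₂ (a : ℂ) : PartialEquiv (Quad a) (ℂ × ℂ) := chartOf (par₂ a) (par₂_injective a)

lemma isOpen_fst_ne : IsOpen {z : ℂ × ℂ | z.1 ≠ 0} :=
  isOpen_ne.preimage continuous_fst

lemma contDiffOn_trans (a : ℂ) (n : WithTop ℕ∞) :
    ContDiffOn ℂ n (trans a) {z : ℂ × ℂ | z.1 ≠ 0} := by
  unfold trans
  refine ContDiffOn.prodMk ?_ ?_
  · exact contDiffOn_const.div contDiffOn_fst (fun z hz => hz)
  · exact ContDiff.contDiffOn (by fun_prop)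

/-- Each of the four changes of charts is the identity of `ℂ²` or the map `trans` on `p ≠ 0`. -/
lemma change_cases {a : ℂ} {e e' : PartialEquiv (Quad a) (ℂ × ℂ)}
    (he : e ∈ ({chart₁ a, chart₂ a} : Set (PartialEquiv (Quad a) (ℂ × ℂ))))
    (he' : e' ∈ ({chart₁ a, chart₂ a} : Set (PartialEquiv (Quad a) (ℂ × ℂ)))) :
    ((e.symm.trans e').source = Set.univ ∧ Set.EqOn (e.symm.trans e') id Set.univ) ∨
    ((e.symm.trans e').source = {z : ℂ × ℂ | z.1 ≠ 0} ∧
      Set.EqOn (e.symm.trans e') (trans a) {z : ℂ × ℂ | z.1 ≠ 0}) := by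
  have same : ∀ (f : ℂ × ℂ → Quad a) (hf : Function.Injective f),
      (((chartOf f hf).symm.trans (chartOf f hf)).source = Set.univ ∧
        Set.EqOn ((chartOf f hf).symm.trans (chartOf f hf)) id Set.univ) := by
    intro f hf
    refine ⟨?_, fun z _ => Function.leftInverse_invFun hf z⟩
    ext z
    simp [PartialEquiv.trans_source, chartOf]
  have diff : ∀ (f g : ℂ × ℂ → Quad a) (hf : Function.Injective f) (hg : Function.Injective g),
      (∀ z w, f z = g w → z.1 ≠ 0) → (∀ z : ℂ × ℂ, z.1 ≠ 0 → g (trans a z) = f z) →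
      (((chartOf f hf).symm.trans (chartOf g hg)).source = {z : ℂ × ℂ | z.1 ≠ 0} ∧
        Set.EqOn ((chartOf f hf).symm.trans (chartOf g hg)) (trans a)
          {z : ℂ × ℂ | z.1 ≠ 0}) := by
    intro f g hf hg h1 h2
    refine ⟨?_, fun z hz => ?_⟩
    · ext z
      simp only [PartialEquiv.trans_source, chartOf, PartialEquiv.symm_source, Set.univ_inter,
        Set.mem_preimage, Set.mem_range, Set.mem_ofPred_eq, PartialEquiv.coe_symm_mk]
      exact ⟨fun ⟨w, hw⟩ => h1 z w hw.symm, fun hz => ⟨_, h2 z hz⟩⟩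
    · change Function.invFun g (f z) = trans a z
      rw [← h2 z hz, Function.leftInverse_invFun hg]
  rcases he with rfl | rfl <;> rcases he' with rfl | rfl
  · exact Or.inl (same _ _)
  · exact Or.inr (diff _ _ _ _ (fun z w h => (par_ne h).1) (par₂_trans a))
  · exact Or.inr (diff _ _ _ _ (fun z w h => (par_ne h.symm).2) (par₁_trans a))
  · exact Or.inl (same _ _)

open Classical in
/-- The two charts define the topology and the manifold structure of the quadric. -/
def quadCore (a : ℂ) : ChartedSpaceCore (ℂ × ℂ) (Quad a) where
  atlas := {chart₁ a, chart₂ a}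
  chartAt := fun x => if x ∈ Set.range (par₁ a) then chart₁ a else chart₂ a
  mem_chart_source := fun x => by
    by_cases h : x ∈ Set.range (par₁ a)
    · rw [if_pos h]; exact h
    · rw [if_neg h]; exact (mem_range_par x).resolve_left h
  chart_mem_atlas := fun x => by
    by_cases h : x ∈ Set.range (par₁ a) <;> simp [h]
  open_source := fun e e' he he' => by
    rcases change_cases he he' with h | h <;> rw [h.1]
    · exact isOpen_univ
    · exact isOpen_fst_ne
  continuousOn_toFun := fun e e' he he' => by
    rcases change_cases he he' with h | h <;> rw [h.1]
    · exact continuousOn_id.congr h.2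
    · exact (contDiffOn_trans a 0).continuousOn.congr h.2

instance (a : ℂ) : TopologicalSpace (Quad a) := (quadCore a).toTopologicalSpace

instance (a : ℂ) : ChartedSpace (ℂ × ℂ) (Quad a) := (quadCore a).toChartedSpace

/-- The quadric is a complex surface. -/
instance (a : ℂ) : IsManifold 𝓘(ℂ, ℂ × ℂ) ∞ (Quad a) := by
  refine isManifold_of_contDiffOn _ _ _ ?_
  intro e e' he he'
  have key : ∀ e : OpenPartialHomeomorph (Quad a) (ℂ × ℂ), e ∈ atlas (ℂ × ℂ) (Quad a) →
      e.toPartialEquiv ∈ (quadCore a).atlas := by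
    intro e he
    change e ∈ ⋃ (e : PartialEquiv (Quad a) (ℂ × ℂ)) (he : e ∈ (quadCore a).atlas),
      {(quadCore a).openPartialHomeomorph e he} at he
    simp only [Set.mem_iUnion, Set.mem_singleton_iff] at he
    obtain ⟨e₀, h₀, rfl⟩ := he
    exact h₀
  have h := change_cases (key e he) (key e' he')
  simp only [modelWithCornersSelf_coe, modelWithCornersSelf_coe_symm, Function.comp_id,
    Function.id_comp, Set.preimage_id, Set.range_id, Set.inter_univ]
  change ContDiffOn ℂ ∞ (e.toPartialEquiv.symm.trans e'.toPartialEquiv)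
    (e.toPartialEquiv.symm.trans e'.toPartialEquiv).source
  rcases h with h | h <;> rw [h.1]
  · exact contDiffOn_id.congr h.2
  · exact (contDiffOn_trans a ∞).congr h.2

/-! ### Products of quadrics -/

/-- The Cartesian product of the quadrics `SL|A⟩'`, `⟨A, A⟩ = a k`. -/
abbrev QuadProd {ι : Type} (a : ι → ℂ) : Type := ∀ k, Quad (a k)

/-- The product manifold structure (the charts are products of charts of the factors). -/
instance {ι : Type} [Fintype ι] (a : ι → ℂ) : ChartedSpace (ι → ℂ × ℂ) (QuadProd a) :=
  piChartedSpace (fun _ => ℂ × ℂ) (fun k => Quad (a k))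

/-! ### Differential 2-forms on complex manifolds modelled on `E` -/

section Forms

variable {E : Type} [NormedAddCommGroup E] [NormedSpace ℂ E]
variable {E' : Type} [NormedAddCommGroup E'] [NormedSpace ℂ E']

/-- A (not necessarily continuous) field of alternating bilinear forms on the tangent spaces. -/
abbrev TwoForm (E : Type) [NormedAddCommGroup E] [NormedSpace ℂ E]
    (X : Type) [TopologicalSpace X] [ChartedSpace E X] : Type :=
  ∀ x : X, (TangentSpace 𝓘(ℂ, E) x) [⋀^Fin 2]→L[ℂ] ℂ

/-- The pullback `f^* η`, `(f^* η)_x (u, v) = η_{f x} (df_x u, df_x v)`. -/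
def TwoForm.pullback {X : Type} [TopologicalSpace X] [ChartedSpace E X]
    {Y : Type} [TopologicalSpace Y] [ChartedSpace E' Y] (f : X → Y) (η : TwoForm E' Y) :
    TwoForm E X :=
  fun x => (η (f x)).compContinuousLinearMap (mfderiv 𝓘(ℂ, E) 𝓘(ℂ, E') f x)

/-- The expression of a form in a chart: the pullback by the inverse of the chart. -/
def TwoForm.inChart {X : Type} [TopologicalSpace X] [ChartedSpace E X] (η : TwoForm E X)
    (e : OpenPartialHomeomorph X E) : E → E [⋀^Fin 2]→L[ℂ] ℂ :=
  TwoForm.pullback e.symm η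

/-- A symplectic form: holomorphic, closed, non-degenerate. -/
structure TwoForm.IsSymplectic {X : Type} [TopologicalSpace X] [ChartedSpace E X]
    (η : TwoForm E X) : Prop where
  holomorphic : ∀ e ∈ atlas E X, ContDiffOn ℂ ∞ (η.inChart e) e.target
  closed : ∀ e ∈ atlas E X, ∀ z ∈ e.target, extDeriv (η.inChart e) z = 0
  nondegenerate : ∀ (x : X) (u : TangentSpace 𝓘(ℂ, E) x), (∀ v, η x ![u, v] = 0) → u = 0

/-- `φ` maps the open set `V` biholomorphically onto the open set `W`. -/
structure IsBiholomorphicOn {X : Type} [TopologicalSpace X] [ChartedSpace E X]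
    {Y : Type} [TopologicalSpace Y] [ChartedSpace E' Y] (φ : X → Y) (V : Set X) (W : Set Y) :
    Prop where
  isOpen_source : IsOpen V
  isOpen_target : IsOpen W
  bijOn : Set.BijOn φ V W
  holomorphic : ContMDiffOn 𝓘(ℂ, E) 𝓘(ℂ, E') ∞ φ V
  holomorphic_inv : ∀ ψ : Y → X, Set.LeftInvOn ψ φ V → ContMDiffOn 𝓘(ℂ, E') 𝓘(ℂ, E) ∞ ψ W

end Forms

/-- The form `dp ∧ dq` on `ℂ²`. -/
def dpdq : (ℂ × ℂ) [⋀^Fin 2]→L[ℂ] ℂ where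
  toFun v := (v 0).1 * (v 1).2 - (v 0).2 * (v 1).1
  map_update_add' v i x y := by fin_cases i <;> simp <;> ring
  map_update_smul' v i c x := by fin_cases i <;> simp <;> ring
  map_eq_zero_of_eq' v i j h hij := by
    fin_cases i <;> fin_cases j <;> simp_all <;> ring
  cont := by fun_prop

/-- The symplectic form `ω_LP = dX₃ ∧ d log X₁ = dp ∧ dq = dp' ∧ dq'` of the quadric
(the tangent space at `x` is identified with `ℂ²` by the chart chosen at `x`; the forms `dp ∧ dq`
of the two charts coincide). -/
def lpForm (a : ℂ) : TwoForm (ℂ × ℂ) (Quad a) := fun _ => dpdq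

/-- The sum `∑ ω^{(k)}` of the forms of the factors on a product of quadrics (the tangent space of
the product is the product of the tangent spaces of the factors). -/
def prodForm {ι : Type} [Fintype ι] (a : ι → ℂ) : TwoForm (ι → ℂ × ℂ) (QuadProd a) :=
  fun x => ∑ k, ContinuousAlternatingMap.compContinuousLinearMap (lpForm (a k) (x k))
    (ContinuousLinearMap.proj (R := ℂ) (φ := fun _ : ι => ℂ × ℂ) k)

/-! ### The action of `SL(2, ℂ)` and the phase spaces -/

/-- `A ↦ g A g⁻¹`. -/
def conj (g : SL2) : Mat →ₗ[ℂ] Mat where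
  toFun A := (g : Mat) * A * ((g⁻¹ : SL2) : Mat)
  map_add' A B := by simp [mul_add, add_mul]
  map_smul' c A := by simp

lemma inv_mul_coe (g : SL2) : ((g⁻¹ : SL2) : Mat) * (g : Mat) = 1 := by
  rw [← Matrix.SpecialLinearGroup.coe_mul, inv_mul_cancel, Matrix.SpecialLinearGroup.coe_one]

lemma conj_one : conj 1 = LinearMap.id := by
  ext A : 1; simp [conj]

lemma conj_mul (g h : SL2) : conj (g * h) = conj g ∘ₗ conj h := by
  refine LinearMap.ext fun A => ?_
  simp only [conj, LinearMap.coe_mk, AddHom.coe_mk, LinearMap.comp_apply, mul_inv_rev,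
    Matrix.SpecialLinearGroup.coe_mul]
  simp only [mul_assoc]

lemma trace_conj (g : SL2) (A : Mat) : (conj g A).trace = A.trace := by
  change ((g : Mat) * A * ((g⁻¹ : SL2) : Mat)).trace = _
  rw [Matrix.trace_mul_comm, ← mul_assoc, inv_mul_coe, one_mul]

lemma pair_conj (g : SL2) (A B : Mat) : pair (conj g A) (conj g B) = pair A B := by
  have : conj g A * conj g B = conj g (A * B) := by
    change (g : Mat) * A * ((g⁻¹ : SL2) : Mat) * ((g : Mat) * B * ((g⁻¹ : SL2) : Mat)) =
      (g : Mat) * (A * B) * ((g⁻¹ : SL2) : Mat)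
    calc _ = (g : Mat) * A * (((g⁻¹ : SL2) : Mat) * (g : Mat)) * B * ((g⁻¹ : SL2) : Mat) := by
          simp only [mul_assoc]
      _ = _ := by rw [inv_mul_coe]; simp only [mul_one, mul_assoc]
  rw [pair, this, trace_conj, pair]

lemma conj_ne_zero (g : SL2) {A : Mat} (h : A ≠ 0) : conj g A ≠ 0 := by
  intro h0
  apply h
  have : conj g⁻¹ (conj g A) = A := by
    rw [← LinearMap.comp_apply, ← conj_mul, inv_mul_cancel, conj_one]; rfl
  rw [← this, h0, map_zero]

/-- `SL(2, ℂ)` acts on the quadric by conjugation of both components. -/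
instance (a : ℂ) : MulAction SL2 (Quad a) where
  smul g x :=
    { A := conj g x.A
      line := x.line.map (conj g)
      line_mem := by
        obtain ⟨B, ⟨h0, ht, hB⟩, hl⟩ := x.line_mem
        refine ⟨conj g B, ⟨conj_ne_zero g h0, by rw [trace_conj, ht], by rw [pair_conj, hB]⟩, ?_⟩
        rw [hl, Submodule.map_span, Set.image_singleton]
      mem_line := Submodule.mem_map_of_mem x.mem_line
      pair_self := by rw [pair_conj, x.pair_self] }
  one_smul x := by
    refine Quad.ext ?_ ?_
    · change conj 1 x.A = x.A
      rw [conj_one]; rfl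
    · change x.line.map (conj 1) = x.line
      rw [conj_one, Submodule.map_id]
  mul_smul g h x := by
    refine Quad.ext ?_ ?_
    · change conj (g * h) x.A = conj g (conj h x.A)
      rw [conj_mul]; rfl
    · change x.line.map (conj (g * h)) = (x.line.map (conj h)).map (conj g)
      rw [conj_mul, Submodule.map_comp]

/-- All the matrices can be carried into the upper-triangular form simultaneously. -/
def Triangular {ι : Type} (A : ι → Mat) : Prop := ∃ g : SL2, ∀ k, conj g (A k) 1 0 = 0

variable {n : ℕ}

/-- The space `M̃`: points of the product of `n + 1` quadrics whose affine components are not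
simultaneously triangularizable and satisfy `∑ A^{(k)} = 0`. -/
def MTilde (a : Fin (n + 1) → ℂ) : Type :=
  {x : QuadProd a // ¬ Triangular (fun k => (x k).A) ∧ ∑ k, (x k).A = 0}

/-- The inclusion of `M̃` into the product of quadrics. -/
def MTilde.incl (a : Fin (n + 1) → ℂ) : MTilde a → QuadProd a := Subtype.val

/-- `M̃` has the topology of a subspace of the product. -/
instance (a : Fin (n + 1) → ℂ) : TopologicalSpace (MTilde a) :=
  TopologicalSpace.induced (MTilde.incl a) inferInstance

/-- Two points of `M̃` are equivalent if they belong to one orbit of `SL(2, ℂ)`. -/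
def orbitSetoid (a : Fin (n + 1) → ℂ) : Setoid (MTilde a) :=
  (MulAction.orbitRel SL2 (QuadProd a)).comap (MTilde.incl a)

/-- The phase space `M = M̃ / SL(2, ℂ)`. -/
def M (a : Fin (n + 1) → ℂ) : Type := Quotient (orbitSetoid a)

/-- The quotient map `π̃`. -/
def proj (a : Fin (n + 1) → ℂ) : MTilde a → M a := Quotient.mk (orbitSetoid a)

/-- `M` has the quotient topology. -/
instance (a : Fin (n + 1) → ℂ) : TopologicalSpace (M a) :=
  TopologicalSpace.coinduced (proj a) inferInstance

/-! ### Accompanying bases and charts -/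

open Classical in
/-- The line `(σ^{(s)})`, where `s² = 2 a`: the eigenspace `[A, σ] = s σ` of `ad_A` in `sl(2, ℂ)` if
`A ≠ 0`, and the projective component if `A = 0`. -/
def sigmaLine {a : ℂ} (s : ℂ) (x : Quad a) : Set Mat :=
  if x.A = 0 then x.line else {B | B.trace = 0 ∧ x.A * B - B * x.A = s • B}

/-- A triple of matrices, to be thought of as `σ₋, σ₊, σ₃`. -/
@[ext]
structure Triple where
  /-- `σ₋` -/
  m : Mat
  /-- `σ₊` -/
  p : Mat
  /-- `σ₃` -/
  z : Mat

/-- The standard bases of `sl(2, ℂ)`. -/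
structure Triple.IsStandard (σ : Triple) : Prop where
  trace_m : σ.m.trace = 0
  trace_p : σ.p.trace = 0
  trace_z : σ.z.trace = 0
  mm : pair σ.m σ.m = 0
  pp : pair σ.p σ.p = 0
  mz : pair σ.m σ.z = 0
  pz : pair σ.p σ.z = 0
  pm : pair σ.p σ.m = 1
  lie : σ.p * σ.m - σ.m * σ.p = σ.z

/-- The standard basis `σ` is accompanying to `A^{(0)}, A^{(i)}, A^{(j)}` along `(σ^{(-s₀)})` and
`(σ^{(sᵢ)})`. -/
structure Accompanying {a : Fin (n + 1) → ℂ} (s : Fin (n + 1) → ℂ) (i j : Fin (n + 1))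
    (x : QuadProd a) (σ : Triple) : Prop where
  standard : σ.IsStandard
  mem_m : σ.m ∈ sigmaLine (-s 0) (x 0)
  mem_p : σ.p ∈ sigmaLine (s i) (x i)
  pair_m : pair σ.m (x j).A = 1

/-- The set `Ũ(-s₀ // sᵢ / j)`. -/
def UTilde (a : Fin (n + 1) → ℂ) (s : Fin (n + 1) → ℂ) (i j : Fin (n + 1)) : Set (MTilde a) :=
  {x | (∃ B ∈ sigmaLine (-s 0) (x.1 0), ∃ C ∈ sigmaLine (s i) (x.1 i), pair B C ≠ 0) ∧
    ∃ B ∈ sigmaLine (-s 0) (x.1 0), pair B (x.1 j).A ≠ 0}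

/-- The set `U(-s₀ // sᵢ / j) = π̃(Ũ(-s₀ // sᵢ / j))`. -/
def U (a : Fin (n + 1) → ℂ) (s : Fin (n + 1) → ℂ) (i j : Fin (n + 1)) : Set (M a) :=
  proj a '' UTilde a s i j

/-- The matrix `(β q; q' -β)` of an element of `sl(2, ℂ)` in a standard basis:
`β = ⟨σ₃ / 2, A⟩`, `q = ⟨σ₋, A⟩`, `q' = ⟨σ₊, A⟩`. -/
def Triple.coord (σ : Triple) : Mat →ₗ[ℂ] Mat where
  toFun A := !![pair σ.z A / 2, pair σ.m A; pair σ.p A, -(pair σ.z A / 2)]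
  map_add' A B := by
    ext i j; fin_cases i <;> fin_cases j <;> simp [pair, mul_add] <;> ring
  map_smul' c A := by
    ext i j; fin_cases i <;> fin_cases j <;> simp [pair] <;> ring

/-- The indices different from `0, i, j`; there are `n - 2` of them if `0, i, j` are distinct. -/
abbrev Rest (i j : Fin (n + 1)) : Type := {k : Fin (n + 1) // k ≠ 0 ∧ k ≠ i ∧ k ≠ j}

/-- The parameters of the quadrics that are left when `0, i, j` are rejected. -/
abbrev rest (a : Fin (n + 1) → ℂ) (i j : Fin (n + 1)) : Rest i j → ℂ := fun k => a k

/-- The polynomial formulas that restore all the matrices `A^{(0)}, …, A^{(n)}` in the accompanying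
basis from those with indices different from `0, i, j`:
`A^{(0)} = (s₀/2 0; q'₀ -s₀/2)`, `A^{(i)} = (sᵢ/2 qᵢ; 0 -sᵢ/2)`, `A^{(j)} = (βⱼ 1; q'ⱼ -βⱼ)`
with `βⱼ = -(s₀/2 + sᵢ/2 + β_Σ)`, `q'ⱼ = aⱼ/2 - βⱼ²`, `qᵢ = -(q_Σ + 1)`, `q'₀ = -(q'_Σ + q'ⱼ)`. -/
def restore (a : Fin (n + 1) → ℂ) (s : Fin (n + 1) → ℂ) (i j : Fin (n + 1))
    (y : QuadProd (rest a i j)) : Fin (n + 1) → Mat :=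
  let S : Mat := ∑ k, (y k).A
  let β : ℂ := -(s 0 / 2 + s i / 2 + S 0 0)
  let q' : ℂ := a j / 2 - β ^ 2
  fun k =>
    if h : k ≠ 0 ∧ k ≠ i ∧ k ≠ j then (y ⟨k, h⟩).A
    else if k = 0 then !![s 0 / 2, 0; -(S 1 0 + q'), -(s 0 / 2)]
    else if k = i then !![s i / 2, -(S 0 1 + 1); 0, -(s i / 2)]
    else !![β, 1; q', -β]

/-- The coordinate map `π_{0ij} : U(-s₀ // sᵢ / j) → ∏_{k ≠ 0, i, j} SL|A^{(k)}⟩'`: the matrices (and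
the projective components) in the accompanying basis, with those of indices `0, i, j` rejected. -/
def IsCoordinateMap (a : Fin (n + 1) → ℂ) (s : Fin (n + 1) → ℂ) (i j : Fin (n + 1))
    (φ : M a → QuadProd (rest a i j)) : Prop :=
  ∀ x ∈ UTilde a s i j, ∀ σ : Triple, Accompanying s i j x.1 σ → ∀ k : Rest i j,
    (φ (proj a x) k).A = σ.coord (x.1 k).A ∧
    (φ (proj a x) k).line = (x.1 k).line.map σ.coord

end Garnier

end

/-! A point `(A, ℓ)` of the quadric with a chosen root `ρ`, `2ρ² = a`, is the same as a vector `v ≠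
0` and a covector `w` with `w·v = 2ρ` and `A + ρ = v w`, up to `(v, w) ↦ (c v, c⁻¹ w)`. At the
vertex of the cone `w = 0` and `v` remembers the line, so blown-up and ordinary quadrics are treated
alike (`IsLift`). This presents the quadric as a reduction of the space of pairs `(v, w)`, and its
symplectic form is `dw ∧ dv` for any holomorphic lift (`lpForm_of_isLift`). The charts `(p, q)` and
`(p', q')` are the gauges `v₀ = 1` and `v₁ = 1`. The group acts linearly on lifts.

Lift `A^{(0)}` with eigenvalue `-s₀/2` and the other `A^{(k)}` with `s_k/2`. If `det (v_i, v_0)` and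
`⟨A^{(j)} v_0, v_0⟩` (`delta`) are non-zero, then `v_i` and a multiple of `v_0` form a basis of
`ℂ²`, in which `v_0`, `v_i` point along the axes and the upper right entry of `A^{(j)}` is `1`. This
normal form is unique in its orbit, depends holomorphically on the point, and expresses the
accompanying basis. When the matrices have zero sum, the factors with indices `0, i, j` of the
normal form are polynomials in the rest. Hence the other `n - 2` factors are coordinates on the
quotient, with an explicit inverse (`sectionMap`).

The identity of forms is a moment map computation. Let `H` be the matrix of the basis, `v_k = H
V_k`, `W_k = w_k H`. The difference of `∑ dw_k ∧ dv_k` and `∑ dW_k ∧ dV_k` depends only on `dH` and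
on the variation of `P = ∑ V_k w_k` (`wedge_frame`). Zero sum of the `A^{(k)}` makes `H P` a
constant scalar matrix, so `dP = -c H⁻¹ dH H⁻¹`, and the difference vanishes by cyclicity of the
trace (`trace_variation`). In the normal form each of the factors `0, i, j` varies in one parameter
only, so its 2-form vanishes, and the other factors remain (`prodForm_pullback_normalize`).

The charts cover `M`: the numbers `⟨A^{(k)} v_0, v_0⟩` have zero sum, vanish for `k = 0`, and are
not all zero by irreducibility, so two of them with positive indices are non-zero
(`exists_mem_domain`). `M` is Hausdorff because intertwining operators of norm one have non-zero
limits, and a non-zero intertwiner from an irreducible family is invertible. The structures on `M`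
and `M̃` come from local slices, with three parameters of the basis added for `M̃`. The form on `M`
is pulled back from any coordinate map; the choice is immaterial because `π̃` is a submersion.
Finally, a common eigenvector of matrices with zero sum has eigenvalues `±s_k/2` of zero sum, so if
no such sum vanishes, the image of each chart is everything. -/

open scoped Matrix

noncomputable section

namespace Garnier

/-! ### Manifold structures on quotients of subspaces, from local slices -/

section Slices

variable {S X N E EN : Type} [TopologicalSpace S] [TopologicalSpace X] [TopologicalSpace N]
  [NormedAddCommGroup E] [NormedSpace ℂ E] [NormedAddCommGroup EN] [NormedSpace ℂ EN]
  [ChartedSpace EN N]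

/-- A local slice of the quotient `π : S → X` of a subspace `ι : S → N` of a manifold: the map `f`
parametrizes a neighbourhood of `x` by an open set `V` of `E`, and the coordinates are the
restriction of a holomorphic map `g` defined on an open set `O` of `N`. -/
structure Slice (E EN : Type) [NormedAddCommGroup E] [NormedSpace ℂ E] [NormedAddCommGroup EN]
    [NormedSpace ℂ EN] [ChartedSpace EN N] (ι : S → N) (π : S → X) (x : X) where
  /-- the parametrization -/
  f : E → S
  /-- the coordinates -/
  g : N → E
  /-- the domain of the parametrization -/
  V : Set E
  /-- the domain of the coordinates -/
  O : Set N
  isOpen_V : IsOpen V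
  isOpen_O : IsOpen O
  smooth_f : ContMDiffOn 𝓘(ℂ, E) 𝓘(ℂ, EN) ∞ (ι ∘ f) V
  smooth_g : ContMDiffOn 𝓘(ℂ, EN) 𝓘(ℂ, E) ∞ g O
  mem_O : ∀ z ∈ V, ι (f z) ∈ O
  g_f : ∀ z ∈ V, g (ι (f z)) = z
  mem_V : ∀ s, ι s ∈ O → g (ι s) ∈ V
  f_g : ∀ s, ι s ∈ O → π (f (g (ι s))) = π s
  saturated : ∀ s s', π s = π s' → ι s ∈ O → ι s' ∈ O
  invariant : ∀ s s', π s = π s' → ι s ∈ O → g (ι s) = g (ι s')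
  base : ∃ s, π s = x ∧ ι s ∈ O

variable {ι : S → N} {π : S → X} (hι : Topology.IsInducing ι) (hπ : IsOpenQuotientMap π)

namespace Slice

/-- The chart defined by a slice. -/
def chart (hι : Topology.IsInducing ι) (hπ : IsOpenQuotientMap π) {x : X} (c : Slice E EN ι π x) :
    OpenPartialHomeomorph X E where
  -- An arbitrary representative serves, since `g` is constant on the fibres of `π` over the slice
  -- (`invariant`).
  toFun y := c.g (ι (Function.surjInv hπ.surjective y))
  invFun z := π (c.f z)
  source := π '' (ι ⁻¹' c.O)
  target := c.V
  map_source' := by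
    rintro _ ⟨s, hs, rfl⟩
    exact c.mem_V _ (c.saturated s _ (Function.surjInv_eq hπ.surjective _).symm hs)
  map_target' z hz := ⟨c.f z, c.mem_O z hz, rfl⟩
  left_inv' := by
    rintro _ ⟨s, hs, rfl⟩
    rw [← c.invariant s _ (Function.surjInv_eq hπ.surjective _).symm hs, c.f_g s hs]
  right_inv' z hz := by
    rw [← c.invariant (c.f z) _ (Function.surjInv_eq hπ.surjective _).symm (c.mem_O z hz),
      c.g_f z hz]
  open_source := hπ.isOpenMap _ (c.isOpen_O.preimage hι.continuous)
  open_target := c.isOpen_V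
  continuousOn_toFun := by
    rintro _ ⟨s, hs, rfl⟩
    refine ContinuousAt.continuousWithinAt ?_
    rw [← hπ.continuousAt_comp_iff]
    have hO : ι ⁻¹' c.O ∈ 𝓝 s := (c.isOpen_O.preimage hι.continuous).mem_nhds hs
    have h1 : ContinuousAt (c.g ∘ ι) s :=
      ContinuousAt.comp ((c.smooth_g.continuousOn).continuousAt (c.isOpen_O.mem_nhds hs))
        hι.continuous.continuousAt
    refine h1.congr ?_
    filter_upwards [hO] with t ht
    exact c.invariant t _ (Function.surjInv_eq hπ.surjective _).symm ht
  continuousOn_invFun := by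
    refine hπ.continuous.comp_continuousOn ?_
    rw [hι.continuousOn_iff]
    exact c.smooth_f.continuousOn

lemma chart_apply {x : X} (c : Slice E EN ι π x) {s : S} (hs : ι s ∈ c.O) :
    c.chart hι hπ (π s) = c.g (ι s) :=
  (c.invariant s _ (Function.surjInv_eq hπ.surjective _).symm hs).symm

lemma mem_chart_source_iff {x : X} (c : Slice E EN ι π x) {s : S} :
    π s ∈ (c.chart hι hπ).source ↔ ι s ∈ c.O :=
  ⟨fun ⟨t, ht, h⟩ => c.saturated t s h ht, fun h => ⟨s, h, rfl⟩⟩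

lemma mem_chart_source {x : X} (c : Slice E EN ι π x) : x ∈ (c.chart hι hπ).source := by
  obtain ⟨s, rfl, hs⟩ := c.base
  exact ⟨s, hs, rfl⟩

/-- The charted space structure defined by slices at all points. -/
@[reducible]
def chartedSpace (c : ∀ x, Slice E EN ι π x) : ChartedSpace E X where
  atlas := Set.range fun x => (c x).chart hι hπ
  chartAt x := (c x).chart hι hπ
  mem_chart_source x := (c x).mem_chart_source hι hπ
  chart_mem_atlas x := ⟨x, rfl⟩

/-- A transition map is `g` of one slice composed with `ι ∘ f` of the other. Both factors are
holomorphic through the ambient manifold `N`, so no structure on `S` is needed. -/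
lemma isManifold (c : ∀ x, Slice E EN ι π x) :
    letI := chartedSpace hι hπ c
    IsManifold 𝓘(ℂ, E) ∞ X := by
  let _ := chartedSpace hι hπ c
  refine isManifold_of_contDiffOn _ _ _ ?_
  rintro _ _ ⟨x, rfl⟩ ⟨y, rfl⟩
  simp only [modelWithCornersSelf_coe, modelWithCornersSelf_coe_symm, Function.comp_id,
    Function.id_comp, Set.preimage_id, Set.range_id, Set.inter_univ]
  rw [← contMDiffOn_iff_contDiffOn]
  have hO : ∀ z ∈ (((c x).chart hι hπ).symm.trans ((c y).chart hι hπ)).source,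
      z ∈ (c x).V ∧ ι ((c x).f z) ∈ (c y).O := by
    intro z hz
    rw [OpenPartialHomeomorph.trans_source] at hz
    exact ⟨hz.1, ((c y).mem_chart_source_iff hι hπ).1 hz.2⟩
  refine ContMDiffOn.congr (f := (c y).g ∘ (ι ∘ (c x).f)) ?_ ?_
  · exact (c y).smooth_g.comp ((c x).smooth_f.mono fun z hz => (hO z hz).1) fun z hz => (hO z hz).2
  · intro z hz
    exact (c y).chart_apply hι hπ (hO z hz).2

/-- A map on `X` is holomorphic if its composition with `π` extends to a holomorphic map on an open
subset of `N`. -/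
lemma contMDiffAt_source (c : ∀ x, Slice E EN ι π x) {EY Y : Type} [NormedAddCommGroup EY]
    [NormedSpace ℂ EY] [TopologicalSpace Y] [ChartedSpace EY Y] {F : X → Y} {F' : N → Y}
    {O' : Set N} (hO' : IsOpen O') (hF : ContMDiffOn 𝓘(ℂ, EN) 𝓘(ℂ, EY) ∞ F' O')
    (h : ∀ t, ι t ∈ O' → F (π t) = F' (ι t)) {x : X} (hx : ∀ t, π t = x → ι t ∈ O') :
    letI := chartedSpace hι hπ c
    ContMDiffAt 𝓘(ℂ, E) 𝓘(ℂ, EY) ∞ F x := by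
  let _ := chartedSpace hι hπ c
  rw [contMDiffAt_iff_source]
  obtain ⟨s, hs, hsO⟩ := (c x).base
  have hz0 := (c x).mem_V s hsO
  have e1 : extChartAt 𝓘(ℂ, E) x x = (c x).g (ι s) := by
    have := (c x).chart_apply hι hπ hsO
    rw [hs] at this
    exact this
  rw [e1]
  refine ContMDiffAt.contMDiffWithinAt ?_
  -- The representative of `x` on the slice may differ from `s`; this is why `O'` has to contain the
  -- whole fibre.
  have hfz : ι ((c x).f ((c x).g (ι s))) ∈ O' := hx _ (by rw [(c x).f_g s hsO, hs])
  have hf := (c x).smooth_f.contMDiffAt ((c x).isOpen_V.mem_nhds hz0)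
  refine ((hF.contMDiffAt (hO'.mem_nhds hfz)).comp ((c x).g (ι s)) hf).congr_of_eventuallyEq ?_
  filter_upwards [hf.continuousAt.preimage_mem_nhds (hO'.mem_nhds hfz)] with z hz
  exact h _ hz

/-- A map to `X` is holomorphic if it lifts to a holomorphic map to `N` with values in `S`. -/
lemma contMDiffAt_target (c : ∀ x, Slice E EN ι π x) {ET T : Type} [NormedAddCommGroup ET]
    [NormedSpace ℂ ET] [TopologicalSpace T] [ChartedSpace ET T] {G : T → X} {G' : T → S} {t : T}
    (hG : ContMDiffAt 𝓘(ℂ, ET) 𝓘(ℂ, EN) ∞ (ι ∘ G') t) (h : ∀ᶠ u in 𝓝 t, G u = π (G' u)) :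
    letI := chartedSpace hι hπ c
    ContMDiffAt 𝓘(ℂ, ET) 𝓘(ℂ, E) ∞ G t := by
  let _ := chartedSpace hι hπ c
  rw [contMDiffAt_iff_target]
  have hc' : ContinuousAt G' t := hι.continuousAt_iff.2 hG.continuousAt
  have hO : ι (G' t) ∈ (c (G t)).O := by
    refine ((c (G t)).mem_chart_source_iff hι hπ).1 ?_
    rw [← h.self_of_nhds]
    exact (c (G t)).mem_chart_source hι hπ
  refine ⟨(hπ.continuous.continuousAt.comp hc').congr (h.mono fun u hu => hu.symm), ?_⟩
  have hg := (c (G t)).smooth_g.contMDiffAt ((c (G t)).isOpen_O.mem_nhds hO)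
  refine (hg.comp t hG).congr_of_eventuallyEq ?_
  filter_upwards [h, hG.continuousAt.preimage_mem_nhds ((c (G t)).isOpen_O.mem_nhds hO)]
    with u hu hu'
  change (c (G t)).chart hι hπ (G u) = _
  rw [hu]
  exact (c (G t)).chart_apply hι hπ hu'

end Slice

end Slices

/-! ### The charts of the quadric -/

/-- The chart `(p, q)` as a member of the atlas. -/
def openChart₁ (a : ℂ) : OpenPartialHomeomorph (Quad a) (ℂ × ℂ) :=
  (quadCore a).openPartialHomeomorph (chart₁ a) (Or.inl rfl)

/-- The chart `(p', q')` as a member of the atlas. -/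
def openChart₂ (a : ℂ) : OpenPartialHomeomorph (Quad a) (ℂ × ℂ) :=
  (quadCore a).openPartialHomeomorph (chart₂ a) (Or.inr rfl)

lemma openChart₁_mem_atlas (a : ℂ) : openChart₁ a ∈ atlas (ℂ × ℂ) (Quad a) :=
  Set.mem_iUnion₂.2 ⟨chart₁ a, Or.inl rfl, rfl⟩

lemma openChart₂_mem_atlas (a : ℂ) : openChart₂ a ∈ atlas (ℂ × ℂ) (Quad a) :=
  Set.mem_iUnion₂.2 ⟨chart₂ a, Or.inr rfl, rfl⟩

lemma mem_atlas_quad {a : ℂ} {e : OpenPartialHomeomorph (Quad a) (ℂ × ℂ)}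
    (he : e ∈ atlas (ℂ × ℂ) (Quad a)) : e = openChart₁ a ∨ e = openChart₂ a := by
  obtain ⟨e₀, h₀, h⟩ := Set.mem_iUnion₂.1 he
  rcases h₀ with rfl | rfl
  · exact Or.inl h
  · exact Or.inr h

lemma chartAt_quad_pos {a : ℂ} {x : Quad a} (h : x ∈ Set.range (par₁ a)) :
    chartAt (ℂ × ℂ) x = openChart₁ a := by
  have : (quadCore a).chartAt x = chart₁ a := if_pos h
  change (quadCore a).openPartialHomeomorph ((quadCore a).chartAt x) _ = _
  simp only [this]
  rfl

lemma chartAt_quad_neg {a : ℂ} {x : Quad a} (h : x ∉ Set.range (par₁ a)) :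
    chartAt (ℂ × ℂ) x = openChart₂ a := by
  have : (quadCore a).chartAt x = chart₂ a := if_neg h
  change (quadCore a).openPartialHomeomorph ((quadCore a).chartAt x) _ = _
  simp only [this]
  rfl

lemma openChart₁_par₁ (a : ℂ) (z : ℂ × ℂ) : openChart₁ a (par₁ a z) = z :=
  Function.leftInverse_invFun (par₁_injective a) z

lemma openChart₂_par₂ (a : ℂ) (z : ℂ × ℂ) : openChart₂ a (par₂ a z) = z :=
  Function.leftInverse_invFun (par₂_injective a) z

lemma contMDiff_par₁ (a : ℂ) : ContMDiff 𝓘(ℂ, ℂ × ℂ) 𝓘(ℂ, ℂ × ℂ) ∞ (par₁ a) := by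
  have := contMDiffOn_symm_of_mem_maximalAtlas
    (IsManifold.subset_maximalAtlas (I := 𝓘(ℂ, ℂ × ℂ)) (n := ∞) (openChart₁_mem_atlas a))
  rwa [show (openChart₁ a).target = Set.univ from rfl, contMDiffOn_univ] at this

lemma contMDiff_par₂ (a : ℂ) : ContMDiff 𝓘(ℂ, ℂ × ℂ) 𝓘(ℂ, ℂ × ℂ) ∞ (par₂ a) := by
  have := contMDiffOn_symm_of_mem_maximalAtlas
    (IsManifold.subset_maximalAtlas (I := 𝓘(ℂ, ℂ × ℂ)) (n := ∞) (openChart₂_mem_atlas a))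
  rwa [show (openChart₂ a).target = Set.univ from rfl, contMDiffOn_univ] at this

lemma contMDiffOn_openChart₁ (a : ℂ) :
    ContMDiffOn 𝓘(ℂ, ℂ × ℂ) 𝓘(ℂ, ℂ × ℂ) ∞ (openChart₁ a) (Set.range (par₁ a)) :=
  contMDiffOn_of_mem_maximalAtlas
    (IsManifold.subset_maximalAtlas (I := 𝓘(ℂ, ℂ × ℂ)) (n := ∞) (openChart₁_mem_atlas a))

lemma contMDiffOn_openChart₂ (a : ℂ) :
    ContMDiffOn 𝓘(ℂ, ℂ × ℂ) 𝓘(ℂ, ℂ × ℂ) ∞ (openChart₂ a) (Set.range (par₂ a)) :=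
  contMDiffOn_of_mem_maximalAtlas
    (IsManifold.subset_maximalAtlas (I := 𝓘(ℂ, ℂ × ℂ)) (n := ∞) (openChart₂_mem_atlas a))

lemma isOpen_range_par₁ (a : ℂ) : IsOpen (Set.range (par₁ a)) := (openChart₁ a).open_source

lemma isOpen_range_par₂ (a : ℂ) : IsOpen (Set.range (par₂ a)) := (openChart₂ a).open_source

/-- The derivative of a map to a manifold modelled on `E'`, read in the chart at the image point. -/
lemma mfderiv_eq_fderiv_chart {E E' Y : Type} [NormedAddCommGroup E] [NormedSpace ℂ E]
    [NormedAddCommGroup E'] [NormedSpace ℂ E'] [TopologicalSpace Y] [ChartedSpace E' Y]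
    {F : E → Y} {z : E} (hF : MDifferentiableAt 𝓘(ℂ, E) 𝓘(ℂ, E') F z) :
    mfderiv 𝓘(ℂ, E) 𝓘(ℂ, E') F z = fderiv ℂ (chartAt E' (F z) ∘ F) z := by
  refine hF.mfderiv.trans ?_
  change fderivWithin ℂ (writtenInExtChartAt 𝓘(ℂ, E) 𝓘(ℂ, E') z F) (Set.range id) z = _
  rw [Set.range_id, fderivWithin_univ]
  rfl

lemma fderiv_trans (a : ℂ) {z : ℂ × ℂ} (hz : z.1 ≠ 0) (u : ℂ × ℂ) :
    fderiv ℂ (trans a) z u =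
      (-u.1 / z.1 ^ 2, -(2 * z.1 * z.2 + 2 * root a) * u.1 - z.1 ^ 2 * u.2) := by
  have h1 : HasFDerivAt (fun z : ℂ × ℂ => z.1) (ContinuousLinearMap.fst ℂ ℂ ℂ) z := hasFDerivAt_fst
  have h2 : HasFDerivAt (fun z : ℂ × ℂ => z.2) (ContinuousLinearMap.snd ℂ ℂ ℂ) z := hasFDerivAt_snd
  have h3 := ((hasDerivAt_inv hz).comp_hasFDerivAt z h1).prodMk (h1.neg.mul ((h1.mul h2).add_const (2 * root a)))
  have h4 : trans a = fun z => (z.1⁻¹, -z.1 * (z.1 * z.2 + 2 * root a)) := by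
    funext z; simp [trans]
  have h5 := h3.congr_of_eventuallyEq (f₁ := trans a) (Filter.Eventually.of_forall fun z => by
    rw [h4]; rfl)
  rw [h5.fderiv]
  ext
  · simp; field_simp
  · simp; ring

lemma dpdq_apply (u v : ℂ × ℂ) : dpdq ![u, v] = u.1 * v.2 - u.2 * v.1 := rfl

lemma twoForm_ext {E : Type} [NormedAddCommGroup E] [NormedSpace ℂ E] {η θ : E [⋀^Fin 2]→L[ℂ] ℂ}
    (h : ∀ u v, η ![u, v] = θ ![u, v]) : η = θ := by
  ext m
  have : m = ![m 0, m 1] := by ext i; fin_cases i <;> rfl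
  rw [this, h]

/-- `dp ∧ dq` is the expression of the form in the chart `(p, q)`. -/
lemma lpForm_par₁ (a : ℂ) (z u v : ℂ × ℂ) :
    lpForm a (par₁ a z) ![mfderiv 𝓘(ℂ, ℂ × ℂ) 𝓘(ℂ, ℂ × ℂ) (par₁ a) z u,
      mfderiv 𝓘(ℂ, ℂ × ℂ) 𝓘(ℂ, ℂ × ℂ) (par₁ a) z v] = dpdq ![u, v] := by
  have h : mfderiv 𝓘(ℂ, ℂ × ℂ) 𝓘(ℂ, ℂ × ℂ) (par₁ a) z = ContinuousLinearMap.id ℂ (ℂ × ℂ) := by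
    rw [mfderiv_eq_fderiv_chart ((contMDiff_par₁ a).mdifferentiableAt (by simp)),
      chartAt_quad_pos ⟨z, rfl⟩]
    have : (openChart₁ a) ∘ par₁ a = id := funext fun z => openChart₁_par₁ a z
    rw [this, fderiv_id]
  rw [h]
  rfl

/-- `dp' ∧ dq'` is the expression of the form in the chart `(p', q')`. -/
lemma lpForm_par₂ (a : ℂ) (z u v : ℂ × ℂ) :
    lpForm a (par₂ a z) ![mfderiv 𝓘(ℂ, ℂ × ℂ) 𝓘(ℂ, ℂ × ℂ) (par₂ a) z u,
      mfderiv 𝓘(ℂ, ℂ × ℂ) 𝓘(ℂ, ℂ × ℂ) (par₂ a) z v] = dpdq ![u, v] := by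
  rw [mfderiv_eq_fderiv_chart ((contMDiff_par₂ a).mdifferentiableAt (by simp))]
  -- The preferred chart is `(p, q)` wherever it is defined. So `(p', q')` is itself the preferred
  -- chart only on `p' = 0`; elsewhere the form is read through `trans`, whose Jacobian is `1`.
  by_cases hz : z.1 = 0
  · have hn : par₂ a z ∉ Set.range (par₁ a) := by
      rintro ⟨w, hw⟩
      exact (par_ne hw).2 hz
    rw [chartAt_quad_neg hn]
    have : (openChart₂ a) ∘ par₂ a = id := funext fun z => openChart₂_par₂ a z
    rw [this, fderiv_id]
    rfl
  · rw [chartAt_quad_pos ⟨trans a z, par₁_trans a z hz⟩]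
    have : (openChart₁ a) ∘ par₂ a =ᶠ[𝓝 z] trans a := by
      filter_upwards [isOpen_fst_ne.mem_nhds hz] with w hw
      rw [Function.comp_apply, ← par₁_trans a w hw, openChart₁_par₁]
    rw [this.fderiv_eq]
    change dpdq ![fderiv ℂ (trans a) z u, fderiv ℂ (trans a) z v] = _
    rw [fderiv_trans a hz, fderiv_trans a hz, dpdq_apply, dpdq_apply]
    field_simp
    ring

/-! ### Lifts of points of the quadric to pairs of a vector and a covector -/

/-- The determinant of two vectors. -/
def det₂ (u v : Fin 2 → ℂ) : ℂ := u 0 * v 1 - u 1 * v 0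

lemma vec_ne_zero {v : Fin 2 → ℂ} : v ≠ 0 ↔ v 0 ≠ 0 ∨ v 1 ≠ 0 := by
  rw [← not_and_or, not_iff_not]
  exact ⟨fun h => by simp [h], fun h => by ext i; fin_cases i <;> simp [h]⟩

lemma eq_smul_of_det₂_eq_zero {u v : Fin 2 → ℂ} (hv : v ≠ 0) (h : det₂ u v = 0) :
    ∃ c : ℂ, u = c • v := by
  rw [det₂] at h
  rcases vec_ne_zero.1 hv with h0 | h0
  · refine ⟨u 0 / v 0, ?_⟩
    ext i; fin_cases i
    · simp [h0]
    · simp; field_simp; linear_combination -h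
  · refine ⟨u 1 / v 1, ?_⟩
    ext i; fin_cases i
    · simp; field_simp; linear_combination h
    · simp [h0]

/-- The traceless nilpotent matrix with kernel and image spanned by `v`. -/
def nilp (v : Fin 2 → ℂ) : Mat := !![v 0 * v 1, -v 0 ^ 2; v 1 ^ 2, -(v 0 * v 1)]

lemma nilp_ne_zero {v : Fin 2 → ℂ} (hv : v ≠ 0) : nilp v ≠ 0 := by
  intro h
  have h0 : v 0 = 0 := by simpa [nilp] using congrFun (congrFun h 0) 1
  have h1 : v 1 = 0 := by simpa [nilp] using congrFun (congrFun h 1) 0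
  rcases vec_ne_zero.1 hv with h | h <;> contradiction

lemma nilp_mem_orbitSet {v : Fin 2 → ℂ} (hv : v ≠ 0) : nilp v ∈ orbitSet 0 := by
  refine ⟨nilp_ne_zero hv, by simp [nilp, Matrix.trace_fin_two], ?_⟩
  simp [pair, nilp, Matrix.trace_fin_two]; ring

lemma nilp_mulVec (v u : Fin 2 → ℂ) : nilp v *ᵥ u = det₂ u v • v := by
  ext i; fin_cases i <;> simp [nilp, det₂, Matrix.mulVec, dotProduct, Fin.sum_univ_two] <;> ring

lemma mat_ext {A B : Mat} (h00 : A 0 0 = B 0 0) (h01 : A 0 1 = B 0 1) (h10 : A 1 0 = B 1 0)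
    (h11 : A 1 1 = B 1 1) : A = B := by
  ext i j; fin_cases i <;> fin_cases j <;> assumption

/-- A nilpotent matrix with the eigenvector `v` is proportional to `nilp v`. -/
lemma eq_smul_nilp {B : Mat} (hB : B ∈ orbitSet 0) {v : Fin 2 → ℂ} (hv : v ≠ 0) {c : ℂ}
    (h : B *ᵥ v = c • v) : ∃ d : ℂ, d ≠ 0 ∧ B = d • nilp v := by
  obtain ⟨hB0, ht, hp⟩ := hB
  have t1 : B 1 1 = -B 0 0 := by rw [Matrix.trace_fin_two] at ht; linear_combination ht
  have n1 : B 0 0 ^ 2 + B 0 1 * B 1 0 = 0 := by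
    simp [pair, Matrix.trace_fin_two, Matrix.mul_apply, Fin.sum_univ_two, t1] at hp
    linear_combination hp / 2
  have e0 : B 0 0 * v 0 + B 0 1 * v 1 = c * v 0 := by
    simpa [Matrix.mulVec, dotProduct, Fin.sum_univ_two] using congrFun h 0
  have e1 : B 1 0 * v 0 - B 0 0 * v 1 = c * v 1 := by
    simpa [Matrix.mulVec, dotProduct, Fin.sum_univ_two, t1, sub_eq_add_neg] using congrFun h 1
  -- Cayley–Hamilton: `B² = 0`, whence `c² v = B² v = 0`.
  have hc : c = 0 := by
    have h0 : c ^ 2 * v 0 = 0 := by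
      linear_combination (-c - B 0 0) * e0 - B 0 1 * e1 + v 0 * n1
    have h1 : c ^ 2 * v 1 = 0 := by
      linear_combination (-c + B 0 0) * e1 - B 1 0 * e0 + v 1 * n1
    rcases vec_ne_zero.1 hv with h | h
    · simpa [h] using h0
    · simpa [h] using h1
  subst hc
  rw [zero_mul] at e0 e1
  have key : ∃ d : ℂ, B = d • nilp v := by
    rcases vec_ne_zero.1 hv with h | h
    · refine ⟨-B 0 1 / v 0 ^ 2, mat_ext ?_ ?_ ?_ ?_⟩ <;> simp [nilp, t1] <;> field_simp
      · linear_combination e0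
      · linear_combination v 0 * e1 + v 1 * e0
      · linear_combination e0
    · refine ⟨B 1 0 / v 1 ^ 2, mat_ext ?_ ?_ ?_ ?_⟩ <;> simp [nilp, t1] <;> field_simp
      · linear_combination -e1
      · linear_combination v 1 * e0 + v 0 * e1
      · linear_combination -e1
  obtain ⟨d, hd⟩ := key
  exact ⟨d, fun h0 => hB0 (by rw [hd, h0, zero_smul]), hd⟩

/-- A lift of a point of the quadric: an eigenvector `v` of the affine component with the
eigenvalue `ρ`, and the covector `w` such that `A = v w - ρ`. -/
structure IsLift (ρ : ℂ) (v w : Fin 2 → ℂ) {a : ℂ} (x : Quad a) : Prop where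
  ne_zero : v ≠ 0
  dot : w 0 * v 0 + w 1 * v 1 = 2 * ρ
  A_eq : x.A = !![v 0 * w 0 - ρ, v 0 * w 1; v 1 * w 0, v 1 * w 1 - ρ]
  -- Automatic when `A ≠ 0`, since `A` then spans the line. At the vertex, where `w = 0`, this is
  -- what ties `v` to the line.
  eigen : ∀ B ∈ x.line, ∃ c : ℂ, B *ᵥ v = c • v

variable {a ρ : ℂ} {v w : Fin 2 → ℂ} {x y : Quad a}

lemma IsLift.mulVec (h : IsLift ρ v w x) : x.A *ᵥ v = ρ • v := by
  rw [h.A_eq]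
  ext i; fin_cases i <;> simp [Matrix.mulVec, dotProduct, Fin.sum_univ_two]
  · linear_combination v 0 * h.dot
  · linear_combination v 1 * h.dot

lemma IsLift.sq (h : IsLift ρ v w x) : 2 * ρ ^ 2 = a := by
  rw [← x.pair_self, h.A_eq]
  simp [pair, Matrix.trace_fin_two]
  linear_combination (-(w 0 * v 0 + w 1 * v 1)) * h.dot

lemma IsLift.line_eq (h : IsLift ρ v w x) (ha : a = 0) : x.line = Submodule.span ℂ {nilp v} := by
  subst ha
  obtain ⟨B, hB, hl⟩ := x.line_mem
  obtain ⟨c, hc⟩ := h.eigen B (hl ▸ Submodule.mem_span_singleton_self B)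
  obtain ⟨d, hd, hBd⟩ := eq_smul_nilp hB h.ne_zero hc
  rw [hl, hBd, Submodule.span_singleton_smul_eq (IsUnit.mk0 d hd)]

/-- The formula `v w - ρ` gives the matrix; the line comes from the matrix if `a ≠ 0` and from `v`,
through `nilp v`, if `a = 0`. -/
lemma IsLift.unique (hx : IsLift ρ v w x) (hy : IsLift ρ v w y) : x = y := by
  by_cases ha : a = 0
  · exact Quad.ext (hx.A_eq.trans hy.A_eq.symm) ((hx.line_eq ha).trans (hy.line_eq ha).symm)
  · exact Quad.ext_of_ne ha (hx.A_eq.trans hy.A_eq.symm)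

/-- The equation `w·v = 2ρ` is the tracelessness of `v w - ρ` and is the only constraint on a lift.
For `a = 0` the line is taken to be that of `nilp v`, which makes sense even if the matrix is zero.
-/
lemma exists_isLift_of_dot (hv : v ≠ 0) (hd : w 0 * v 0 + w 1 * v 1 = 2 * ρ) (ha : 2 * ρ ^ 2 = a) :
    ∃ x : Quad a, IsLift ρ v w x := by
  set A : Mat := !![v 0 * w 0 - ρ, v 0 * w 1; v 1 * w 0, v 1 * w 1 - ρ] with hA
  have hAt : A.trace = 0 := by
    simp [hA, Matrix.trace_fin_two]; linear_combination hd
  have hAp : pair A A = a := by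
    rw [← ha]
    simp [hA, pair, Matrix.trace_fin_two]
    linear_combination (w 0 * v 0 + w 1 * v 1) * hd
  by_cases h0 : a = 0
  · subst h0
    have hρ : ρ = 0 := by simpa using ha
    subst hρ
    have hm : A ∈ Submodule.span ℂ {nilp v} := by
      rw [mul_zero] at hd
      rw [Submodule.mem_span_singleton]
      rcases vec_ne_zero.1 hv with h | h
      · refine ⟨-w 1 / v 0, ?_⟩
        refine mat_ext ?_ ?_ ?_ ?_ <;> simp [nilp, hA] <;> field_simp
        · linear_combination -hd
        · linear_combination (-v 1) * hd
      · refine ⟨w 0 / v 1, ?_⟩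
        refine mat_ext ?_ ?_ ?_ ?_ <;> simp [nilp, hA] <;> field_simp
        · linear_combination (-v 0) * hd
        · linear_combination -hd
    refine ⟨⟨A, _, ⟨nilp v, nilp_mem_orbitSet hv, rfl⟩, hm, hAp⟩, hv, hd, rfl, ?_⟩
    intro B hB
    obtain ⟨c, rfl⟩ := Submodule.mem_span_singleton.1 hB
    refine ⟨0, ?_⟩
    rw [Matrix.smul_mulVec, nilp_mulVec]
    simp [det₂, mul_comm]
  · have hA0 : A ≠ 0 := by
      intro h
      rw [h] at hAp
      exact h0 (by rw [← hAp]; simp [pair])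
    refine ⟨⟨A, _, ⟨A, ⟨hA0, hAt, hAp⟩, rfl⟩, Submodule.mem_span_singleton_self A, hAp⟩, hv, hd,
      rfl, ?_⟩
    intro B hB
    obtain ⟨c, rfl⟩ := Submodule.mem_span_singleton.1 hB
    refine ⟨c * ρ, ?_⟩
    rw [Matrix.smul_mulVec, mul_smul]
    congr 1
    ext i; fin_cases i <;> simp [hA, Matrix.mulVec, dotProduct, Fin.sum_univ_two]
    · linear_combination v 0 * hd
    · linear_combination v 1 * hd

lemma IsLift.smul (h : IsLift ρ v w x) {c : ℂ} (hc : c ≠ 0) : IsLift ρ (c • v) (c⁻¹ • w) x := by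
  refine ⟨smul_ne_zero hc h.ne_zero, ?_, ?_, fun B hB => ?_⟩
  · simp; field_simp; linear_combination h.dot
  · rw [h.A_eq]; refine mat_ext ?_ ?_ ?_ ?_ <;> simp <;> field_simp
  · obtain ⟨d, hd⟩ := h.eigen B hB
    exact ⟨d, by rw [Matrix.mulVec_smul, hd, smul_comm]⟩

/-- The lift with the opposite eigenvalue. -/
lemma IsLift.neg (h : IsLift ρ v w x) (hρ : ρ ≠ 0) :
    IsLift (-ρ) ![-w 1, w 0] ![v 1, -v 0] x := by
  have ha : a ≠ 0 := by rw [← h.sq]; simpa using hρ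
  -- The eigenvectors for `-ρ` form the kernel of `A + ρ = v w`, that is, the annihilator of `w`,
  -- spanned by `(-w₁, w₀)`. It is a line since `w·v = 2ρ ≠ 0`.
  refine ⟨?_, ?_, ?_, ?_⟩
  · rw [vec_ne_zero]
    by_contra! hh
    have h0 : w 1 = 0 := by simpa using hh.1
    have h1 : w 0 = 0 := by simpa using hh.2
    have := h.dot
    rw [h0, h1] at this
    apply hρ
    linear_combination -this / 2
  · simp; linear_combination -h.dot
  · rw [h.A_eq]
    refine mat_ext ?_ ?_ ?_ ?_ <;> simp
    · linear_combination h.dot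
    · ring
    · ring
    · linear_combination h.dot
  · rw [x.line_eq ha]
    intro B hB
    obtain ⟨c, rfl⟩ := Submodule.mem_span_singleton.1 hB
    refine ⟨c * -ρ, ?_⟩
    rw [Matrix.smul_mulVec, mul_smul, h.A_eq]
    congr 1
    ext i; fin_cases i <;> simp [Matrix.mulVec, dotProduct, Fin.sum_univ_two] <;> ring

/-- The chart `(p, q)` is the gauge `v₀ = 1` for the rescaling of lifts, with `v₁ = -p` and `w₁ =
q`; the chart `(p', q')` is likewise the gauge `v₁ = 1`. -/
lemma isLift_par₁ (a : ℂ) (z : ℂ × ℂ) :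
    IsLift (root a) ![1, -z.1] ![z.1 * z.2 + 2 * root a, z.2] (par₁ a z) := by
  refine ⟨vec_ne_zero.2 (by simp), ?_, ?_, ?_⟩
  · simp; ring
  · change mat₁ _ _ _ = _
    refine mat_ext ?_ ?_ ?_ ?_ <;> simp [mat₁] <;> ring
  · intro B hB
    obtain ⟨c, rfl⟩ := Submodule.mem_span_singleton.1 hB
    refine ⟨c * root a, ?_⟩
    rw [Matrix.smul_mulVec, mul_smul]
    congr 1
    ext i; fin_cases i <;> simp [mat₁, Matrix.mulVec, dotProduct, Fin.sum_univ_two] <;> ring_nf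

lemma isLift_par₂ (a : ℂ) (z : ℂ × ℂ) :
    IsLift (root a) ![-z.1, 1] ![z.2, z.1 * z.2 + 2 * root a] (par₂ a z) := by
  refine ⟨vec_ne_zero.2 (by simp), ?_, ?_, ?_⟩
  · simp; ring
  · change mat₂ _ _ _ = _
    refine mat_ext ?_ ?_ ?_ ?_ <;> simp [mat₂] <;> ring
  · intro B hB
    obtain ⟨c, rfl⟩ := Submodule.mem_span_singleton.1 hB
    refine ⟨c * root a, ?_⟩
    rw [Matrix.smul_mulVec, mul_smul]
    congr 1
    ext i; fin_cases i <;> simp [mat₂, Matrix.mulVec, dotProduct, Fin.sum_univ_two] <;> ring_nf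

lemma IsLift.eq_par₁ (h : IsLift (root a) v w x) (h0 : v 0 ≠ 0) :
    x = par₁ a (-v 1 / v 0, v 0 * w 1) := by
  refine h.unique ?_
  convert (isLift_par₁ a (-v 1 / v 0, v 0 * w 1)).smul h0 using 1
  · ext i; fin_cases i <;> simp; field_simp
  · ext i; fin_cases i <;> simp <;> field_simp
    linear_combination h.dot

lemma IsLift.eq_par₂ (h : IsLift (root a) v w x) (h1 : v 1 ≠ 0) :
    x = par₂ a (-v 0 / v 1, v 1 * w 0) := by
  refine h.unique ?_
  convert (isLift_par₂ a (-v 0 / v 1, v 1 * w 0)).smul h1 using 1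
  · ext i; fin_cases i <;> simp; field_simp
  · ext i; fin_cases i <;> simp <;> field_simp
    linear_combination h.dot

/-- Two lifts with the same eigenvalue are proportional. -/
lemma IsLift.proportional {v' w' : Fin 2 → ℂ} (h : IsLift ρ v w x) (h' : IsLift ρ v' w' x) :
    ∃ c : ℂ, c ≠ 0 ∧ v' = c • v ∧ w' = c⁻¹ • w := by
  have hd : det₂ v' v = 0 := by
    -- If `a = 0` the matrix may vanish, and the line is used: it contains both `nilp v` and `nilp
    -- v'`. If `a ≠ 0` the eigenvalue `ρ ≠ -ρ` is simple.
    by_cases ha : a = 0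
    · have hm : nilp v ∈ x.line := h.line_eq ha ▸ Submodule.mem_span_singleton_self _
      rw [h'.line_eq ha] at hm
      obtain ⟨d, hd⟩ := Submodule.mem_span_singleton.1 hm
      have := nilp_mulVec v v'
      rw [← hd, Matrix.smul_mulVec, nilp_mulVec] at this
      have h2 : det₂ v' v' = 0 := by simp [det₂, mul_comm]
      rw [h2, zero_smul, smul_zero] at this
      exact (smul_eq_zero.1 this.symm).resolve_right h.ne_zero
    · have hρ : ρ ≠ 0 := by
        rintro rfl
        exact ha (by rw [← h.sq]; simp)
      have e := h'.mulVec
      rw [h.A_eq] at e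
      have e0 := congrFun e 0
      have e1 := congrFun e 1
      simp [Matrix.mulVec, dotProduct, Fin.sum_univ_two] at e0 e1
      have : 2 * ρ * det₂ v' v = 0 := by
        rw [det₂]; linear_combination v 0 * e1 - v 1 * e0
      simpa [hρ] using this
  obtain ⟨c, hc⟩ := eq_smul_of_det₂_eq_zero h.ne_zero hd
  have hc0 : c ≠ 0 := by
    rintro rfl
    exact h'.ne_zero (by rw [hc, zero_smul])
  refine ⟨c, hc0, hc, ?_⟩
  have hA := h.A_eq.symm.trans h'.A_eq
  rw [hc] at hA
  have a00 := congrFun (congrFun hA 0) 0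
  have a01 := congrFun (congrFun hA 0) 1
  have a10 := congrFun (congrFun hA 1) 0
  have a11 := congrFun (congrFun hA 1) 1
  simp at a00 a01 a10 a11
  rcases vec_ne_zero.1 h.ne_zero with h0 | h0
  · ext i; fin_cases i
    · simp; field_simp
      exact mul_left_cancel₀ h0 (by linear_combination -a00)
    · simp; field_simp
      exact mul_left_cancel₀ h0 (by linear_combination -a01)
  · ext i; fin_cases i
    · simp; field_simp
      exact mul_left_cancel₀ h0 (by linear_combination -a10)
    · simp; field_simp
      exact mul_left_cancel₀ h0 (by linear_combination -a11)

/-- Reduces an arbitrary root to `root a`, on which the charts are built. The opposite sign is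
separated only when `root a ≠ 0`, which is when `IsLift.neg` can exchange the two eigenvalues. -/
lemma eq_or_eq_neg_root (h : 2 * ρ ^ 2 = a) : ρ = root a ∨ (ρ = -root a ∧ root a ≠ 0) := by
  have h1 : (ρ - root a) * (ρ + root a) = 0 := by
    have := root_sq a
    linear_combination h / 2 - this
  rcases mul_eq_zero.1 h1 with h2 | h2
  · exact Or.inl (sub_eq_zero.1 h2)
  · by_cases h0 : root a = 0
    · left; rw [h0] at h2 ⊢; simpa using h2
    · exact Or.inr ⟨eq_neg_of_add_eq_zero_left h2, h0⟩

/-! ### Holomorphic lifts of maps to the quadric, and the symplectic form -/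

section

variable {ET T : Type} [NormedAddCommGroup ET] [NormedSpace ℂ ET] [TopologicalSpace T]
  [ChartedSpace ET T] {a ρ : ℂ} {F : T → Quad a} {t : T}

lemma contMDiffAt_of_isLift_root {v w : T → Fin 2 → ℂ}
    (hv : ContMDiffAt 𝓘(ℂ, ET) 𝓘(ℂ, Fin 2 → ℂ) ∞ v t)
    (hw : ContMDiffAt 𝓘(ℂ, ET) 𝓘(ℂ, Fin 2 → ℂ) ∞ w t)
    (h : ∀ᶠ u in 𝓝 t, IsLift (root a) (v u) (w u) (F u)) :
    ContMDiffAt 𝓘(ℂ, ET) 𝓘(ℂ, ℂ × ℂ) ∞ F t := by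
  have hvw := hv.prodMk_space hw
  have cont : ∀ i, ContinuousAt (fun u => v u i) t := fun i =>
    (continuous_apply i).continuousAt.comp hv.continuousAt
  rcases vec_ne_zero.1 h.self_of_nhds.ne_zero with h0 | h0
  · have hc : ContDiffAt ℂ ∞ (fun m : (Fin 2 → ℂ) × (Fin 2 → ℂ) =>
        (-m.1 1 / m.1 0, m.1 0 * m.2 1)) (v t, w t) := by
      refine ContDiffAt.prodMk (ContDiffAt.div (by fun_prop) (by fun_prop) h0) (by fun_prop)
    refine ((contMDiff_par₁ a).contMDiffAt.comp t (hc.contMDiffAt.comp t hvw)).congr_of_eventuallyEq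
      ?_
    filter_upwards [h, (cont 0).eventually_ne h0] with u hu hu0
    exact hu.eq_par₁ hu0
  · have hc : ContDiffAt ℂ ∞ (fun m : (Fin 2 → ℂ) × (Fin 2 → ℂ) =>
        (-m.1 0 / m.1 1, m.1 1 * m.2 0)) (v t, w t) := by
      refine ContDiffAt.prodMk (ContDiffAt.div (by fun_prop) (by fun_prop) h0) (by fun_prop)
    refine ((contMDiff_par₂ a).contMDiffAt.comp t (hc.contMDiffAt.comp t hvw)).congr_of_eventuallyEq
      ?_
    filter_upwards [h, (cont 1).eventually_ne h0] with u hu hu0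
    exact hu.eq_par₂ hu0

lemma contMDiffAt_vec {f g : T → ℂ} (hf : ContMDiffAt 𝓘(ℂ, ET) 𝓘(ℂ, ℂ) ∞ f t)
    (hg : ContMDiffAt 𝓘(ℂ, ET) 𝓘(ℂ, ℂ) ∞ g t) :
    ContMDiffAt 𝓘(ℂ, ET) 𝓘(ℂ, Fin 2 → ℂ) ∞ (fun u => ![f u, g u]) t := by
  rw [contMDiffAt_pi_space]
  intro i
  fin_cases i
  · exact hf
  · exact hg

lemma contMDiffAt_comp_vec {v : T → Fin 2 → ℂ}
    (hv : ContMDiffAt 𝓘(ℂ, ET) 𝓘(ℂ, Fin 2 → ℂ) ∞ v t) (i : Fin 2) :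
    ContMDiffAt 𝓘(ℂ, ET) 𝓘(ℂ, ℂ) ∞ (fun u => v u i) t :=
  contMDiffAt_pi_space.1 hv i

/-- A map to the quadric with a holomorphic lift is holomorphic. -/
lemma contMDiffAt_of_isLift {v w : T → Fin 2 → ℂ}
    (hv : ContMDiffAt 𝓘(ℂ, ET) 𝓘(ℂ, Fin 2 → ℂ) ∞ v t)
    (hw : ContMDiffAt 𝓘(ℂ, ET) 𝓘(ℂ, Fin 2 → ℂ) ∞ w t)
    (h : ∀ᶠ u in 𝓝 t, IsLift ρ (v u) (w u) (F u)) :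
    ContMDiffAt 𝓘(ℂ, ET) 𝓘(ℂ, ℂ × ℂ) ∞ F t := by
  rcases eq_or_eq_neg_root h.self_of_nhds.sq with rfl | ⟨rfl, h0⟩
  · exact contMDiffAt_of_isLift_root hv hw h
  · refine contMDiffAt_of_isLift_root (v := fun u => ![-w u 1, w u 0])
      (w := fun u => ![v u 1, -v u 0])
      (contMDiffAt_vec (contMDiffAt_comp_vec hw 1).neg (contMDiffAt_comp_vec hw 0))
      (contMDiffAt_vec (contMDiffAt_comp_vec hv 1) (contMDiffAt_comp_vec hv 0).neg) ?_
    filter_upwards [h] with u hu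
    simpa using hu.neg (neg_ne_zero.2 h0)

/-- Holomorphic maps to the quadric have local holomorphic lifts. -/
lemma exists_isLift_of_contMDiffAt (hF : ContMDiffAt 𝓘(ℂ, ET) 𝓘(ℂ, ℂ × ℂ) ∞ F t)
    (hρ : 2 * ρ ^ 2 = a) :
    ∃ v w : T → Fin 2 → ℂ, ContMDiffAt 𝓘(ℂ, ET) 𝓘(ℂ, Fin 2 → ℂ) ∞ v t ∧
      ContMDiffAt 𝓘(ℂ, ET) 𝓘(ℂ, Fin 2 → ℂ) ∞ w t ∧ ∀ᶠ u in 𝓝 t, IsLift ρ (v u) (w u) (F u) := by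
  have key : ∃ v w : T → Fin 2 → ℂ, ContMDiffAt 𝓘(ℂ, ET) 𝓘(ℂ, Fin 2 → ℂ) ∞ v t ∧
      ContMDiffAt 𝓘(ℂ, ET) 𝓘(ℂ, Fin 2 → ℂ) ∞ w t ∧
      ∀ᶠ u in 𝓝 t, IsLift (root a) (v u) (w u) (F u) := by
    rcases mem_range_par (F t) with h | h
    · have hm := (isOpen_range_par₁ a).mem_nhds h
      have hc := ((contMDiffOn_openChart₁ a).contMDiffAt hm).comp t hF
      have h1 := contDiff_fst.contMDiff.contMDiffAt.comp t hc
      have h2 := contDiff_snd.contMDiff.contMDiffAt.comp t hc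
      refine ⟨_, _, contMDiffAt_vec (contMDiffAt_const (c := 1)) h1.neg,
        contMDiffAt_vec ((h1.mul h2).add (contMDiffAt_const (c := 2 * root a))) h2, ?_⟩
      filter_upwards [hF.continuousAt.preimage_mem_nhds hm] with u hu
      obtain ⟨z, hz⟩ := hu
      simp only [Pi.add_apply, Pi.mul_apply, Function.comp_apply, ← hz, openChart₁_par₁]
      exact isLift_par₁ a z
    · have hm := (isOpen_range_par₂ a).mem_nhds h
      have hc := ((contMDiffOn_openChart₂ a).contMDiffAt hm).comp t hF
      have h1 := contDiff_fst.contMDiff.contMDiffAt.comp t hc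
      have h2 := contDiff_snd.contMDiff.contMDiffAt.comp t hc
      refine ⟨_, _, contMDiffAt_vec h1.neg (contMDiffAt_const (c := 1)),
        contMDiffAt_vec h2 ((h1.mul h2).add (contMDiffAt_const (c := 2 * root a))), ?_⟩
      filter_upwards [hF.continuousAt.preimage_mem_nhds hm] with u hu
      obtain ⟨z, hz⟩ := hu
      simp only [Pi.add_apply, Pi.mul_apply, Function.comp_apply, ← hz, openChart₂_par₂]
      exact isLift_par₂ a z
  obtain ⟨v, w, hv, hw, h⟩ := key
  rcases eq_or_eq_neg_root hρ with rfl | ⟨rfl, h0⟩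
  · exact ⟨v, w, hv, hw, h⟩
  · refine ⟨fun u => ![-w u 1, w u 0], fun u => ![v u 1, -v u 0],
      (contMDiffAt_vec (contMDiffAt_comp_vec hw 1).neg (contMDiffAt_comp_vec hw 0)),
      (contMDiffAt_vec (contMDiffAt_comp_vec hv 1) (contMDiffAt_comp_vec hv 0).neg), ?_⟩
    filter_upwards [h] with u hu
    exact hu.neg h0

lemma exists_isLift (x : Quad a) (hρ : 2 * ρ ^ 2 = a) : ∃ v w, IsLift ρ v w x := by
  obtain ⟨v, w, -, -, h⟩ := exists_isLift_of_contMDiffAt (F := id) (t := x) contMDiffAt_id hρ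
  exact ⟨v x, w x, h.self_of_nhds⟩

end

/-! ### The symplectic form of the quadric in terms of lifts -/

section

variable {E : Type} [NormedAddCommGroup E] [NormedSpace ℂ E] {a ρ : ℂ} {F : E → Quad a} {z : E}

/-- The form `dw ∧ dv`. -/
def wedge (v w v' w' : Fin 2 → ℂ) : ℂ := w 0 * v' 0 + w 1 * v' 1 - (w' 0 * v 0 + w' 1 * v 1)

lemma fderiv_vec {v : E → Fin 2 → ℂ} (hv : DifferentiableAt ℂ v z) (i : Fin 2) :
    HasFDerivAt (fun y => v y i) ((ContinuousLinearMap.proj i).comp (fderiv ℂ v z)) z :=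
  (hasFDerivAt_pi'.1 hv.hasFDerivAt) i

/-- In the gauge `v₀ = 1`, where `v₁ = -p` and `w₁ = q`, the form `dw ∧ dv` is `dp ∧ dq`. A change
of gauge has no effect, because `w·v` is constant and so the directions of rescaling are in the
kernel of `dw ∧ dv`. -/
lemma lpForm_of_isLift_root {v w : E → Fin 2 → ℂ} (hv : DifferentiableAt ℂ v z)
    (hw : DifferentiableAt ℂ w z) (h : ∀ᶠ y in 𝓝 z, IsLift (root a) (v y) (w y) (F y)) (u u' : E) :
    lpForm a (F z) ![mfderiv 𝓘(ℂ, E) 𝓘(ℂ, ℂ × ℂ) F z u, mfderiv 𝓘(ℂ, E) 𝓘(ℂ, ℂ × ℂ) F z u'] =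
      wedge (fderiv ℂ v z u) (fderiv ℂ w z u) (fderiv ℂ v z u') (fderiv ℂ w z u') := by
  have v0 := fderiv_vec hv 0
  have v1 := fderiv_vec hv 1
  have w0 := fderiv_vec hw 0
  have w1 := fderiv_vec hw 1
  have hdot : ∀ u, w z 0 * fderiv ℂ v z u 0 + v z 0 * fderiv ℂ w z u 0 +
      (w z 1 * fderiv ℂ v z u 1 + v z 1 * fderiv ℂ w z u 1) = 0 := by
    intro u
    have h1 := (w0.mul v0).add (w1.mul v1)
    have h2 : HasFDerivAt (fun _ : E => 2 * root a) (0 : E →L[ℂ] ℂ) z := hasFDerivAt_const _ _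
    have h3 := h1.unique (h2.congr_of_eventuallyEq (h.mono fun y hy => hy.dot))
    simpa using congrArg (fun l : E →L[ℂ] ℂ => l u) h3
  have hc := hdot u
  have hc' := hdot u'
  rcases vec_ne_zero.1 h.self_of_nhds.ne_zero with h0 | h0
  · have hp := ((v1.neg.mul ((hasDerivAt_inv h0).comp_hasFDerivAt z v0)).prodMk (v0.mul w1))
    set c : E → ℂ × ℂ := fun y => (-v y 1 * (v y 0)⁻¹, v y 0 * w y 1) with hcdef
    have hc1 : HasFDerivAt c _ z := hp
    have hFc : F =ᶠ[𝓝 z] par₁ a ∘ c := by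
      filter_upwards [h, v0.continuousAt.eventually_ne h0] with y hy hy0
      rw [hy.eq_par₁ hy0]; rfl
    have hm : mfderiv 𝓘(ℂ, E) 𝓘(ℂ, ℂ × ℂ) (par₁ a ∘ c) z =
        (mfderiv 𝓘(ℂ, ℂ × ℂ) 𝓘(ℂ, ℂ × ℂ) (par₁ a) (c z)).comp (fderiv ℂ c z) := by
      exact (mfderiv_comp z ((contMDiff_par₁ a).mdifferentiableAt (by simp))
        hc1.differentiableAt.mdifferentiableAt).trans
        (congrArg (ContinuousLinearMap.comp _) mfderiv_eq_fderiv)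
    have hm' : mfderiv 𝓘(ℂ, E) 𝓘(ℂ, ℂ × ℂ) F z = mfderiv 𝓘(ℂ, E) 𝓘(ℂ, ℂ × ℂ) (par₁ a ∘ c) z :=
      hFc.mfderiv_eq
    rw [hm', hm]
    refine (lpForm_par₁ a (c z) (fderiv ℂ c z u) (fderiv ℂ c z u')).trans ?_
    rw [hc1.fderiv, dpdq_apply, wedge]
    simp
    field_simp
    linear_combination v z 0 * (fderiv ℂ v z u 0 * hc' - fderiv ℂ v z u' 0 * hc)
  · have hp := ((v0.neg.mul ((hasDerivAt_inv h0).comp_hasFDerivAt z v1)).prodMk (v1.mul w0))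
    set c : E → ℂ × ℂ := fun y => (-v y 0 * (v y 1)⁻¹, v y 1 * w y 0) with hcdef
    have hc1 : HasFDerivAt c _ z := hp
    have hFc : F =ᶠ[𝓝 z] par₂ a ∘ c := by
      filter_upwards [h, v1.continuousAt.eventually_ne h0] with y hy hy0
      rw [hy.eq_par₂ hy0]; rfl
    have hm : mfderiv 𝓘(ℂ, E) 𝓘(ℂ, ℂ × ℂ) (par₂ a ∘ c) z =
        (mfderiv 𝓘(ℂ, ℂ × ℂ) 𝓘(ℂ, ℂ × ℂ) (par₂ a) (c z)).comp (fderiv ℂ c z) := by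
      exact (mfderiv_comp z ((contMDiff_par₂ a).mdifferentiableAt (by simp))
        hc1.differentiableAt.mdifferentiableAt).trans
        (congrArg (ContinuousLinearMap.comp _) mfderiv_eq_fderiv)
    have hm' : mfderiv 𝓘(ℂ, E) 𝓘(ℂ, ℂ × ℂ) F z = mfderiv 𝓘(ℂ, E) 𝓘(ℂ, ℂ × ℂ) (par₂ a ∘ c) z :=
      hFc.mfderiv_eq
    rw [hm', hm]
    refine (lpForm_par₂ a (c z) (fderiv ℂ c z u) (fderiv ℂ c z u')).trans ?_
    rw [hc1.fderiv, dpdq_apply, wedge]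
    simp
    field_simp
    linear_combination v z 1 * (fderiv ℂ v z u 1 * hc' - fderiv ℂ v z u' 1 * hc)

/-- The symplectic form of the quadric is `dw ∧ dv` for any lift. -/
lemma lpForm_of_isLift {v w : E → Fin 2 → ℂ} (hv : DifferentiableAt ℂ v z)
    (hw : DifferentiableAt ℂ w z) (h : ∀ᶠ y in 𝓝 z, IsLift ρ (v y) (w y) (F y)) (u u' : E) :
    lpForm a (F z) ![mfderiv 𝓘(ℂ, E) 𝓘(ℂ, ℂ × ℂ) F z u, mfderiv 𝓘(ℂ, E) 𝓘(ℂ, ℂ × ℂ) F z u'] =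
      wedge (fderiv ℂ v z u) (fderiv ℂ w z u) (fderiv ℂ v z u') (fderiv ℂ w z u') := by
  rcases eq_or_eq_neg_root h.self_of_nhds.sq with rfl | ⟨rfl, h0⟩
  · exact lpForm_of_isLift_root hv hw h u u'
  -- The passage to the opposite eigenvalue, `v ↦ (-w₁, w₀)`, `w ↦ (v₁, -v₀)`, preserves `dw ∧ dv`.
  · have hv' : HasFDerivAt (fun y => ![-w y 1, w y 0]) _ z :=
      hasFDerivAt_pi.2 fun i => (by
        fin_cases i
        · exact (fderiv_vec hw 1).neg
        · exact fderiv_vec hw 0 :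
        HasFDerivAt (fun y => (![-w y 1, w y 0] : Fin 2 → ℂ) i)
          ((![-(ContinuousLinearMap.proj 1).comp (fderiv ℂ w z),
            (ContinuousLinearMap.proj 0).comp (fderiv ℂ w z)] : Fin 2 → E →L[ℂ] ℂ) i) z)
    have hw' : HasFDerivAt (fun y => ![v y 1, -v y 0]) _ z :=
      hasFDerivAt_pi.2 fun i => (by
        fin_cases i
        · exact fderiv_vec hv 1
        · exact (fderiv_vec hv 0).neg :
        HasFDerivAt (fun y => (![v y 1, -v y 0] : Fin 2 → ℂ) i)
          ((![(ContinuousLinearMap.proj 1).comp (fderiv ℂ v z),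
            -(ContinuousLinearMap.proj 0).comp (fderiv ℂ v z)] : Fin 2 → E →L[ℂ] ℂ) i) z)
    rw [lpForm_of_isLift_root hv'.differentiableAt hw'.differentiableAt
      (h.mono fun y hy => by simpa using hy.neg (neg_ne_zero.2 h0)), hv'.fderiv, hw'.fderiv]
    simp [wedge]
    ring

end

/-! ### Products of quadrics -/

section

variable {ι : Type} [Fintype ι] {a : ι → ℂ}

lemma contMDiffAt_quadProd {ET T : Type} [NormedAddCommGroup ET] [NormedSpace ℂ ET]
    [TopologicalSpace T] [ChartedSpace ET T] {F : T → QuadProd a} {t : T} :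
    ContMDiffAt 𝓘(ℂ, ET) 𝓘(ℂ, ι → ℂ × ℂ) ∞ F t ↔
      ∀ k, ContMDiffAt 𝓘(ℂ, ET) 𝓘(ℂ, ℂ × ℂ) ∞ (fun u => F u k) t := by
  rw [contMDiffAt_iff_target]
  have h : (extChartAt 𝓘(ℂ, ι → ℂ × ℂ) (F t) ∘ F) =
      fun u k => extChartAt 𝓘(ℂ, ℂ × ℂ) (F t k) (F u k) := rfl
  rw [h, contMDiffAt_pi_space, continuousAt_pi, ← forall_and]
  exact forall_congr' fun k => (contMDiffAt_iff_target (f := fun u => F u k)).symm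

/-- The product of charts of the factors. -/
lemma mem_atlas_quadProd {e : OpenPartialHomeomorph (QuadProd a) (ι → ℂ × ℂ)}
    (he : e ∈ atlas (ι → ℂ × ℂ) (QuadProd a)) :
    ∃ f : ∀ k, OpenPartialHomeomorph (Quad (a k)) (ℂ × ℂ),
      (∀ k, f k = openChart₁ (a k) ∨ f k = openChart₂ (a k)) ∧ e = OpenPartialHomeomorph.pi f := by
  obtain ⟨f, hf, rfl⟩ := he
  exact ⟨f, fun k => mem_atlas_quad (hf k (Set.mem_univ k)), rfl⟩

lemma contMDiff_chart_symm {a : ℂ} {f : OpenPartialHomeomorph (Quad a) (ℂ × ℂ)}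
    (hf : f = openChart₁ a ∨ f = openChart₂ a) :
    ContMDiff 𝓘(ℂ, ℂ × ℂ) 𝓘(ℂ, ℂ × ℂ) ∞ f.symm := by
  rcases hf with rfl | rfl
  · exact contMDiff_par₁ a
  · exact contMDiff_par₂ a

lemma contMDiffOn_chart' {a : ℂ} {f : OpenPartialHomeomorph (Quad a) (ℂ × ℂ)}
    (hf : f = openChart₁ a ∨ f = openChart₂ a) :
    ContMDiffOn 𝓘(ℂ, ℂ × ℂ) 𝓘(ℂ, ℂ × ℂ) ∞ f f.source := by
  rcases hf with rfl | rfl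
  · exact contMDiffOn_openChart₁ a
  · exact contMDiffOn_openChart₂ a

lemma contMDiff_atlas_symm {e : OpenPartialHomeomorph (QuadProd a) (ι → ℂ × ℂ)}
    (he : e ∈ atlas (ι → ℂ × ℂ) (QuadProd a)) :
    ContMDiff 𝓘(ℂ, ι → ℂ × ℂ) 𝓘(ℂ, ι → ℂ × ℂ) ∞ e.symm := by
  obtain ⟨f, hf, rfl⟩ := mem_atlas_quadProd he
  intro z
  rw [contMDiffAt_quadProd]
  intro k
  exact (contMDiff_chart_symm (hf k)).contMDiffAt.comp z
    (contMDiffAt_pi_space.1 contMDiffAt_id k)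

instance : IsManifold 𝓘(ℂ, ι → ℂ × ℂ) ∞ (QuadProd a) := by
  refine isManifold_of_contDiffOn _ _ _ ?_
  intro e e' he he'
  simp only [modelWithCornersSelf_coe, modelWithCornersSelf_coe_symm, Function.comp_id,
    Function.id_comp, Set.preimage_id, Set.range_id, Set.inter_univ]
  rw [← contMDiffOn_iff_contDiffOn]
  have hs := contMDiff_atlas_symm he
  intro z hz
  rw [OpenPartialHomeomorph.trans_source] at hz
  have hz' : e.symm z ∈ e'.source := hz.2
  refine ContMDiffAt.contMDiffWithinAt ?_
  obtain ⟨f, hf, rfl⟩ := mem_atlas_quadProd he'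
  rw [contMDiffAt_pi_space]
  intro k
  have h1 := contMDiffAt_quadProd.1 (hs z) k
  exact ((contMDiffOn_chart' (hf k)).contMDiffAt
    ((f k).open_source.mem_nhds (hz' k (Set.mem_univ k)))).comp z h1

lemma mfderiv_quadProd {E : Type} [NormedAddCommGroup E] [NormedSpace ℂ E] {F : E → QuadProd a}
    {z : E} (hF : ContMDiffAt 𝓘(ℂ, E) 𝓘(ℂ, ι → ℂ × ℂ) ∞ F z) (u : E) (k : ι) :
    (mfderiv 𝓘(ℂ, E) 𝓘(ℂ, ι → ℂ × ℂ) F z u : ι → ℂ × ℂ) k =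
      mfderiv 𝓘(ℂ, E) 𝓘(ℂ, ℂ × ℂ) (fun y => F y k) z u := by
  have hk := contMDiffAt_quadProd.1 hF k
  rw [mfderiv_eq_fderiv_chart (hF.mdifferentiableAt (by simp)),
    mfderiv_eq_fderiv_chart (hk.mdifferentiableAt (by simp))]
  have hd : DifferentiableAt ℂ (chartAt (ι → ℂ × ℂ) (F z) ∘ F) z :=
    ((contMDiffAt_iff_target.1 hF).2.mdifferentiableAt (by simp)).differentiableAt
  have h := (hasFDerivAt_pi'.1 hd.hasFDerivAt) k
  exact congrArg (fun l : E →L[ℂ] ℂ × ℂ => l u) h.fderiv.symm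

/-- The form `∑ dp_k ∧ dq_k` on `∏ ℂ²`. -/
def flatForm (ι : Type) [Fintype ι] : (ι → ℂ × ℂ) [⋀^Fin 2]→L[ℂ] ℂ :=
  ∑ k, ContinuousAlternatingMap.compContinuousLinearMap dpdq
    (ContinuousLinearMap.proj (R := ℂ) (φ := fun _ : ι => ℂ × ℂ) k)

lemma flatForm_apply (u v : ι → ℂ × ℂ) : flatForm ι ![u, v] = ∑ k, dpdq ![u k, v k] := by
  rw [flatForm, ContinuousAlternatingMap.sum_apply]
  refine Finset.sum_congr rfl fun k _ => ?_
  rw [ContinuousAlternatingMap.compContinuousLinearMap_apply]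
  rfl

lemma prodForm_apply (x : QuadProd a) (u v : ι → ℂ × ℂ) :
    prodForm a x ![u, v] = ∑ k, dpdq ![u k, v k] :=
  flatForm_apply u v

lemma prodForm_mfderiv {E : Type} [NormedAddCommGroup E] [NormedSpace ℂ E] {F : E → QuadProd a}
    {z : E} (hF : ContMDiffAt 𝓘(ℂ, E) 𝓘(ℂ, ι → ℂ × ℂ) ∞ F z) (u v : E) :
    (prodForm a).pullback F z ![u, v] = ∑ k, lpForm (a k) (F z k)
      ![mfderiv 𝓘(ℂ, E) 𝓘(ℂ, ℂ × ℂ) (fun y => F y k) z u,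
        mfderiv 𝓘(ℂ, E) 𝓘(ℂ, ℂ × ℂ) (fun y => F y k) z v] := by
  have h1 : (prodForm a).pullback F z ![u, v] =
      prodForm a (F z) ![mfderiv 𝓘(ℂ, E) 𝓘(ℂ, ι → ℂ × ℂ) F z u,
        mfderiv 𝓘(ℂ, E) 𝓘(ℂ, ι → ℂ × ℂ) F z v] := by
    rw [TwoForm.pullback, ContinuousAlternatingMap.compContinuousLinearMap_apply]
    congr 1
    ext i : 1
    fin_cases i <;> rfl
  refine h1.trans ((prodForm_apply _ _ _).trans (Finset.sum_congr rfl fun k _ => ?_))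
  rw [mfderiv_quadProd hF, mfderiv_quadProd hF]
  rfl

lemma flatForm_nondegenerate {u : ι → ℂ × ℂ} (h : ∀ v, flatForm ι ![u, v] = 0) : u = 0 := by
  classical
  have key : ∀ k (w : ℂ × ℂ), dpdq ![u k, w] = 0 := by
    intro k w
    have := h (Pi.single k w)
    rw [flatForm_apply, Finset.sum_eq_single k] at this
    · simpa using this
    · intro b _ hb
      simp [dpdq_apply, hb]
    · simp
  funext k
  ext
  · simpa [dpdq_apply] using key k (0, 1)
  · simpa [dpdq_apply] using key k (1, 0)

/-- All charts of the atlas are Darboux charts: the form has constant coefficients in each of them,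
which makes holomorphy and closedness immediate. -/
lemma prodForm_pullback_chart_symm {e : OpenPartialHomeomorph (QuadProd a) (ι → ℂ × ℂ)}
    (he : e ∈ atlas (ι → ℂ × ℂ) (QuadProd a)) (z : ι → ℂ × ℂ) :
    (prodForm a).pullback e.symm z = flatForm ι := by
  have hs := contMDiff_atlas_symm he z
  obtain ⟨f, hf, rfl⟩ := mem_atlas_quadProd he
  refine twoForm_ext (E := ι → ℂ × ℂ) fun u v => ?_
  refine (prodForm_mfderiv hs u v).trans ?_
  rw [flatForm_apply]
  refine Finset.sum_congr rfl fun k _ => ?_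
  have hd : ∀ u, mfderiv 𝓘(ℂ, ι → ℂ × ℂ) 𝓘(ℂ, ℂ × ℂ) (fun y => (f k).symm (y k)) z u =
      mfderiv 𝓘(ℂ, ℂ × ℂ) 𝓘(ℂ, ℂ × ℂ) (f k).symm (z k) (u k) := by
    intro u
    have hp : HasFDerivAt (fun y : ι → ℂ × ℂ => y k)
      (ContinuousLinearMap.proj (R := ℂ) (φ := fun _ : ι => ℂ × ℂ) k) z := hasFDerivAt_apply k z
    have h1 := mfderiv_comp (f := fun y : ι → ℂ × ℂ => y k) z
      ((contMDiff_chart_symm (hf k)).mdifferentiableAt (x := z k) (by simp))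
      hp.differentiableAt.mdifferentiableAt
    have h2 := h1.trans (congrArg (ContinuousLinearMap.comp _)
      (mfderiv_eq_fderiv.trans hp.fderiv))
    exact congrArg (fun l => l u) h2
  have key : ∀ u v : ℂ × ℂ, lpForm (a k) ((f k).symm (z k))
      ![mfderiv 𝓘(ℂ, ℂ × ℂ) 𝓘(ℂ, ℂ × ℂ) (f k).symm (z k) u,
        mfderiv 𝓘(ℂ, ℂ × ℂ) 𝓘(ℂ, ℂ × ℂ) (f k).symm (z k) v] = dpdq ![u, v] := by
    intro u v
    rcases hf k with h | h <;> rw [h]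
    · exact lpForm_par₁ _ _ _ _
    · exact lpForm_par₂ _ _ _ _
  rw [← key]
  exact congrArg₂ (fun x y => dpdq ![x, y]) (hd u) (hd v)

lemma extDeriv_const {E : Type} [NormedAddCommGroup E] [NormedSpace ℂ E]
    (η : E [⋀^Fin 2]→L[ℂ] ℂ) (z : E) : extDeriv (fun _ => η) z = 0 := by
  rw [extDeriv, fderiv_const_apply]
  ext m
  simp [ContinuousAlternatingMap.alternatizeUncurryFin_apply]

/-- The form `∑ ω^{(k)}` of a product of quadrics is symplectic. -/
theorem prodForm_isSymplectic (a : ι → ℂ) : (prodForm a).IsSymplectic where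
  holomorphic e he := by
    have : (prodForm a).inChart e = fun _ => flatForm ι :=
      funext fun z => prodForm_pullback_chart_symm he z
    rw [this]
    exact contDiffOn_const
  closed e he z _ := by
    have : (prodForm a).inChart e = fun _ => flatForm ι :=
      funext fun z => prodForm_pullback_chart_symm he z
    rw [this]
    exact extDeriv_const _ _
  nondegenerate x u h := flatForm_nondegenerate fun v => h v

/-- The sum of the symplectic forms is `∑ dw_k ∧ dv_k` for any lifts. -/
lemma prodForm_of_isLift {E : Type} [NormedAddCommGroup E] [NormedSpace ℂ E] {F : E → QuadProd a}
    {z : E} {ρ : ι → ℂ} {v w : ι → E → Fin 2 → ℂ} (hv : ∀ k, ContDiffAt ℂ ∞ (v k) z)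
    (hw : ∀ k, ContDiffAt ℂ ∞ (w k) z)
    (h : ∀ k, ∀ᶠ y in 𝓝 z, IsLift (ρ k) (v k y) (w k y) (F y k)) (u u' : E) :
    (prodForm a).pullback F z ![u, u'] =
      ∑ k, wedge (fderiv ℂ (v k) z u) (fderiv ℂ (w k) z u) (fderiv ℂ (v k) z u')
        (fderiv ℂ (w k) z u') := by
  have hF : ContMDiffAt 𝓘(ℂ, E) 𝓘(ℂ, ι → ℂ × ℂ) ∞ F z := contMDiffAt_quadProd.2 fun k =>
    contMDiffAt_of_isLift (hv k).contMDiffAt (hw k).contMDiffAt (h k)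
  refine (prodForm_mfderiv hF u u').trans (Finset.sum_congr rfl fun k _ => ?_)
  exact lpForm_of_isLift ((hv k).differentiableAt (by simp)) ((hw k).differentiableAt (by simp))
    (h k) u u'

end

/-! ### The action of `SL(2, ℂ)` and lifts -/

section Action

variable {a ρ : ℂ} {v w v' w' : Fin 2 → ℂ} {x y : Quad a}

lemma smul_A (g : SL2) (x : Quad a) : (g • x).A = conj g x.A := rfl

lemma smul_line (g : SL2) (x : Quad a) : (g • x).line = x.line.map (conj g) := rfl

lemma conj_mul_coe (g : SL2) (A : Mat) : conj g A * (g : Mat) = (g : Mat) * A := by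
  change (g : Mat) * A * ((g⁻¹ : SL2) : Mat) * (g : Mat) = _
  rw [mul_assoc, inv_mul_coe, mul_one]

lemma mulVec_apply_zero (H : Mat) (v : Fin 2 → ℂ) : (H *ᵥ v) 0 = H 0 0 * v 0 + H 0 1 * v 1 := by
  simp [Matrix.mulVec, dotProduct, Fin.sum_univ_two]

lemma mulVec_apply_one (H : Mat) (v : Fin 2 → ℂ) : (H *ᵥ v) 1 = H 1 0 * v 0 + H 1 1 * v 1 := by
  simp [Matrix.mulVec, dotProduct, Fin.sum_univ_two]

lemma vecMul_apply (H : Mat) (w : Fin 2 → ℂ) (q : Fin 2) :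
    (w ᵥ* H) q = w 0 * H 0 q + w 1 * H 1 q := by
  simp [Matrix.vecMul, dotProduct, Fin.sum_univ_two]

lemma coe_inv_mulVec (g : SL2) (v : Fin 2 → ℂ) : ((g⁻¹ : SL2) : Mat) *ᵥ ((g : Mat) *ᵥ v) = v := by
  rw [Matrix.mulVec_mulVec, inv_mul_coe, Matrix.one_mulVec]

/-- The action on lifts is linear. -/
lemma IsLift.sl_smul (h : IsLift ρ v w x) (g : SL2) (hw : w = w' ᵥ* (g : Mat)) :
    IsLift ρ ((g : Mat) *ᵥ v) w' (g • x) := by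
  have hw0 : w 0 = w' 0 * (g : Mat) 0 0 + w' 1 * (g : Mat) 1 0 := by rw [hw, vecMul_apply]
  have hw1 : w 1 = w' 0 * (g : Mat) 0 1 + w' 1 * (g : Mat) 1 1 := by rw [hw, vecMul_apply]
  refine ⟨fun h0 => h.ne_zero ?_, ?_, ?_, ?_⟩
  · rw [← coe_inv_mulVec g v, h0, Matrix.mulVec_zero]
  · rw [mulVec_apply_zero, mulVec_apply_one, ← h.dot, hw0, hw1]; ring
  · have hu : IsUnit (g : Mat) := by
      rw [Matrix.isUnit_iff_isUnit_det, g.det_coe]; exact isUnit_one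
    refine hu.mul_right_cancel ?_
    rw [smul_A, conj_mul_coe, h.A_eq]
    refine mat_ext ?_ ?_ ?_ ?_ <;>
      simp [Matrix.mul_apply, Fin.sum_univ_two, mulVec_apply_zero, mulVec_apply_one, hw0, hw1] <;>
      ring
  · intro B hB
    rw [smul_line] at hB
    obtain ⟨B', hB', rfl⟩ := hB
    obtain ⟨c, hc⟩ := h.eigen B' hB'
    refine ⟨c, ?_⟩
    rw [Matrix.mulVec_mulVec, conj_mul_coe, ← Matrix.mulVec_mulVec, hc, Matrix.mulVec_smul]

/-- Divide by a square root of the determinant. Conjugation does not see scalar factors, so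
holomorphic bases of `ℂ²` may be used without normalizing their determinants, and no holomorphic
square root is ever needed. -/
lemma exists_sl_smul (H : Mat) (hH : H.det ≠ 0) : ∃ (g : SL2) (c : ℂ), c ≠ 0 ∧ H = c • (g : Mat) := by
  obtain ⟨c, hc⟩ := IsSquare.exists_sq _ (IsAlgClosed.exists_pow_nat_eq H.det (n := 2) two_pos |>
    fun ⟨z, hz⟩ => (⟨z, by rw [← hz, sq]⟩ : IsSquare H.det))
  have hc0 : c ≠ 0 := by
    rintro rfl
    exact hH (by rw [hc]; simp)
  refine ⟨⟨c⁻¹ • H, ?_⟩, c, hc0, ?_⟩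
  · rw [Matrix.det_smul, hc]; simp [hc0]
  · simp [smul_smul, hc0]

/-- The action of an invertible matrix proportional to `g`. -/
lemma IsLift.inv_smul {H : Mat} {g : SL2} {c : ℂ} (hc : c ≠ 0) (hH : H = c • (g : Mat))
    (h : IsLift ρ v w x) (hv : v = H *ᵥ v') (hw : w' = w ᵥ* H) : IsLift ρ v' w' (g⁻¹ • x) := by
  have h1 := (h.smul (inv_ne_zero hc)).sl_smul g⁻¹ (w' := w') ?_
  · have h2 : c⁻¹ • v = (g : Mat) *ᵥ v' := by
      rw [hv, hH, Matrix.smul_mulVec, smul_smul, inv_mul_cancel₀ hc, one_smul]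
    rwa [h2, coe_inv_mulVec] at h1
  · rw [hw, hH, Matrix.vecMul_smul, Matrix.smul_vecMul, Matrix.vecMul_vecMul,
      ← Matrix.SpecialLinearGroup.coe_mul, mul_inv_cancel, Matrix.SpecialLinearGroup.coe_one,
      Matrix.vecMul_one, inv_inv]

/-- Since `v ≠ 0`, the covector is recovered from the matrix. Sharing `v` also fixes the line at the
vertex, where equality of matrices would not be enough. -/
lemma IsLift.eq_of_A_eq (hx : IsLift ρ v w x) (hy : IsLift ρ v w' y) (h : x.A = y.A) : x = y := by
  have hw : w = w' := by
    have hA := hx.A_eq.symm.trans (h.trans hy.A_eq)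
    have a00 := congrFun (congrFun hA 0) 0
    have a01 := congrFun (congrFun hA 0) 1
    have a10 := congrFun (congrFun hA 1) 0
    have a11 := congrFun (congrFun hA 1) 1
    simp only [Matrix.of_apply, Matrix.cons_val', Matrix.cons_val_zero, Matrix.cons_val_one,
      Matrix.cons_val_fin_one] at a00 a01 a10 a11
    rcases vec_ne_zero.1 hx.ne_zero with h0 | h0
    · ext i; fin_cases i
      · exact mul_left_cancel₀ h0 (sub_left_injective a00)
      · exact mul_left_cancel₀ h0 a01
    · ext i; fin_cases i
      · exact mul_left_cancel₀ h0 a10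
      · exact mul_left_cancel₀ h0 (sub_left_injective a11)
  subst hw
  exact hx.unique hy

lemma Quad.eq_of_A_eq (h : x.A = y.A) (h0 : x.A ≠ 0) : x = y := by
  have key : ∀ x : Quad a, x.A ≠ 0 → x.line = Submodule.span ℂ {x.A} := by
    intro x h0
    obtain ⟨B, -, hl⟩ := x.line_mem
    obtain ⟨c, hc⟩ := Submodule.mem_span_singleton.1 (hl ▸ x.mem_line)
    have hc0 : c ≠ 0 := by
      rintro rfl
      exact h0 (by rw [← hc, zero_smul])
    rw [hl, ← hc, Submodule.span_singleton_smul_eq (IsUnit.mk0 c hc0)]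
  exact Quad.ext h (by rw [key x h0, key y (h ▸ h0), h])

lemma Quad.trace_line (x : Quad a) {B : Mat} (hB : B ∈ x.line) : B.trace = 0 := by
  obtain ⟨C, ⟨-, ht, -⟩, hl⟩ := x.line_mem
  rw [hl] at hB
  obtain ⟨c, rfl⟩ := Submodule.mem_span_singleton.1 hB
  rw [Matrix.trace_smul, ht, smul_zero]

lemma Quad.trace_A (x : Quad a) : x.A.trace = 0 := x.trace_line x.mem_line

lemma Quad.A_one_one (x : Quad a) : x.A 1 1 = -x.A 0 0 := by
  have := x.trace_A
  rw [Matrix.trace_fin_two] at this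
  linear_combination this

end Action

/-! ### The normal form of a point in its accompanying basis -/

section NormalForm

variable {n : ℕ} {a : Fin (n + 1) → ℂ} {s : Fin (n + 1) → ℂ} {i j : Fin (n + 1)}

/-- The eigenvalues of the matrices to which the eigenvectors `v_k` of the lifts belong. -/
def eig (s : Fin (n + 1) → ℂ) (k : Fin (n + 1)) : ℂ := if k = 0 then -s 0 / 2 else s k / 2

lemma eig_sq (hs : ∀ k, s k ^ 2 = 2 * a k) (k : Fin (n + 1)) : 2 * eig s k ^ 2 = a k := by
  unfold eig
  split_ifs with h
  · subst h; linear_combination hs 0 / 2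
  · linear_combination hs k / 2

/-- The accompanying basis of the point is the standard one. -/
structure IsNormal (s : Fin (n + 1) → ℂ) (i j : Fin (n + 1)) (x : QuadProd a) : Prop where
  lift_zero : ∃ w, IsLift (eig s 0) ![0, 1] w (x 0)
  lift_i : ∃ w, IsLift (eig s i) ![1, 0] w (x i)
  A_j : (x j).A 0 1 = 1

lemma smul_eq_self_of_conj {g : SL2} (hg : conj g = LinearMap.id) (x : QuadProd a) : g • x = x := by
  funext k
  refine Quad.ext ?_ ?_
  · change conj g (x k).A = _
    rw [hg]; rfl
  · change (x k).line.map (conj g) = _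
    rw [hg, Submodule.map_id]

lemma conj_apply (g : SL2) (A : Mat) (p q : Fin 2) : conj g A p q =
    ((g : Mat) * A * !![(g : Mat) 1 1, -(g : Mat) 0 1; -(g : Mat) 1 0, (g : Mat) 0 0]) p q := by
  change ((g : Mat) * A * ((g⁻¹ : SL2) : Mat)) p q = _
  rw [Matrix.SpecialLinearGroup.coe_inv, Matrix.adjugate_fin_two]

lemma exists_sl_lift {a ρ : ℂ} {v w : Fin 2 → ℂ} {x : Quad a} (h : IsLift ρ v w x) (g : SL2) :
    ∃ w', w = w' ᵥ* (g : Mat) ∧ IsLift ρ ((g : Mat) *ᵥ v) w' (g • x) := by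
  have hw : w = (w ᵥ* ((g⁻¹ : SL2) : Mat)) ᵥ* (g : Mat) := by
    rw [Matrix.vecMul_vecMul, inv_mul_coe, Matrix.vecMul_one]
  exact ⟨_, hw, h.sl_smul g hw⟩

/-- The normal form of a point is unique. -/
lemma IsNormal.smul_eq {x : QuadProd a} (hx : IsNormal s i j x) {g : SL2}
    (hg : IsNormal s i j (g • x)) : g • x = x := by
  obtain ⟨w0, h0⟩ := hx.lift_zero
  obtain ⟨wi, hi⟩ := hx.lift_i
  obtain ⟨w0', h0'⟩ := hg.lift_zero
  obtain ⟨wi', hi'⟩ := hg.lift_i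
  obtain ⟨_, -, h1⟩ := exists_sl_lift h0 g
  obtain ⟨_, -, h2⟩ := exists_sl_lift hi g
  obtain ⟨c, hc, e1, -⟩ := h0'.proportional h1
  obtain ⟨d, hd, e2, -⟩ := hi'.proportional h2
  -- Preserving both coordinate axes makes `g` diagonal. Conjugation multiplies the upper right
  -- entry by `g₀₀²`, so fixing the value `1` for `A^{(j)}` forces `g = ±1`, which acts trivially.
  have g01 : (g : Mat) 0 1 = 0 := by simpa [mulVec_apply_zero] using congrFun e1 0
  have g10 : (g : Mat) 1 0 = 0 := by simpa [mulVec_apply_one] using congrFun e2 1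
  have hdet : (g : Mat) 0 0 * (g : Mat) 1 1 = 1 := by
    have := g.det_coe
    rw [Matrix.det_fin_two, g01] at this
    linear_combination this
  have hsq : (g : Mat) 0 0 * (g : Mat) 0 0 = 1 := by
    have := hg.A_j
    change conj g (x j).A 0 1 = 1 at this
    rw [conj_apply] at this
    simp [Matrix.mul_apply, Fin.sum_univ_two, g01, g10, hx.A_j] at this
    linear_combination this
  have hne : (g : Mat) 0 0 ≠ 0 := left_ne_zero_of_mul (by rw [hdet]; exact one_ne_zero)
  have g11 : (g : Mat) 1 1 = (g : Mat) 0 0 := mul_left_cancel₀ hne (hdet.trans hsq.symm)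
  refine smul_eq_self_of_conj (LinearMap.ext fun A => ?_) x
  refine mat_ext ?_ ?_ ?_ ?_ <;> rw [conj_apply] <;>
    simp [Matrix.mul_apply, Fin.sum_univ_two, g01, g10, g11]
  · linear_combination A 0 0 * hsq
  · linear_combination A 0 1 * hsq
  · linear_combination A 1 0 * hsq
  · linear_combination A 1 1 * hsq

/-- The points that can be carried to the normal form. -/
def domain (a s : Fin (n + 1) → ℂ) (i j : Fin (n + 1)) : Set (QuadProd a) :=
  {x | ∃ g : SL2, IsNormal s i j (g • x)}

lemma smul_mem_domain {x : QuadProd a} (hx : x ∈ domain a s i j) (g : SL2) :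
    g • x ∈ domain a s i j := by
  obtain ⟨h, hh⟩ := hx
  exact ⟨h * g⁻¹, by rwa [smul_smul, inv_mul_cancel_right]⟩

open Classical in
/-- The normal form of a point. -/
def normalize (s : Fin (n + 1) → ℂ) (i j : Fin (n + 1)) (x : QuadProd a) : QuadProd a :=
  if h : x ∈ domain a s i j then h.choose • x else x

lemma normalize_eq {x : QuadProd a} {g : SL2} (h : IsNormal s i j (g • x)) :
    normalize s i j x = g • x := by
  have hx : x ∈ domain a s i j := ⟨g, h⟩
  rw [normalize, dif_pos hx]
  have h2 := hx.choose_spec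
  have e : hx.choose • x = (hx.choose * g⁻¹) • (g • x) := by
    rw [smul_smul, inv_mul_cancel_right]
  rw [e] at h2 ⊢
  exact h.smul_eq h2

lemma normalize_smul {x : QuadProd a} (hx : x ∈ domain a s i j) (g : SL2) :
    normalize s i j (g • x) = normalize s i j x := by
  obtain ⟨h, hh⟩ := hx
  rw [normalize_eq hh, normalize_eq (g := h * g⁻¹)]
  · rw [smul_smul, inv_mul_cancel_right]
  · rwa [smul_smul, inv_mul_cancel_right]

lemma normalize_of_isNormal {x : QuadProd a} (hx : IsNormal s i j x) : normalize s i j x = x := by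
  rw [normalize_eq (g := 1) (by rwa [one_smul]), one_smul]

lemma det₂_mulVec (H : Mat) (u v : Fin 2 → ℂ) : det₂ (H *ᵥ u) (H *ᵥ v) = H.det * det₂ u v := by
  simp only [det₂, mulVec_apply_zero, mulVec_apply_one, Matrix.det_fin_two]; ring

/-- The product `⟨w_j, v_0⟩ det (v_j, v_0)`, which is `⟨A^{(j)} v_0, v_0⟩`. -/
def delta (vj wj v0 : Fin 2 → ℂ) : ℂ := det₂ vj v0 * (wj 0 * v0 0 + wj 1 * v0 1)

/-- Both quantities are invariant under `SL(2, ℂ)` and acquire only non-zero factors when lifts are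
rescaled, so they can be evaluated in the normal form. Together with the converse
`isNormal_of_isLift`, this describes the domain by two inequalities. -/
lemma domain_ne_zero {x : QuadProd a} (hx : x ∈ domain a s i j) {v w : Fin (n + 1) → Fin 2 → ℂ}
    (h : ∀ k, IsLift (eig s k) (v k) (w k) (x k)) :
    det₂ (v i) (v 0) ≠ 0 ∧ delta (v j) (w j) (v 0) ≠ 0 := by
  obtain ⟨g, hg⟩ := hx
  obtain ⟨w0', h0'⟩ := hg.lift_zero
  obtain ⟨wi', hi'⟩ := hg.lift_i
  obtain ⟨_, -, h1⟩ := exists_sl_lift (h 0) g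
  obtain ⟨_, -, h2⟩ := exists_sl_lift (h i) g
  obtain ⟨wj, ej, h3⟩ := exists_sl_lift (h j) g
  obtain ⟨c, hc, e1, -⟩ := h0'.proportional h1
  obtain ⟨d, hd, e2, -⟩ := hi'.proportional h2
  have hdet : ∀ u u', det₂ u u' = det₂ ((g : Mat) *ᵥ u) ((g : Mat) *ᵥ u') := by
    intro u u'
    rw [det₂_mulVec, g.det_coe, one_mul]
  have hA : ((g : Mat) *ᵥ v j) 0 * wj 1 = 1 := by
    have := hg.A_j
    have h4 := congrFun (congrFun h3.A_eq 0) 1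
    simp only [Matrix.of_apply, Matrix.cons_val', Matrix.cons_val_zero, Matrix.cons_val_one,
      Matrix.cons_val_fin_one] at h4
    rw [← h4]; exact this
  have hdot : w j 0 * v 0 0 + w j 1 * v 0 1 = wj 1 * c := by
    have e10 := congrFun e1 0
    have e11 := congrFun e1 1
    rw [mulVec_apply_zero] at e10
    rw [mulVec_apply_one] at e11
    simp at e10 e11
    rw [ej, vecMul_apply, vecMul_apply]
    linear_combination wj 0 * e10 + wj 1 * e11
  constructor
  · rw [hdet, e1, e2]
    simp [det₂, hc, hd]
  · have h5 : wj 1 ≠ 0 := right_ne_zero_of_mul (by rw [hA]; exact one_ne_zero)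
    have h6 : ((g : Mat) *ᵥ v j) 0 ≠ 0 := left_ne_zero_of_mul (by rw [hA]; exact one_ne_zero)
    rw [delta, hdot, hdet, e1]
    refine mul_ne_zero ?_ (mul_ne_zero h5 hc)
    have e : det₂ ((g : Mat) *ᵥ v j) (c • ![0, 1]) = ((g : Mat) *ᵥ v j) 0 * c := by simp [det₂]
    rw [e]
    exact mul_ne_zero h6 hc

/-- The vector component of the lift in the accompanying basis. -/
def frameV (vi v0 vj wj v : Fin 2 → ℂ) : Fin 2 → ℂ :=
  ![det₂ v v0 / det₂ vi v0, det₂ vi v * delta vj wj v0 / det₂ vi v0 ^ 2]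

/-- The covector component of the lift in the accompanying basis. -/
def frameW (vi v0 vj wj w : Fin 2 → ℂ) : Fin 2 → ℂ :=
  ![w 0 * vi 0 + w 1 * vi 1, det₂ vi v0 / delta vj wj v0 * (w 0 * v0 0 + w 1 * v0 1)]

/-- The accompanying basis of `ℂ²`. -/
def frameMat (vi v0 vj wj : Fin 2 → ℂ) : Mat :=
  -- Up to a common scalar the only freedom is the factor at `v_0`. In the basis `v_i, λ v_0` the
  -- upper right entry of `A^{(j)}` is `λ delta / det (v_i, v_0)`, and `λ` makes it `1`.
  !![vi 0, det₂ vi v0 / delta vj wj v0 * v0 0; vi 1, det₂ vi v0 / delta vj wj v0 * v0 1]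

lemma frameMat_det (vi v0 vj wj : Fin 2 → ℂ) :
    (frameMat vi v0 vj wj).det = det₂ vi v0 ^ 2 / delta vj wj v0 := by
  rw [frameMat, Matrix.det_fin_two_of]
  simp only [det₂]; ring

lemma frameMat_mulVec {vi v0 vj wj : Fin 2 → ℂ} (hD : det₂ vi v0 ≠ 0) (hδ : delta vj wj v0 ≠ 0)
    (v : Fin 2 → ℂ) : v = frameMat vi v0 vj wj *ᵥ frameV vi v0 vj wj v := by
  ext p
  fin_cases p
  · simp [mulVec_apply_zero, frameMat, frameV]
    field_simp
    simp only [det₂]; ring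
  · simp [mulVec_apply_one, frameMat, frameV]
    field_simp
    simp only [det₂]; ring

lemma frameMat_vecMul (vi v0 vj wj w : Fin 2 → ℂ) :
    frameW vi v0 vj wj w = w ᵥ* frameMat vi v0 vj wj := by
  ext p
  fin_cases p <;> simp [vecMul_apply, frameMat, frameW]; ring

/-- Lifts of the normal form of a point. -/
lemma isNormal_of_isLift {x : QuadProd a} {v w : Fin (n + 1) → Fin 2 → ℂ}
    (h : ∀ k, IsLift (eig s k) (v k) (w k) (x k)) (hD : det₂ (v i) (v 0) ≠ 0)
    (hδ : delta (v j) (w j) (v 0) ≠ 0) : ∃ g : SL2, IsNormal s i j (g • x) ∧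
      ∀ k, IsLift (eig s k) (frameV (v i) (v 0) (v j) (w j) (v k))
        (frameW (v i) (v 0) (v j) (w j) (w k)) ((g • x) k) := by
  obtain ⟨g, c, hc, hH⟩ := exists_sl_smul (frameMat (v i) (v 0) (v j) (w j))
    (by rw [frameMat_det]; exact div_ne_zero (pow_ne_zero 2 hD) hδ)
  have key : ∀ k, IsLift (eig s k) (frameV (v i) (v 0) (v j) (w j) (v k))
        (frameW (v i) (v 0) (v j) (w j) (w k)) ((g⁻¹ • x) k) := fun k =>
    (h k).inv_smul hc hH (frameMat_mulVec hD hδ (v k)) (frameMat_vecMul _ _ _ _ _)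
  refine ⟨g⁻¹, ⟨?_, ?_, ?_⟩, key⟩
  · have h0 := (key 0).smul (c := det₂ (v i) (v 0) / delta (v j) (w j) (v 0)) (div_ne_zero hD hδ)
    have e : (det₂ (v i) (v 0) / delta (v j) (w j) (v 0)) •
        frameV (v i) (v 0) (v j) (w j) (v 0) = ![0, 1] := by
      ext p
      fin_cases p
      · simp [frameV, det₂, mul_comm]
      · simp [frameV]; field_simp
    rw [e] at h0
    exact ⟨_, h0⟩
  · have hi := key i
    have e : frameV (v i) (v 0) (v j) (w j) (v i) = ![1, 0] := by
      ext p
      fin_cases p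
      · simp [frameV, hD]
      · simp [frameV, det₂, mul_comm]
    rw [e] at hi
    exact ⟨_, hi⟩
  · have h1 := congrFun (congrFun (key j).A_eq 0) 1
    refine h1.trans ?_
    simp [frameV, frameW]
    have e : det₂ (v j) (v 0) * (w j 0 * v 0 0 + w j 1 * v 0 1) = delta (v j) (w j) (v 0) := rfl
    field_simp
    linear_combination e

end NormalForm

/-! ### Holomorphy of the normal form -/

section Smooth

variable {n : ℕ} {a : Fin (n + 1) → ℂ} {s : Fin (n + 1) → ℂ} {i j : Fin (n + 1)}
  {ET T : Type} [NormedAddCommGroup ET] [NormedSpace ℂ ET] [TopologicalSpace T]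
  [ChartedSpace ET T] {t : T}

lemma contMDiffAt_det₂ {u v : T → Fin 2 → ℂ} (hu : ContMDiffAt 𝓘(ℂ, ET) 𝓘(ℂ, Fin 2 → ℂ) ∞ u t)
    (hv : ContMDiffAt 𝓘(ℂ, ET) 𝓘(ℂ, Fin 2 → ℂ) ∞ v t) :
    ContMDiffAt 𝓘(ℂ, ET) 𝓘(ℂ, ℂ) ∞ (fun y => det₂ (u y) (v y)) t :=
  ((contMDiffAt_comp_vec hu 0).mul (contMDiffAt_comp_vec hv 1)).sub
    ((contMDiffAt_comp_vec hu 1).mul (contMDiffAt_comp_vec hv 0))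

lemma contMDiffAt_dot {u v : T → Fin 2 → ℂ} (hu : ContMDiffAt 𝓘(ℂ, ET) 𝓘(ℂ, Fin 2 → ℂ) ∞ u t)
    (hv : ContMDiffAt 𝓘(ℂ, ET) 𝓘(ℂ, Fin 2 → ℂ) ∞ v t) :
    ContMDiffAt 𝓘(ℂ, ET) 𝓘(ℂ, ℂ) ∞ (fun y => u y 0 * v y 0 + u y 1 * v y 1) t :=
  ((contMDiffAt_comp_vec hu 0).mul (contMDiffAt_comp_vec hv 0)).add
    ((contMDiffAt_comp_vec hu 1).mul (contMDiffAt_comp_vec hv 1))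

lemma contMDiffAt_delta {vj wj v0 : T → Fin 2 → ℂ}
    (hvj : ContMDiffAt 𝓘(ℂ, ET) 𝓘(ℂ, Fin 2 → ℂ) ∞ vj t)
    (hwj : ContMDiffAt 𝓘(ℂ, ET) 𝓘(ℂ, Fin 2 → ℂ) ∞ wj t)
    (hv0 : ContMDiffAt 𝓘(ℂ, ET) 𝓘(ℂ, Fin 2 → ℂ) ∞ v0 t) :
    ContMDiffAt 𝓘(ℂ, ET) 𝓘(ℂ, ℂ) ∞ (fun y => delta (vj y) (wj y) (v0 y)) t :=
  (contMDiffAt_det₂ hvj hv0).mul (contMDiffAt_dot hwj hv0)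

lemma exists_lifts (hs : ∀ k, s k ^ 2 = 2 * a k) {F : T → QuadProd a}
    (hF : ContMDiffAt 𝓘(ℂ, ET) 𝓘(ℂ, Fin (n + 1) → ℂ × ℂ) ∞ F t) :
    ∃ v w : Fin (n + 1) → T → Fin 2 → ℂ,
      (∀ k, ContMDiffAt 𝓘(ℂ, ET) 𝓘(ℂ, Fin 2 → ℂ) ∞ (v k) t) ∧
      (∀ k, ContMDiffAt 𝓘(ℂ, ET) 𝓘(ℂ, Fin 2 → ℂ) ∞ (w k) t) ∧
      ∀ᶠ u in 𝓝 t, ∀ k, IsLift (eig s k) (v k u) (w k u) (F u k) := by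
  have h := fun k => exists_isLift_of_contMDiffAt (contMDiffAt_quadProd.1 hF k) (eig_sq hs k)
  choose v w hv hw h using h
  exact ⟨v, w, hv, hw, Filter.eventually_all.2 h⟩

/-- Near a point of the domain of the normal form there are holomorphic lifts of a point and of its
normal form, related by a holomorphic change of basis of `ℂ²`. -/
lemma exists_frame_lifts (hs : ∀ k, s k ^ 2 = 2 * a k) {F : T → QuadProd a}
    (hF : ContMDiffAt 𝓘(ℂ, ET) 𝓘(ℂ, Fin (n + 1) → ℂ × ℂ) ∞ F t) (ht : F t ∈ domain a s i j) :
    ∃ (v w V W : Fin (n + 1) → T → Fin 2 → ℂ) (H : T → Mat),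
      (∀ k, ContMDiffAt 𝓘(ℂ, ET) 𝓘(ℂ, Fin 2 → ℂ) ∞ (v k) t) ∧
      (∀ k, ContMDiffAt 𝓘(ℂ, ET) 𝓘(ℂ, Fin 2 → ℂ) ∞ (w k) t) ∧
      (∀ k, ContMDiffAt 𝓘(ℂ, ET) 𝓘(ℂ, Fin 2 → ℂ) ∞ (V k) t) ∧
      (∀ k, ContMDiffAt 𝓘(ℂ, ET) 𝓘(ℂ, Fin 2 → ℂ) ∞ (W k) t) ∧
      (∀ p q, ContMDiffAt 𝓘(ℂ, ET) 𝓘(ℂ, ℂ) ∞ (fun u => H u p q) t) ∧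
      ∀ᶠ u in 𝓝 t, (F u ∈ domain a s i j ∧ IsNormal s i j (normalize s i j (F u)) ∧
        (H u).det ≠ 0) ∧ ∀ k, IsLift (eig s k) (v k u) (w k u) (F u k) ∧
        IsLift (eig s k) (V k u) (W k u) (normalize s i j (F u) k) ∧
        v k u = H u *ᵥ V k u ∧ W k u = w k u ᵥ* H u := by
  obtain ⟨v, w, hv, hw, h⟩ := exists_lifts hs hF
  obtain ⟨hD, hδ⟩ := domain_ne_zero ht h.self_of_nhds
  have sD := contMDiffAt_det₂ (hv i) (hv 0)
  have sδ := contMDiffAt_delta (hv j) (hw j) (hv 0)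
  have sc := sD.div₀ sδ hδ
  refine ⟨v, w, fun k u => frameV (v i u) (v 0 u) (v j u) (w j u) (v k u),
    fun k u => frameW (v i u) (v 0 u) (v j u) (w j u) (w k u),
    fun u => frameMat (v i u) (v 0 u) (v j u) (w j u), hv, hw, fun k => ?_, fun k => ?_, ?_, ?_⟩
  · refine contMDiffAt_vec ((contMDiffAt_det₂ (hv k) (hv 0)).div₀ sD hD) ?_
    exact ((contMDiffAt_det₂ (hv i) (hv k)).mul sδ).div₀ (sD.pow 2) (pow_ne_zero 2 hD)
  · exact contMDiffAt_vec (contMDiffAt_dot (hw k) (hv i)) (sc.mul (contMDiffAt_dot (hw k) (hv 0)))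
  · intro p q
    fin_cases p <;> fin_cases q
    · exact contMDiffAt_comp_vec (hv i) 0
    · exact sc.mul (contMDiffAt_comp_vec (hv 0) 0)
    · exact contMDiffAt_comp_vec (hv i) 1
    · exact sc.mul (contMDiffAt_comp_vec (hv 0) 1)
  · filter_upwards [h, sD.continuousAt.eventually_ne hD, sδ.continuousAt.eventually_ne hδ]
      with u hu hDu hδu
    obtain ⟨g, hg, hl⟩ := isNormal_of_isLift hu hDu hδu
    rw [normalize_eq hg]
    exact ⟨⟨⟨g, hg⟩, hg, by rw [frameMat_det]; exact div_ne_zero (pow_ne_zero 2 hDu) hδu⟩,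
      fun k => ⟨hu k, hl k, frameMat_mulVec hDu hδu _, frameMat_vecMul _ _ _ _ _⟩⟩

lemma isOpen_domain (hs : ∀ k, s k ^ 2 = 2 * a k) : IsOpen (domain a s i j) := by
  rw [isOpen_iff_mem_nhds]
  intro x hx
  obtain ⟨_, _, _, _, _, _, _, _, _, _, h⟩ := exists_frame_lifts hs (F := id) (t := x)
    contMDiffAt_id hx
  exact h.mono fun u hu => hu.1.1

/-- The group element in `normalize` is an arbitrary choice, but the result has lifts that are
rational functions of the lifts of the point. -/
lemma contMDiffAt_normalize (hs : ∀ k, s k ^ 2 = 2 * a k) {F : T → QuadProd a}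
    (hF : ContMDiffAt 𝓘(ℂ, ET) 𝓘(ℂ, Fin (n + 1) → ℂ × ℂ) ∞ F t) (ht : F t ∈ domain a s i j) :
    ContMDiffAt 𝓘(ℂ, ET) 𝓘(ℂ, Fin (n + 1) → ℂ × ℂ) ∞ (fun u => normalize s i j (F u)) t := by
  obtain ⟨_, _, V, W, _, _, _, hV, hW, _, h⟩ := exists_frame_lifts hs hF ht
  exact contMDiffAt_quadProd.2 fun k =>
    contMDiffAt_of_isLift (hV k) (hW k) (h.mono fun u hu => (hu.2 k).2.1)

end Smooth

/-! ### The reduction of the symplectic form -/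

section Reduction

/-- Leibniz rule for `v = H V`, `W = w H` with `X = dH`: the terms `dw·(H dV)` are common to both
forms and cancel. What is left involves only `dH` and the variation of the rank one matrix `V w`. -/
lemma wedge_frame (X X' H : Mat) (V dV dV' w dw dw' : Fin 2 → ℂ) :
    wedge (X *ᵥ V + H *ᵥ dV) dw (X' *ᵥ V + H *ᵥ dV') dw' -
      wedge dV (dw ᵥ* H + w ᵥ* X) dV' (dw' ᵥ* H + w ᵥ* X') =
    (X' * (Matrix.vecMulVec V dw + Matrix.vecMulVec dV w)).trace -
      (X * (Matrix.vecMulVec V dw' + Matrix.vecMulVec dV' w)).trace := by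
  simp [wedge, Matrix.trace_fin_two, Matrix.mul_apply, Fin.sum_univ_two, vecMul_apply,
    Matrix.vecMulVec_apply]
  ring

/-- Here `P = c H⁻¹`, hence `dP = -c H⁻¹ X H⁻¹`, and `tr (X' H⁻¹ X H⁻¹)` is symmetric in `X, X'` by
cyclicity. -/
lemma trace_variation {H P X X' dP dP' : Mat} {c : ℂ} (hH : H.det ≠ 0) (hP : H * P = c • 1)
    (h : X * P + H * dP = 0) (h' : X' * P + H * dP' = 0) :
    (X' * dP).trace = (X * dP').trace := by
  have hu : IsUnit H.det := IsUnit.mk0 _ hH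
  have hP' : P = c • H⁻¹ := by
    rw [← Matrix.nonsing_inv_mul_cancel_left H P hu, hP]; simp
  have key : ∀ {X dP : Mat}, X * P + H * dP = 0 → dP = -(c • (H⁻¹ * X * H⁻¹)) := by
    intro X dP h
    rw [← Matrix.nonsing_inv_mul_cancel_left H dP hu, eq_neg_of_add_eq_zero_right h, hP']
    simp [mul_assoc]
  rw [key h, key h', mul_neg, mul_neg, Matrix.trace_neg, Matrix.trace_neg, Matrix.mul_smul,
    Matrix.mul_smul, Matrix.trace_smul, Matrix.trace_smul]
  congr 2
  rw [← mul_assoc, ← mul_assoc, ← mul_assoc, ← mul_assoc, mul_assoc (X' * H⁻¹) X,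
    Matrix.trace_mul_comm, mul_assoc]
  simp only [mul_assoc]

/-- Serves the index `0`: when `V` stays on an axis, constancy of `W·V` makes the variation of the
paired component of `W` proportional to that of `V`, and the 2-form degenerates. The next lemma is
the same for the other axis and the index `i`. -/
lemma wedge_eq_zero_of_left {v w v' w' : Fin 2 → ℂ} {p r : ℂ} (hp : p ≠ 0) (h0 : v 0 = 0)
    (h0' : v' 0 = 0) (h1 : r * v 1 + p * w 1 = 0) (h1' : r * v' 1 + p * w' 1 = 0) :
    wedge v w v' w' = 0 := by
  refine mul_left_cancel₀ hp ?_
  rw [wedge, h0, h0']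
  linear_combination v' 1 * h1 - v 1 * h1'

lemma wedge_eq_zero_of_right {v w v' w' : Fin 2 → ℂ} {p r : ℂ} (hp : p ≠ 0) (h0 : v 1 = 0)
    (h0' : v' 1 = 0) (h1 : r * v 0 + p * w 0 = 0) (h1' : r * v' 0 + p * w' 0 = 0) :
    wedge v w v' w' = 0 := by
  refine mul_left_cancel₀ hp ?_
  rw [wedge, h0, h0']
  linear_combination v' 0 * h1 - v 0 * h1'

/-- Serves the index `j`, where both `V₀ W₁` and `W·V` are constant. In the gauge `V₀ = 1` these
equations fix `W₁` and express `W₀` through `V₁`, so only one parameter is left. -/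
lemma wedge_eq_zero_of_mul {V W v w v' w' : Fin 2 → ℂ} (hp : V 0 ≠ 0)
    (h1 : W 1 * v 0 + V 0 * w 1 = 0) (h1' : W 1 * v' 0 + V 0 * w' 1 = 0)
    (hd : W 0 * v 0 + V 0 * w 0 + (W 1 * v 1 + V 1 * w 1) = 0)
    (hd' : W 0 * v' 0 + V 0 * w' 0 + (W 1 * v' 1 + V 1 * w' 1) = 0) :
    wedge v w v' w' = 0 := by
  refine mul_left_cancel₀ (mul_ne_zero hp hp) ?_
  rw [wedge]
  linear_combination V 0 * v' 0 * hd - V 0 * v 0 * hd' + (V 0 * v' 1 - V 1 * v' 0) * h1 -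
    (V 0 * v 1 - V 1 * v 0) * h1'

variable {E : Type} [NormedAddCommGroup E] [NormedSpace ℂ E] {z : E}

lemma fderiv_vec_apply {v : E → Fin 2 → ℂ} (hv : ContDiffAt ℂ ∞ v z) (u : E) (p : Fin 2) :
    fderiv ℂ v z u p = fderiv ℂ (fun y => v y p) z u := by
  rw [(fderiv_vec (hv.differentiableAt (by simp)) p).fderiv]; rfl

lemma fderiv_mul_apply {f g : E → ℂ} (hf : ContDiffAt ℂ ∞ f z) (hg : ContDiffAt ℂ ∞ g z) (u : E) :
    fderiv ℂ (fun y => f y * g y) z u = g z * fderiv ℂ f z u + f z * fderiv ℂ g z u := by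
  rw [fderiv_fun_mul (hf.differentiableAt (by simp)) (hg.differentiableAt (by simp))]
  simp; ring

lemma fderiv_add_apply {f g : E → ℂ} (hf : ContDiffAt ℂ ∞ f z) (hg : ContDiffAt ℂ ∞ g z) (u : E) :
    fderiv ℂ (fun y => f y + g y) z u = fderiv ℂ f z u + fderiv ℂ g z u := by
  rw [fderiv_fun_add (hf.differentiableAt (by simp)) (hg.differentiableAt (by simp))]
  simp

lemma fderiv_eq_zero_of_eventually {f : E → ℂ} {c : ℂ} (h : ∀ᶠ y in 𝓝 z, f y = c) (u : E) :
    fderiv ℂ f z u = 0 := by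
  rw [Filter.EventuallyEq.fderiv_eq (f := fun _ => c) h]; simp

end Reduction

section Reduction

variable {n : ℕ} {a : Fin (n + 1) → ℂ} {s : Fin (n + 1) → ℂ} {i j : Fin (n + 1)}

lemma sum_eq_add_sum_rest {β : Type} [AddCommMonoid β] (hi : i ≠ 0) (hj : j ≠ 0) (hij : i ≠ j)
    (f : Fin (n + 1) → β) : ∑ k, f k = f 0 + f i + f j + ∑ k : Rest i j, f k := by
  classical
  rw [← Finset.sum_filter_not_add_sum_filter Finset.univ
    (fun k : Fin (n + 1) => k ≠ 0 ∧ k ≠ i ∧ k ≠ j) f]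
  congr 1
  · have : (Finset.univ.filter fun k : Fin (n + 1) => ¬(k ≠ 0 ∧ k ≠ i ∧ k ≠ j)) = {0, i, j} := by
      ext k; simp; tauto
    rw [this, Finset.sum_insert (by simp [hi.symm, hj.symm]), Finset.sum_pair hij, add_assoc]
  · exact Finset.sum_subtype _ (by simp) f

/-- Omitting the factors with indices `0, i, j`. -/
def restrict (i j : Fin (n + 1)) (x : QuadProd a) : QuadProd (rest a i j) := fun k => x k

lemma contMDiffAt_restrict {ET T : Type} [NormedAddCommGroup ET] [NormedSpace ℂ ET]
    [TopologicalSpace T] [ChartedSpace ET T] {t : T} {F : T → QuadProd a}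
    (hF : ContMDiffAt 𝓘(ℂ, ET) 𝓘(ℂ, Fin (n + 1) → ℂ × ℂ) ∞ F t) :
    ContMDiffAt 𝓘(ℂ, ET) 𝓘(ℂ, Rest i j → ℂ × ℂ) ∞ (fun u => restrict i j (F u)) t :=
  contMDiffAt_quadProd.2 fun k => contMDiffAt_quadProd.1 hF k

variable {E : Type} [NormedAddCommGroup E] [NormedSpace ℂ E] {z : E}

/-- The symplectic form on matrices with zero sum is that of the normal forms, to which only the
matrices with the indices different from `0, i, j` contribute. -/
theorem prodForm_pullback_normalize (hs : ∀ k, s k ^ 2 = 2 * a k) (hi : i ≠ 0) (hj : j ≠ 0)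
    (hij : i ≠ j) {F : E → QuadProd a} (hF : ContMDiffAt 𝓘(ℂ, E) 𝓘(ℂ, Fin (n + 1) → ℂ × ℂ) ∞ F z)
    (hz : F z ∈ domain a s i j) (hsum : ∀ᶠ y in 𝓝 z, ∑ k, (F y k).A = 0) :
    (prodForm a).pullback (E := E) F z =
      (prodForm (rest a i j)).pullback (E := E) (fun y => restrict i j (normalize s i j (F y))) z := by
  obtain ⟨v, w, V, W, H, hv, hw, hV, hW, hH, h⟩ := exists_frame_lifts hs hF hz
  simp only [contMDiffAt_iff_contDiffAt] at hv hw hV hW hH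
  have cv : ∀ {f : E → Fin 2 → ℂ}, ContDiffAt ℂ ∞ f z → ∀ p, ContDiffAt ℂ ∞ (fun y => f y p) z :=
    fun hf p => contDiffAt_pi.1 hf p
  refine twoForm_ext (E := E) fun u u' => ?_
  refine (prodForm_of_isLift hv hw (fun k => h.mono fun y hy => (hy.2 k).1) u u').trans ?_
  refine Eq.trans ?_ (prodForm_of_isLift (F := fun y => restrict i j (normalize s i j (F y)))
    (v := fun k : Rest i j => V k) (w := fun k : Rest i j => W k) (fun k => hV k) (fun k => hW k)
    (fun k => h.mono fun y hy => (hy.2 k).2.1) u u').symm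
  set X : E → Mat := fun u => Matrix.of fun p q => fderiv ℂ (fun y => H y p q) z u with hX
  -- derivatives of the relations between the lifts
  have dv : ∀ k u, fderiv ℂ (v k) z u = X u *ᵥ V k z + H z *ᵥ fderiv ℂ (V k) z u := by
    intro k u
    have e : ∀ p, fderiv ℂ (fun y => v k y p) z u =
        fderiv ℂ (fun y => H y p 0 * V k y 0 + H y p 1 * V k y 1) z u := by
      intro p
      refine congrArg (fun l : E →L[ℂ] ℂ => l u) (Filter.EventuallyEq.fderiv_eq ?_)
      filter_upwards [h] with y hy
      rw [(hy.2 k).2.2.1]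
      simp [Matrix.mulVec, dotProduct, Fin.sum_univ_two]
    ext p
    rw [fderiv_vec_apply (hv k), e, fderiv_add_apply ((hH p 0).mul (cv (hV k) 0))
      ((hH p 1).mul (cv (hV k) 1)), fderiv_mul_apply (hH p 0) (cv (hV k) 0),
      fderiv_mul_apply (hH p 1) (cv (hV k) 1)]
    simp only [hX, Pi.add_apply, Matrix.mulVec, dotProduct, Fin.sum_univ_two, Matrix.of_apply,
      fderiv_vec_apply (hV k)]
    ring
  have dW : ∀ k u, fderiv ℂ (W k) z u = fderiv ℂ (w k) z u ᵥ* H z + w k z ᵥ* X u := by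
    intro k u
    have e : ∀ p, fderiv ℂ (fun y => W k y p) z u =
        fderiv ℂ (fun y => w k y 0 * H y 0 p + w k y 1 * H y 1 p) z u := by
      intro p
      refine congrArg (fun l : E →L[ℂ] ℂ => l u) (Filter.EventuallyEq.fderiv_eq ?_)
      filter_upwards [h] with y hy
      rw [(hy.2 k).2.2.2, vecMul_apply]
    ext p
    rw [fderiv_vec_apply (hW k), e, fderiv_add_apply ((cv (hw k) 0).mul (hH 0 p))
      ((cv (hw k) 1).mul (hH 1 p)), fderiv_mul_apply (cv (hw k) 0) (hH 0 p),
      fderiv_mul_apply (cv (hw k) 1) (hH 1 p)]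
    simp only [hX, Pi.add_apply, vecMul_apply, Matrix.of_apply, fderiv_vec_apply (hw k)]
    ring
  -- the sum of the lifts
  set P : E → Mat := fun y => ∑ k, Matrix.vecMulVec (V k y) (w k y) with hP
  set dP : E → Mat := fun u => ∑ k, (Matrix.vecMulVec (V k z) (fderiv ℂ (w k) z u) +
    Matrix.vecMulVec (fderiv ℂ (V k) z u) (w k z)) with hdP
  -- `H V_k w_k = v_k w_k = A^{(k)} + ρ_k`, where `ρ_k` is the chosen eigenvalue. Here the vanishing
  -- of `∑ A^{(k)}` enters.
  have hHP : ∀ᶠ y in 𝓝 z, H y * P y = (∑ k, eig s k) • (1 : Mat) := by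
    filter_upwards [h, hsum] with y hy hs0
    have : ∀ k, H y * Matrix.vecMulVec (V k y) (w k y) = (F y k).A + eig s k • (1 : Mat) := by
      intro k
      rw [Matrix.mul_vecMulVec, ← (hy.2 k).2.2.1, (hy.2 k).1.A_eq]
      refine mat_ext ?_ ?_ ?_ ?_ <;> simp [Matrix.vecMulVec_apply]
    rw [hP, Finset.mul_sum, Finset.sum_congr rfl fun k _ => this k, Finset.sum_add_distrib, hs0,
      zero_add, Finset.sum_smul]
  have cP : ∀ p q, ContDiffAt ℂ ∞ (fun y => P y p q) z := by
    intro p q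
    have : (fun y => P y p q) = fun y => ∑ k, V k y p * w k y q := by
      funext y; simp [hP, Matrix.sum_apply, Matrix.vecMulVec_apply]
    rw [this]
    exact ContDiffAt.sum fun k _ => (cv (hV k) p).mul (cv (hw k) q)
  have dPe : ∀ u p q, fderiv ℂ (fun y => P y p q) z u = dP u p q := by
    intro u p q
    have : (fun y => P y p q) = fun y => ∑ k, V k y p * w k y q := by
      funext y; simp [hP, Matrix.sum_apply, Matrix.vecMulVec_apply]
    rw [this, fderiv_fun_sum fun k _ =>
      ((cv (hV k) p).mul (cv (hw k) q)).differentiableAt (by simp)]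
    simp only [hdP, sum_apply, Matrix.sum_apply, Matrix.add_apply,
      Matrix.vecMulVec_apply]
    refine Finset.sum_congr rfl fun k _ => ?_
    rw [fderiv_mul_apply (cv (hV k) p) (cv (hw k) q), fderiv_vec_apply (hV k),
      fderiv_vec_apply (hw k)]
    ring
  have hvar : ∀ u, X u * P z + H z * dP u = 0 := by
    intro u
    ext p q
    have e0 : ∀ᶠ y in 𝓝 z, H y p 0 * P y 0 q + H y p 1 * P y 1 q =
        ((∑ k, eig s k) • (1 : Mat)) p q := by
      filter_upwards [hHP] with y hy
      rw [← hy]; simp [Matrix.mul_apply, Fin.sum_univ_two]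
    have e1 := fderiv_eq_zero_of_eventually e0 u
    rw [fderiv_add_apply ((hH p 0).mul (cP 0 q)) ((hH p 1).mul (cP 1 q)),
      fderiv_mul_apply (hH p 0) (cP 0 q), fderiv_mul_apply (hH p 1) (cP 1 q), dPe, dPe] at e1
    simp only [Matrix.add_apply, Matrix.mul_apply, Fin.sum_univ_two, hX, Matrix.of_apply,
      Matrix.zero_apply]
    linear_combination e1
  have htr := trace_variation h.self_of_nhds.1.2.2 hHP.self_of_nhds (hvar u) (hvar u')
  have hall : ∑ k, wedge (fderiv ℂ (v k) z u) (fderiv ℂ (w k) z u) (fderiv ℂ (v k) z u')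
      (fderiv ℂ (w k) z u') = ∑ k, wedge (fderiv ℂ (V k) z u) (fderiv ℂ (W k) z u)
      (fderiv ℂ (V k) z u') (fderiv ℂ (W k) z u') := by
    rw [← sub_eq_zero, ← Finset.sum_sub_distrib]
    have : ∀ k, wedge (fderiv ℂ (v k) z u) (fderiv ℂ (w k) z u) (fderiv ℂ (v k) z u')
        (fderiv ℂ (w k) z u') - wedge (fderiv ℂ (V k) z u) (fderiv ℂ (W k) z u)
        (fderiv ℂ (V k) z u') (fderiv ℂ (W k) z u') =
        (X u' * (Matrix.vecMulVec (V k z) (fderiv ℂ (w k) z u) +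
          Matrix.vecMulVec (fderiv ℂ (V k) z u) (w k z))).trace -
        (X u * (Matrix.vecMulVec (V k z) (fderiv ℂ (w k) z u') +
          Matrix.vecMulVec (fderiv ℂ (V k) z u') (w k z))).trace := by
      intro k
      rw [dv k u, dv k u', dW k u, dW k u']
      exact wedge_frame _ _ _ _ _ _ _ _ _
    rw [Finset.sum_congr rfl fun k _ => this k, Finset.sum_sub_distrib, ← Matrix.trace_sum,
      ← Matrix.trace_sum, ← Finset.mul_sum, ← Finset.mul_sum]
    exact sub_eq_zero.2 htr
  rw [hall, sum_eq_add_sum_rest hi hj hij]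
  -- the matrices with the indices `0, i, j` do not contribute
  have hdot : ∀ k u, W k z 0 * fderiv ℂ (V k) z u 0 + V k z 0 * fderiv ℂ (W k) z u 0 +
      (W k z 1 * fderiv ℂ (V k) z u 1 + V k z 1 * fderiv ℂ (W k) z u 1) = 0 := by
    intro k u
    have e1 := fderiv_eq_zero_of_eventually (h.mono fun y hy => (hy.2 k).2.1.dot) u
    rw [fderiv_add_apply ((cv (hW k) 0).mul (cv (hV k) 0)) ((cv (hW k) 1).mul (cv (hV k) 1)),
      fderiv_mul_apply (cv (hW k) 0) (cv (hV k) 0), fderiv_mul_apply (cv (hW k) 1) (cv (hV k) 1)]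
      at e1
    simp only [fderiv_vec_apply (hV k), fderiv_vec_apply (hW k)]
    linear_combination e1
  -- The lifts of the normal form are fixed only up to scale, so `V_0` and `V_i` lie on the axes
  -- without being the basis vectors; the product `V₀ W₁` for the index `j` does not depend on the
  -- scale.
  have e00 : ∀ᶠ y in 𝓝 z, V 0 y 0 = 0 := by
    filter_upwards [h] with y hy
    obtain ⟨w', hw'⟩ := hy.1.2.1.lift_zero
    obtain ⟨c, -, hc, -⟩ := hw'.proportional (hy.2 0).2.1
    rw [hc]; simp
  have ei1 : ∀ᶠ y in 𝓝 z, V i y 1 = 0 := by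
    filter_upwards [h] with y hy
    obtain ⟨w', hw'⟩ := hy.1.2.1.lift_i
    obtain ⟨c, -, hc, -⟩ := hw'.proportional (hy.2 i).2.1
    rw [hc]; simp
  have ej : ∀ᶠ y in 𝓝 z, V j y 0 * W j y 1 = 1 := by
    filter_upwards [h] with y hy
    have h1 := congrFun (congrFun (hy.2 j).2.1.A_eq 0) 1
    rw [hy.1.2.1.A_j] at h1
    exact h1.symm
  have d0 : ∀ u, fderiv ℂ (V 0) z u 0 = 0 := fun u => by
    rw [fderiv_vec_apply (hV 0), fderiv_eq_zero_of_eventually e00]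
  have di : ∀ u, fderiv ℂ (V i) z u 1 = 0 := fun u => by
    rw [fderiv_vec_apply (hV i), fderiv_eq_zero_of_eventually ei1]
  have dj : ∀ u, W j z 1 * fderiv ℂ (V j) z u 0 + V j z 0 * fderiv ℂ (W j) z u 1 = 0 := by
    intro u
    have e1 := fderiv_eq_zero_of_eventually ej u
    rw [fderiv_mul_apply (cv (hV j) 0) (cv (hW j) 1)] at e1
    rw [fderiv_vec_apply (hV j), fderiv_vec_apply (hW j)]
    exact e1
  have z0 : V 0 z 1 ≠ 0 := by
    have := vec_ne_zero.1 (h.self_of_nhds.2 0).2.1.ne_zero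
    rw [e00.self_of_nhds] at this
    simpa using this
  have zi : V i z 0 ≠ 0 := by
    have := vec_ne_zero.1 (h.self_of_nhds.2 i).2.1.ne_zero
    rw [ei1.self_of_nhds] at this
    simpa using this
  have zj : V j z 0 ≠ 0 := left_ne_zero_of_mul (by rw [ej.self_of_nhds]; exact one_ne_zero)
  have dot0 : ∀ u, W 0 z 1 * fderiv ℂ (V 0) z u 1 + V 0 z 1 * fderiv ℂ (W 0) z u 1 = 0 := by
    intro u
    have := hdot 0 u
    rw [d0, e00.self_of_nhds] at this
    linear_combination this
  have doti : ∀ u, W i z 0 * fderiv ℂ (V i) z u 0 + V i z 0 * fderiv ℂ (W i) z u 0 = 0 := by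
    intro u
    have := hdot i u
    rw [di, ei1.self_of_nhds] at this
    linear_combination this
  rw [wedge_eq_zero_of_left z0 (d0 u) (d0 u') (dot0 u) (dot0 u'),
    wedge_eq_zero_of_right zi (di u) (di u') (doti u) (doti u'),
    wedge_eq_zero_of_mul zj (dj u) (dj u') (hdot j u) (hdot j u')]
  simp

end Reduction

/-! ### The section defined by the normal forms -/

section Section

variable {n : ℕ} {a : Fin (n + 1) → ℂ} {s : Fin (n + 1) → ℂ} {i j : Fin (n + 1)}

/-- The element `βⱼ`, as a function of the sum of the matrices with indices different from
`0, i, j`. -/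
def secBeta (s : Fin (n + 1) → ℂ) (i : Fin (n + 1)) (S : Mat) : ℂ := -(s 0 / 2 + s i / 2 + S 0 0)

/-- Vector components of the lifts of the matrices `A^{(0)}, A^{(i)}, A^{(j)}` of a normal form. -/
def secV (s : Fin (n + 1) → ℂ) (i : Fin (n + 1)) (S : Mat) (k : Fin (n + 1)) : Fin 2 → ℂ :=
  if k = 0 then ![0, 1] else if k = i then ![1, 0] else ![1, s k / 2 - secBeta s i S]

/-- Covector components of the lifts of the matrices `A^{(0)}, A^{(i)}, A^{(j)}` of a normal
form. -/
def secW (a s : Fin (n + 1) → ℂ) (i j : Fin (n + 1)) (S : Mat) (k : Fin (n + 1)) : Fin 2 → ℂ :=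
  if k = 0 then ![-(S 1 0 + (a j / 2 - secBeta s i S ^ 2)), -s 0]
  else if k = i then ![s i, -(S 0 1 + 1)] else ![secBeta s i S + s k / 2, 1]

/-- The prescribed lifts satisfy `w·v = 2ρ` identically, so they define points of the quadrics for
every `y`, including values where `A^{(0)}` or `A^{(i)}` vanishes. -/
lemma exists_section (hs : ∀ k, s k ^ 2 = 2 * a k) (y : QuadProd (rest a i j)) :
    ∃ x : QuadProd a, restrict i j x = y ∧ ∀ k, ¬(k ≠ 0 ∧ k ≠ i ∧ k ≠ j) →
      IsLift (eig s k) (secV s i (∑ k, (y k).A) k) (secW a s i j (∑ k, (y k).A) k) (x k) := by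
  classical
  set S : Mat := ∑ k, (y k).A
  -- The formula for `j` makes sense for all remaining indices, so a point is built for each `k` and
  -- then overwritten by `y` outside `0, i, j`.
  have h : ∀ k, ∃ x : Quad (a k), IsLift (eig s k) (secV s i S k) (secW a s i j S k) x := by
    intro k
    refine exists_isLift_of_dot ?_ ?_ (eig_sq hs k)
    · rw [vec_ne_zero]
      unfold secV
      split_ifs <;> simp
    · unfold secV secW eig
      split_ifs with h0 h1
      · simp
        ring
      · simp [h1]
        ring
      · simp
        ring
  choose x hx using h
  refine ⟨fun k => if h : k ≠ 0 ∧ k ≠ i ∧ k ≠ j then y ⟨k, h⟩ else x k, ?_, ?_⟩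
  · funext k
    exact dif_pos k.2
  · intro k hk
    simp only [dif_neg hk]
    exact hx k

/-- The point in the normal form with given factors of indices different from `0, i, j`. -/
def sectionMap (hs : ∀ k, s k ^ 2 = 2 * a k) (y : QuadProd (rest a i j)) : QuadProd a :=
  (exists_section hs y).choose

variable (hs : ∀ k, s k ^ 2 = 2 * a k)

lemma restrict_sectionMap (y : QuadProd (rest a i j)) : restrict i j (sectionMap hs y) = y :=
  (exists_section hs y).choose_spec.1

lemma isLift_sectionMap (y : QuadProd (rest a i j)) {k : Fin (n + 1)}
    (hk : ¬(k ≠ 0 ∧ k ≠ i ∧ k ≠ j)) : IsLift (eig s k) (secV s i (∑ k, (y k).A) k)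
      (secW a s i j (∑ k, (y k).A) k) (sectionMap hs y k) :=
  (exists_section hs y).choose_spec.2 k hk

lemma sectionMap_A (hi : i ≠ 0) (hj : j ≠ 0) (hij : i ≠ j) (y : QuadProd (rest a i j))
    (k : Fin (n + 1)) : (sectionMap hs y k).A = restore a s i j y k := by
  unfold restore
  by_cases hk : k ≠ 0 ∧ k ≠ i ∧ k ≠ j
  · simp only [dif_pos hk]
    exact congrArg Quad.A (congrFun (restrict_sectionMap hs y) ⟨k, hk⟩)
  · simp only [dif_neg hk]
    rw [(isLift_sectionMap hs y hk).A_eq]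
    have hk' : k = 0 ∨ k = i ∨ k = j := by tauto
    rcases hk' with rfl | rfl | rfl
    · refine mat_ext ?_ ?_ ?_ ?_ <;> simp [secV, secW, eig, secBeta] <;> ring
    · refine mat_ext ?_ ?_ ?_ ?_ <;> simp [secV, secW, eig, hi]; ring
    -- The lower left entry `(s_j/2 - β)(s_j/2 + β)` equals `a_j/2 - β²` because `s_j² = 2 a_j`.
    · have e := hs k
      refine mat_ext ?_ ?_ ?_ ?_ <;> simp [secV, secW, eig, hj, hij.symm, secBeta]
      linear_combination e / 4

lemma isNormal_sectionMap (hi : i ≠ 0) (hj : j ≠ 0) (hij : i ≠ j) (y : QuadProd (rest a i j)) :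
    IsNormal s i j (sectionMap hs y) := by
  refine ⟨⟨_, isLift_sectionMap hs y (k := 0) (by simp)⟩, ?_, ?_⟩
  · have := isLift_sectionMap hs y (k := i) (by simp)
    simp only [secV, hi, if_false, if_true] at this
    exact ⟨_, this⟩
  · rw [sectionMap_A hs hi hj hij]
    simp [restore, hj, hij.symm]

lemma sum_restore (hi : i ≠ 0) (hj : j ≠ 0) (hij : i ≠ j) (y : QuadProd (rest a i j)) :
    ∑ k, restore a s i j y k = 0 := by
  rw [sum_eq_add_sum_rest hi hj hij]
  have h : ∀ k : Rest i j, restore a s i j y k = (y k).A := by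
    intro k
    simp [restore, k.2]
  rw [Finset.sum_congr rfl fun k _ => h k]
  have tr : (∑ k, (y k).A) 1 1 = -(∑ k, (y k).A) 0 0 := by
    simp only [Matrix.sum_apply, Quad.A_one_one, Finset.sum_neg_distrib]
  refine mat_ext ?_ ?_ ?_ ?_ <;> simp only [Matrix.add_apply, tr] <;>
    simp [restore, hi, hj, hij.symm] <;> ring

lemma sum_sectionMap (hi : i ≠ 0) (hj : j ≠ 0) (hij : i ≠ j) (y : QuadProd (rest a i j)) :
    ∑ k, (sectionMap hs y k).A = 0 := by
  rw [Finset.sum_congr rfl fun k _ => sectionMap_A hs hi hj hij y k, sum_restore hi hj hij]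

/-- A point in the normal form with zero sum of the matrices is restored by its factors with
indices different from `0, i, j`. -/
lemma IsNormal.eq_sectionMap (hi : i ≠ 0) (hj : j ≠ 0) (hij : i ≠ j) {x : QuadProd a}
    (hx : IsNormal s i j x) (hsum : ∑ k, (x k).A = 0) : x = sectionMap hs (restrict i j x) := by
  have hN := isNormal_sectionMap hs hi hj hij (restrict i j x)
  have hr := restrict_sectionMap hs (restrict i j x)
  have hsum' := sum_sectionMap hs hi hj hij (restrict i j x)
  set x' := sectionMap hs (restrict i j x)
  obtain ⟨w0, h0⟩ := hx.lift_zero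
  obtain ⟨wi, hwi⟩ := hx.lift_i
  obtain ⟨w0', h0'⟩ := hN.lift_zero
  obtain ⟨wi', hwi'⟩ := hN.lift_i
  have hrest : ∀ k : Rest i j, x k = x' k := fun k => (congrFun hr k).symm
  have hS : (x 0).A + (x i).A + (x j).A = (x' 0).A + (x' i).A + (x' j).A := by
    rw [sum_eq_add_sum_rest hi hj hij] at hsum hsum'
    rw [Finset.sum_congr rfl fun k _ => congrArg Quad.A (hrest k)] at hsum
    exact add_right_cancel (hsum.trans hsum'.symm)
  have ent : ∀ {x x' : Mat} (p q), x = x' → x p q = x' p q := fun p q h => by rw [h]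
  have d0 := h0.dot
  have d0' := h0'.dot
  have di := hwi.dot
  have di' := hwi'.dot
  have A0 := h0.A_eq
  have A0' := h0'.A_eq
  have Ai := hwi.A_eq
  have Ai' := hwi'.A_eq
  simp at d0 d0' di di'
  -- The diagonals of `A^{(0)}` and `A^{(i)}` are determined by their eigenvalues, so zero sum gives
  -- the diagonal of `A^{(j)}`. Its upper right entry is `1`, and `⟨A, A⟩ = a_j` gives the last
  -- entry.
  have hAj : (x j).A = (x' j).A := by
    have j00 : (x j).A 0 0 = (x' j).A 0 0 := by
      have := ent 0 0 hS
      rw [A0, A0', Ai, Ai'] at this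
      simp [di, di'] at this
      exact this
    have j01 : (x j).A 0 1 = (x' j).A 0 1 := hx.A_j.trans hN.A_j.symm
    have hp : ∀ y : Quad (a j), y.A 0 1 = 1 → y.A 1 0 = a j / 2 - y.A 0 0 ^ 2 := by
      intro y hy
      have := y.pair_self
      simp [pair, Matrix.trace_fin_two, Matrix.mul_apply, Fin.sum_univ_two, y.A_one_one, hy] at this
      linear_combination this / 2
    refine mat_ext j00 j01 ?_ ?_
    · rw [hp _ hx.A_j, hp _ hN.A_j, j00]
    · rw [Quad.A_one_one, Quad.A_one_one, j00]
  have hA0i : (x 0).A + (x i).A = (x' 0).A + (x' i).A := by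
    rw [hAj] at hS
    exact add_right_cancel hS
  -- `A^{(0)}` is lower triangular and `A^{(i)}` is upper triangular, so the known sum separates
  -- into the two off-diagonal entries.
  have hA0 : (x 0).A = (x' 0).A := by
    have h10 := ent 1 0 hA0i
    rw [A0, A0', Ai, Ai'] at h10
    simp at h10
    rw [A0, A0']
    refine mat_ext ?_ ?_ ?_ ?_ <;> simp [d0, d0', h10]
  have hAi : (x i).A = (x' i).A := by
    rw [hA0] at hA0i
    exact add_left_cancel hA0i
  funext k
  by_cases hk : k ≠ 0 ∧ k ≠ i ∧ k ≠ j
  · exact hrest ⟨k, hk⟩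
  · have hk' : k = 0 ∨ k = i ∨ k = j := by tauto
    rcases hk' with rfl | rfl | rfl
    -- These matrices may vanish, and the lines agree because the lifts share their vector.
    -- `A^{(j)}` is never zero, having an entry `1`.
    · exact h0.eq_of_A_eq h0' hA0
    · exact hwi.eq_of_A_eq hwi' hAi
    · refine Quad.eq_of_A_eq hAj fun h => ?_
      have := hx.A_j
      rw [h] at this
      simp at this

variable {ET T : Type} [NormedAddCommGroup ET] [NormedSpace ℂ ET] [TopologicalSpace T]
  [ChartedSpace ET T] {t : T}

lemma contMDiffAt_A {a : ℂ} {F : T → Quad a} (hF : ContMDiffAt 𝓘(ℂ, ET) 𝓘(ℂ, ℂ × ℂ) ∞ F t)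
    (p q : Fin 2) : ContMDiffAt 𝓘(ℂ, ET) 𝓘(ℂ, ℂ) ∞ (fun u => (F u).A p q) t := by
  obtain ⟨v, w, hv, hw, h⟩ := exists_isLift_of_contMDiffAt hF (root_sq' a)
  have h1 : ContMDiffAt 𝓘(ℂ, ET) 𝓘(ℂ, ℂ) ∞
      (fun u => v u p * w u q - (root a • (1 : Mat)) p q) t :=
    ((contMDiffAt_comp_vec hv p).mul (contMDiffAt_comp_vec hw q)).sub contMDiffAt_const
  refine h1.congr_of_eventuallyEq ?_
  filter_upwards [h] with u hu
  rw [hu.A_eq]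
  fin_cases p <;> fin_cases q <;> simp

lemma contMDiffAt_sum_A {ι : Type} [Fintype ι] {a : ι → ℂ} {F : T → QuadProd a}
    (hF : ContMDiffAt 𝓘(ℂ, ET) 𝓘(ℂ, ι → ℂ × ℂ) ∞ F t) (p q : Fin 2) :
    ContMDiffAt 𝓘(ℂ, ET) 𝓘(ℂ, ℂ) ∞ (fun u => (∑ k, (F u k).A) p q) t := by
  simp only [Matrix.sum_apply]
  exact contMDiffAt_finsetSum fun k _ => contMDiffAt_A (contMDiffAt_quadProd.1 hF k) p q

lemma contMDiffAt_sectionMap {F : T → QuadProd (rest a i j)}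
    (hF : ContMDiffAt 𝓘(ℂ, ET) 𝓘(ℂ, Rest i j → ℂ × ℂ) ∞ F t) :
    ContMDiffAt 𝓘(ℂ, ET) 𝓘(ℂ, Fin (n + 1) → ℂ × ℂ) ∞ (fun u => sectionMap hs (F u)) t := by
  rw [contMDiffAt_quadProd]
  intro k
  by_cases hk : k ≠ 0 ∧ k ≠ i ∧ k ≠ j
  · have h := contMDiffAt_quadProd.1 hF ⟨k, hk⟩
    have e : (fun u => F u ⟨k, hk⟩) = fun u => sectionMap hs (F u) k :=
      funext fun u => (congrFun (restrict_sectionMap hs (F u)) ⟨k, hk⟩).symm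
    exact e ▸ h
  · have hS := contMDiffAt_sum_A hF
    have hβ : ContMDiffAt 𝓘(ℂ, ET) 𝓘(ℂ, ℂ) ∞ (fun u => secBeta s i (∑ k, (F u k).A)) t :=
      (contMDiffAt_const.add (hS 0 0)).neg
    refine contMDiffAt_of_isLift (ρ := eig s k) ?_ ?_
      (Filter.Eventually.of_forall fun u => isLift_sectionMap hs (F u) hk)
    · unfold secV
      split_ifs
      · exact contMDiffAt_const
      · exact contMDiffAt_const
      · exact contMDiffAt_vec contMDiffAt_const (contMDiffAt_const.sub hβ)
    · unfold secW
      split_ifs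
      · exact contMDiffAt_vec ((hS 1 0).add (contMDiffAt_const.sub (hβ.pow 2))).neg contMDiffAt_const
      · exact contMDiffAt_vec contMDiffAt_const ((hS 0 1).add contMDiffAt_const).neg
      · exact contMDiffAt_vec (hβ.add contMDiffAt_const) contMDiffAt_const

end Section

/-! ### The lines `(σ^{(s)})` and accompanying bases -/

section Sigma

variable {a ρ : ℂ} {v w : Fin 2 → ℂ} {x : Quad a}

lemma conj_inv_conj (g : SL2) (A : Mat) : conj g⁻¹ (conj g A) = A := by
  rw [← LinearMap.comp_apply, ← conj_mul, inv_mul_cancel, conj_one]; rfl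

lemma conj_conj_inv (g : SL2) (A : Mat) : conj g (conj g⁻¹ A) = A := by
  rw [← LinearMap.comp_apply, ← conj_mul, mul_inv_cancel, conj_one]; rfl

lemma conj_mul_conj (g : SL2) (A B : Mat) : conj g A * conj g B = conj g (A * B) := by
  change (g : Mat) * A * ((g⁻¹ : SL2) : Mat) * ((g : Mat) * B * ((g⁻¹ : SL2) : Mat)) =
    (g : Mat) * (A * B) * ((g⁻¹ : SL2) : Mat)
  calc _ = (g : Mat) * A * (((g⁻¹ : SL2) : Mat) * (g : Mat)) * B * ((g⁻¹ : SL2) : Mat) := by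
        simp only [mul_assoc]
    _ = _ := by rw [inv_mul_coe]; simp only [mul_one, mul_assoc]

lemma isUnit_coe (g : SL2) : IsUnit (g : Mat) := by
  rw [Matrix.isUnit_iff_isUnit_det, g.det_coe]; exact isUnit_one

/-- `nilp v` is the operator `u ↦ det (u, v) v`, and `g` preserves determinants of pairs of vectors.
-/
lemma nilp_conj (g : SL2) (v : Fin 2 → ℂ) : conj g (nilp v) = nilp ((g : Mat) *ᵥ v) := by
  refine (isUnit_coe g).mul_right_cancel ?_
  have hd := g.det_coe
  rw [Matrix.det_fin_two] at hd
  rw [conj_mul_coe]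
  refine mat_ext ?_ ?_ ?_ ?_ <;>
    simp [nilp, Matrix.mul_apply, Fin.sum_univ_two, mulVec_apply_zero, mulVec_apply_one]
  · linear_combination (-v 1 * ((g : Mat) 0 0 * v 0 + (g : Mat) 0 1 * v 1)) * hd
  · linear_combination (v 0 * ((g : Mat) 0 0 * v 0 + (g : Mat) 0 1 * v 1)) * hd
  · linear_combination (-v 1 * ((g : Mat) 1 0 * v 0 + (g : Mat) 1 1 * v 1)) * hd
  · linear_combination (v 0 * ((g : Mat) 1 0 * v 0 + (g : Mat) 1 1 * v 1)) * hd

lemma smul_mem_sigmaLine {s : ℂ} {B : Mat} (hB : B ∈ sigmaLine s x) (g : SL2) :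
    conj g B ∈ sigmaLine s (g • x) := by
  unfold sigmaLine at hB ⊢
  by_cases h : x.A = 0
  · rw [if_pos h] at hB
    rw [if_pos (by rw [smul_A, h, map_zero])]
    exact Submodule.mem_map_of_mem hB
  · rw [if_neg h] at hB
    rw [if_neg (show ¬(g • x).A = 0 from conj_ne_zero g h)]
    refine ⟨by rw [trace_conj, hB.1], ?_⟩
    rw [smul_A, conj_mul_conj, conj_mul_conj, ← map_sub, hB.2, map_smul]

lemma smul_mem_sigmaLine_iff {s : ℂ} {B : Mat} (g : SL2) :
    conj g B ∈ sigmaLine s (g • x) ↔ B ∈ sigmaLine s x := by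
  refine ⟨fun h => ?_, fun h => smul_mem_sigmaLine h g⟩
  have := smul_mem_sigmaLine h g⁻¹
  rwa [conj_inv_conj, inv_smul_smul] at this

lemma exists_sl_mulVec (hv : v ≠ 0) : ∃ g : SL2, (g : Mat) *ᵥ v = ![0, 1] := by
  rcases vec_ne_zero.1 hv with h | h
  · refine ⟨⟨!![v 1, -v 0; (v 0)⁻¹, 0], by simp [Matrix.det_fin_two, h]⟩, ?_⟩
    ext p; fin_cases p
    · simp [Matrix.mulVec, dotProduct, Fin.sum_univ_two]; ring
    · simp [Matrix.mulVec, dotProduct, Fin.sum_univ_two, h]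
  · refine ⟨⟨!![v 1, -v 0; 0, (v 1)⁻¹], by simp [Matrix.det_fin_two, h]⟩, ?_⟩
    ext p; fin_cases p
    · simp [Matrix.mulVec, dotProduct, Fin.sum_univ_two]; ring
    · simp [Matrix.mulVec, dotProduct, Fin.sum_univ_two, h]

lemma mem_sigmaLine_of_normal (h : IsLift ρ ![0, 1] w x) {B : Mat} :
    B ∈ sigmaLine (2 * ρ) x ↔ ∃ c : ℂ, B = c • nilp ![0, 1] := by
  unfold sigmaLine
  have hd := h.dot
  simp at hd
  by_cases h0 : x.A = 0
  · rw [if_pos h0]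
    have ha : a = 0 := by rw [← x.pair_self, h0]; simp [pair]
    change B ∈ x.line ↔ _
    rw [h.line_eq ha, Submodule.mem_span_singleton]
    exact exists_congr fun c => eq_comm
  · rw [if_neg h0, h.A_eq]
    constructor
    · rintro ⟨ht, hB⟩
      have t1 : B 1 1 = -B 0 0 := by rw [Matrix.trace_fin_two] at ht; linear_combination ht
      have e00 := congrFun (congrFun hB 0) 0
      have e01 := congrFun (congrFun hB 0) 1
      have e10 := congrFun (congrFun hB 1) 0
      simp [Matrix.vecMul, dotProduct, Matrix.mul_apply, Fin.sum_univ_two, t1, hd] at e00 e01 e10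
      refine ⟨B 1 0, ?_⟩
      have key : B 0 1 = 0 ∧ B 0 0 = 0 := by
        -- For `ρ = 0` the eigenspace is the centralizer of a non-zero nilpotent matrix; for `ρ ≠ 0`
        -- the eigenvalue `2ρ` of `ad A` is simple.
        by_cases hρ : ρ = 0
        · subst hρ
          have hw : w 0 ≠ 0 := by
            intro hw
            apply h0
            rw [h.A_eq]
            refine mat_ext ?_ ?_ ?_ ?_ <;> simp [hw, hd]
          constructor
          · exact (mul_eq_zero.1 (by linear_combination -e00 : w 0 * B 0 1 = 0)).resolve_left hw
          · exact (mul_eq_zero.1 (by linear_combination e10 / 2 : w 0 * B 0 0 = 0)).resolve_left hw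
        · have h1 : B 0 1 = 0 :=
            (mul_eq_zero.1 (by linear_combination -e01 / 4 : ρ * B 0 1 = 0)).resolve_left hρ
          refine ⟨h1, (mul_eq_zero.1 (?_ : ρ * B 0 0 = 0)).resolve_left hρ⟩
          rw [h1] at e00
          linear_combination -e00 / 2
      refine mat_ext ?_ ?_ ?_ ?_ <;> simp [nilp, key.1, key.2, t1]
    · rintro ⟨c, rfl⟩
      refine ⟨by simp [nilp, Matrix.trace_fin_two], ?_⟩
      refine mat_ext ?_ ?_ ?_ ?_ <;>
        simp [nilp, hd]
      ring

/-- The line `(σ^{(2 ρ)})` is spanned by the nilpotent matrix with the image `v`. -/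
lemma mem_sigmaLine_iff (h : IsLift ρ v w x) {B : Mat} :
    B ∈ sigmaLine (2 * ρ) x ↔ ∃ c : ℂ, B = c • nilp v := by
  obtain ⟨g, hg⟩ := exists_sl_mulVec h.ne_zero
  obtain ⟨w', -, hw'⟩ := exists_sl_lift h g
  rw [hg] at hw'
  rw [← smul_mem_sigmaLine_iff g, mem_sigmaLine_of_normal hw']
  refine exists_congr fun c => ?_
  rw [← hg, ← nilp_conj, ← map_smul]
  constructor
  · intro h
    rw [← conj_inv_conj g B, h, conj_inv_conj]
  · intro h
    rw [h]

/-- With `pair_nilp_A` this turns the orthogonality conditions that define `Ũ` into the two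
inequalities for lifts that define the domain of the normal form. -/
lemma pair_nilp_nilp (u v : Fin 2 → ℂ) : pair (nilp u) (nilp v) = -det₂ v u ^ 2 := by
  simp [pair, nilp, det₂, Matrix.trace_fin_two]; ring

lemma pair_nilp_A (h : IsLift ρ v w x) (u : Fin 2 → ℂ) : pair (nilp u) x.A = delta v w u := by
  rw [h.A_eq]
  simp [pair, nilp, delta, det₂, Matrix.trace_fin_two]; ring

lemma pair_smul_left (c : ℂ) (A B : Mat) : pair (c • A) B = c * pair A B := by
  simp [pair]

lemma pair_smul_right (c : ℂ) (A B : Mat) : pair A (c • B) = c * pair A B := by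
  simp [pair]

end Sigma

/-! ### Accompanying bases and normal forms -/

section Accompanying

variable {n : ℕ} {a : Fin (n + 1) → ℂ} {s : Fin (n + 1) → ℂ} {i j : Fin (n + 1)}

lemma two_mul_eig_zero : 2 * eig s 0 = -s 0 := by simp [eig]; ring

lemma two_mul_eig (hi : i ≠ 0) : 2 * eig s i = s i := by simp [eig, hi]; ring

/-- In terms of lifts both sides say that `det (v_i, v_0)` and `delta` are non-zero. -/
lemma mem_UTilde_iff (hs : ∀ k, s k ^ 2 = 2 * a k) (hi : i ≠ 0) (x : MTilde a) :
    x ∈ UTilde a s i j ↔ x.1 ∈ domain a s i j := by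
  have hl := fun k => exists_isLift (x.1 k) (eig_sq hs k)
  choose v w hl using hl
  have h0 : ∀ B, B ∈ sigmaLine (-s 0) (x.1 0) ↔ ∃ c : ℂ, B = c • nilp (v 0) := by
    intro B; rw [← two_mul_eig_zero, mem_sigmaLine_iff (hl 0)]
  have hi' : ∀ B, B ∈ sigmaLine (s i) (x.1 i) ↔ ∃ c : ℂ, B = c • nilp (v i) := by
    intro B; rw [← two_mul_eig (s := s) hi, mem_sigmaLine_iff (hl i)]
  constructor
  · rintro ⟨⟨B, hB, C, hC, hBC⟩, B', hB', hBj⟩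
    obtain ⟨b, rfl⟩ := (h0 B).1 hB
    obtain ⟨c, rfl⟩ := (hi' C).1 hC
    obtain ⟨b', rfl⟩ := (h0 B').1 hB'
    rw [pair_smul_left, pair_smul_right, pair_nilp_nilp] at hBC
    rw [pair_smul_left, pair_nilp_A (hl j)] at hBj
    have hD : det₂ (v i) (v 0) ≠ 0 := by
      intro h
      apply hBC
      rw [h]; ring
    obtain ⟨g, hg, -⟩ := isNormal_of_isLift hl hD (right_ne_zero_of_mul hBj)
    exact ⟨g, hg⟩
  · intro hx
    obtain ⟨hD, hδ⟩ := domain_ne_zero hx hl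
    refine ⟨⟨nilp (v 0), (h0 _).2 ⟨1, (one_smul _ _).symm⟩, nilp (v i),
      (hi' _).2 ⟨1, (one_smul _ _).symm⟩, ?_⟩, nilp (v 0), (h0 _).2 ⟨1, (one_smul _ _).symm⟩, ?_⟩
    · rw [pair_nilp_nilp]
      exact neg_ne_zero.2 (pow_ne_zero 2 hD)
    · rwa [pair_nilp_A (hl j)]

/-- The basis `σ₋ = (0 0; 1 0)`, `σ₊ = (0 1; 0 0)`, `σ₃ = (1 0; 0 -1)`. -/
def stdTriple : Triple := ⟨!![0, 0; 1, 0], !![0, 1; 0, 0], !![1, 0; 0, -1]⟩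

/-- Conjugation of the three matrices. -/
def Triple.conj (g : SL2) (σ : Triple) : Triple :=
  ⟨Garnier.conj g σ.m, Garnier.conj g σ.p, Garnier.conj g σ.z⟩

lemma stdTriple_isStandard : stdTriple.IsStandard := by
  constructor <;> simp [stdTriple, pair, Matrix.trace_fin_two]

lemma Triple.IsStandard.conj {σ : Triple} (h : σ.IsStandard) (g : SL2) :
    (σ.conj g).IsStandard where
  trace_m := by rw [← h.trace_m]; exact trace_conj g _
  trace_p := by rw [← h.trace_p]; exact trace_conj g _
  trace_z := by rw [← h.trace_z]; exact trace_conj g _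
  mm := by rw [← h.mm]; exact pair_conj g _ _
  pp := by rw [← h.pp]; exact pair_conj g _ _
  mz := by rw [← h.mz]; exact pair_conj g _ _
  pz := by rw [← h.pz]; exact pair_conj g _ _
  pm := by rw [← h.pm]; exact pair_conj g _ _
  lie := by
    change Garnier.conj g σ.p * Garnier.conj g σ.m - Garnier.conj g σ.m * Garnier.conj g σ.p =
      Garnier.conj g σ.z
    rw [conj_mul_conj, conj_mul_conj, ← map_sub, h.lie]

lemma Accompanying.conj {x : QuadProd a} {σ : Triple} (h : Accompanying s i j x σ) (g : SL2) :
    Accompanying s i j (g • x) (σ.conj g) where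
  standard := h.standard.conj g
  mem_m := smul_mem_sigmaLine h.mem_m g
  mem_p := smul_mem_sigmaLine h.mem_p g
  pair_m := by rw [← h.pair_m]; exact pair_conj g _ _

lemma Triple.conj_inv_conj (g : SL2) (σ : Triple) : (σ.conj g).conj g⁻¹ = σ := by
  simp only [Triple.conj, Garnier.conj_inv_conj]

lemma nilp_e2 : nilp ![0, 1] = stdTriple.m := by
  refine mat_ext ?_ ?_ ?_ ?_ <;> simp [nilp, stdTriple]

lemma nilp_e1 : nilp ![1, 0] = (-1 : ℂ) • stdTriple.p := by
  refine mat_ext ?_ ?_ ?_ ?_ <;> simp [nilp, stdTriple]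

/-- The lines prescribe `σ₋` and `σ₊` up to factors. The pairing with `A^{(j)}` fixes the factor of
`σ₋`, then `⟨σ₊, σ₋⟩ = 1` fixes that of `σ₊`, and `σ₃` is their commutator. -/
lemma IsNormal.accompanying_iff (hi : i ≠ 0) {x : QuadProd a} (hx : IsNormal s i j x)
    {σ : Triple} : Accompanying s i j x σ ↔ σ = stdTriple := by
  obtain ⟨w0, h0⟩ := hx.lift_zero
  obtain ⟨wi, hwi⟩ := hx.lift_i
  have m0 : ∀ B, B ∈ sigmaLine (-s 0) (x 0) ↔ ∃ c : ℂ, B = c • stdTriple.m := by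
    intro B; rw [← two_mul_eig_zero, mem_sigmaLine_iff h0, nilp_e2]
  have mi : ∀ B, B ∈ sigmaLine (s i) (x i) ↔ ∃ c : ℂ, B = c • (-1 : ℂ) • stdTriple.p := by
    intro B; rw [← two_mul_eig (s := s) hi, mem_sigmaLine_iff hwi, nilp_e1]
  have hpj : pair stdTriple.m (x j).A = 1 := by
    rw [← hx.A_j]
    simp [pair, stdTriple, Matrix.trace_fin_two, Matrix.vecMul, dotProduct]
  constructor
  · intro h
    obtain ⟨c, hc⟩ := (m0 _).1 h.mem_m
    obtain ⟨d, hd⟩ := (mi _).1 h.mem_p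
    have c1 : c = 1 := by
      have := h.pair_m
      rwa [hc, pair_smul_left, hpj, mul_one] at this
    rw [c1, one_smul] at hc
    have d1 : d * (-1) = 1 := by
      have := h.standard.pm
      rw [hc, hd, pair_smul_left, pair_smul_left, stdTriple_isStandard.pm] at this
      linear_combination this
    rw [smul_smul, d1, one_smul] at hd
    refine Triple.ext hc hd ?_
    rw [← h.standard.lie, hc, hd, stdTriple_isStandard.lie]
  · rintro rfl
    exact ⟨stdTriple_isStandard, (m0 _).2 ⟨1, (one_smul _ _).symm⟩, (mi _).2 ⟨-1, by simp⟩, hpj⟩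

lemma accompanying_iff (hi : i ≠ 0) {x : QuadProd a} {g : SL2} (hx : IsNormal s i j (g • x))
    {σ : Triple} : Accompanying s i j x σ ↔ σ = stdTriple.conj g⁻¹ := by
  constructor
  · intro h
    rw [← (hx.accompanying_iff hi).1 (h.conj g), Triple.conj_inv_conj]
  · rintro rfl
    have := ((hx.accompanying_iff hi).2 rfl).conj g⁻¹
    rwa [inv_smul_smul] at this

lemma coord_stdTriple {A : Mat} (hA : A.trace = 0) : stdTriple.coord A = A := by
  have t1 : A 1 1 = -A 0 0 := by rw [Matrix.trace_fin_two] at hA; linear_combination hA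
  refine mat_ext ?_ ?_ ?_ ?_ <;>
    simp [Triple.coord, stdTriple, pair, Matrix.trace_fin_two, Matrix.vecMul, dotProduct, t1]

lemma coord_conj (g : SL2) (σ : Triple) (A : Mat) :
    (σ.conj g⁻¹).coord A = σ.coord (conj g A) := by
  have h : ∀ B, pair (conj g⁻¹ B) A = pair B (conj g A) := by
    intro B
    rw [← pair_conj g, conj_conj_inv]
  simp only [Triple.coord, Triple.conj, LinearMap.coe_mk, AddHom.coe_mk, h]

/-- Taking coordinates in the accompanying basis is the same as conjugating to the normal form,
which identifies the normal form without the factors `0, i, j` with the map `π_{0ij}`. The two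
linear maps agree only on traceless matrices, hence the restriction to the line. -/
lemma coord_eq_smul {a : ℂ} (g : SL2) (x : Quad a) :
    (g • x).A = (stdTriple.conj g⁻¹).coord x.A ∧
      (g • x).line = x.line.map (stdTriple.conj g⁻¹).coord := by
  have key : ∀ B ∈ x.line, (stdTriple.conj g⁻¹).coord B = conj g B := by
    intro B hB
    rw [coord_conj, coord_stdTriple (by rw [trace_conj, x.trace_line hB])]
  refine ⟨(key _ x.mem_line).symm, ?_⟩
  rw [smul_line]
  ext B
  simp only [Submodule.mem_map]
  exact ⟨fun ⟨C, hC, h⟩ => ⟨C, hC, (key C hC).trans h⟩,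
    fun ⟨C, hC, h⟩ => ⟨C, hC, (key C hC).symm.trans h⟩⟩

end Accompanying

/-! ### Simultaneous triangularization -/

section Triangular

variable {ι : Type}

lemma det₂_mulVec_eq_zero_iff {v : Fin 2 → ℂ} {A : Mat} (hv : v ≠ 0) :
    det₂ (A *ᵥ v) v = 0 ↔ ∃ c : ℂ, A *ᵥ v = c • v := by
  refine ⟨eq_smul_of_det₂_eq_zero hv, ?_⟩
  rintro ⟨c, hc⟩
  rw [hc]
  simp [det₂]; ring

/-- Simultaneously triangularizable matrices have a common eigenvector. -/
lemma triangular_iff {A : ι → Mat} :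
    Triangular A ↔ ∃ v : Fin 2 → ℂ, v ≠ 0 ∧ ∀ k, det₂ (A k *ᵥ v) v = 0 := by
  constructor
  · rintro ⟨g, hg⟩
    -- This is `g⁻¹ e₁`, the vector killed by the second row of `g`.
    refine ⟨![(g : Mat) 1 1, -(g : Mat) 1 0], ?_, fun k => ?_⟩
    · rw [vec_ne_zero]
      by_contra! h
      have h0 : (g : Mat) 1 1 = 0 := by simpa using h.1
      have h1 : (g : Mat) 1 0 = 0 := by simpa using h.2
      have := g.det_coe
      rw [Matrix.det_fin_two, h0, h1] at this
      simp at this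
    · have := hg k
      rw [conj_apply] at this
      simp [Matrix.mul_apply, Fin.sum_univ_two] at this
      simp [det₂, mulVec_apply_zero, mulVec_apply_one]
      linear_combination -this
  · rintro ⟨v, hv, h⟩
    obtain ⟨g, hg⟩ : ∃ g : SL2, (g : Mat) 1 1 = v 0 ∧ (g : Mat) 1 0 = -v 1 := by
      rcases vec_ne_zero.1 hv with h | h
      · exact ⟨⟨!![(v 0)⁻¹, 0; -v 1, v 0], by simp [Matrix.det_fin_two, h]⟩, by simp⟩
      · exact ⟨⟨!![0, (v 1)⁻¹; -v 1, v 0], by simp [Matrix.det_fin_two, h]⟩, by simp⟩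
    refine ⟨g, fun k => ?_⟩
    have := h k
    simp [det₂, mulVec_apply_zero, mulVec_apply_one] at this
    rw [conj_apply]
    simp [Matrix.mul_apply, Fin.sum_univ_two, hg.1, hg.2]
    linear_combination -this

lemma triangular_smul {ι : Type} {a : ι → ℂ} (x : QuadProd a) (g : SL2) :
    Triangular (fun k => ((g • x) k).A) ↔ Triangular (fun k => (x k).A) := by
  constructor
  · rintro ⟨h, hh⟩
    refine ⟨h * g, fun k => ?_⟩
    rw [conj_mul]
    exact hh k
  · rintro ⟨h, hh⟩
    refine ⟨h * g⁻¹, fun k => ?_⟩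
    have : conj (h * g⁻¹) ((g • x) k).A = conj h (x k).A := by
      rw [conj_mul, LinearMap.comp_apply]
      exact congrArg _ (conj_inv_conj g _)
    rw [this]
    exact hh k

lemma sum_smul_A {ι : Type} [Fintype ι] {a : ι → ℂ} (x : QuadProd a) (g : SL2) :
    ∑ k, ((g • x) k).A = conj g (∑ k, (x k).A) := by
  rw [map_sum]; rfl

/-- The set of families that are not simultaneously triangularizable is open. -/
lemma isOpen_not_triangular {T : Type} [TopologicalSpace T] {F : T → ι → Mat}
    (hF : ∀ k p q, Continuous fun t => F t k p q) : IsOpen {t | ¬Triangular (F t)} := by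
  -- A common eigenvector may be taken on the unit sphere. The complement is then the projection of
  -- a closed set along a compact factor, hence closed.
  have hset : {t | ¬Triangular (F t)}ᶜ = Prod.snd '' {m : Metric.sphere (0 : Fin 2 → ℂ) 1 × T |
      ∀ k, det₂ (F m.2 k *ᵥ m.1.1) m.1.1 = 0} := by
    ext t
    simp only [Set.mem_compl_iff, Set.mem_ofPred_eq, not_not, Set.mem_image, Prod.exists,
      exists_eq_right, triangular_iff]
    constructor
    · rintro ⟨v, hv, h⟩
      have hn : ‖v‖ ≠ 0 := norm_ne_zero_iff.2 hv
      refine ⟨⟨((‖v‖ : ℂ)⁻¹) • v, ?_⟩, fun k => ?_⟩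
      · rw [mem_sphere_zero_iff_norm, norm_smul, norm_inv, Complex.norm_real, norm_norm,
          inv_mul_cancel₀ hn]
      · have e : ∀ c : ℂ, det₂ (F t k *ᵥ (c • v)) (c • v) = c ^ 2 * det₂ (F t k *ᵥ v) v := by
          intro c
          rw [Matrix.mulVec_smul]
          simp [det₂]; ring
        rw [e, h k, mul_zero]
    · rintro ⟨⟨v, hv⟩, h⟩
      exact ⟨v, ne_zero_of_mem_unit_sphere ⟨v, hv⟩, h⟩
  rw [← isClosed_compl_iff, hset]
  refine isClosedMap_snd_of_compactSpace _ ?_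
  simp only [Set.ofPred_forall]
  refine isClosed_iInter fun k => isClosed_eq ?_ continuous_const
  simp only [det₂, mulVec_apply_zero, mulVec_apply_one]
  have hv : ∀ p, Continuous fun m : Metric.sphere (0 : Fin 2 → ℂ) 1 × T => m.1.1 p := fun p =>
    (continuous_apply p).comp (continuous_subtype_val.comp continuous_fst)
  have hA : ∀ p q, Continuous fun m : Metric.sphere (0 : Fin 2 → ℂ) 1 × T => F m.2 k p q :=
    fun p q => (hF k p q).comp continuous_snd
  have h0 := hv 0
  have h1 := hv 1
  have h00 := hA 0 0
  have h01 := hA 0 1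
  have h10 := hA 1 0
  have h11 := hA 1 1
  fun_prop

variable {n : ℕ} {a : Fin (n + 1) → ℂ} {s : Fin (n + 1) → ℂ} {i j : Fin (n + 1)}

/-- Simultaneously triangularizable matrices with zero sum have eigenvalues with zero sum. -/
lemma exists_sum_eq_zero_of_triangular (hs : ∀ k, s k ^ 2 = 2 * a k) {x : QuadProd a}
    (hsum : ∑ k, (x k).A = 0) (h : Triangular fun k => (x k).A) :
    ∃ ε : Fin (n + 1) → ℤˣ, ∑ k, ((ε k : ℤ) : ℂ) * s k = 0 := by
  obtain ⟨v, hv, h⟩ := triangular_iff.1 h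
  have hc := fun k => (det₂_mulVec_eq_zero_iff hv).1 (h k)
  choose c hc using hc
  -- The eigenvalues of `A^{(k)}` are `±s_k/2`, since `2 c² = a_k` for each eigenvalue `c`.
  have hε : ∀ k, ∃ e : ℤˣ, ((e : ℤ) : ℂ) * s k = 2 * c k := by
    intro k
    have e0 := congrFun (hc k) 0
    have e1 := congrFun (hc k) 1
    rw [mulVec_apply_zero] at e0
    rw [mulVec_apply_one, Quad.A_one_one] at e1
    simp only [Pi.smul_apply, smul_eq_mul] at e0 e1
    have hp := (x k).pair_self
    simp [pair, Matrix.trace_fin_two, Matrix.mul_apply, Fin.sum_univ_two, Quad.A_one_one] at hp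
    have hsq : (2 * c k - s k) * (2 * c k + s k) = 0 := by
      have h0 : (2 * c k ^ 2 - a k) * v 0 = 0 := by
        linear_combination (-2 * c k - 2 * (x k).A 0 0) * e0 - 2 * (x k).A 0 1 * e1 + v 0 * hp
      have h1 : (2 * c k ^ 2 - a k) * v 1 = 0 := by
        linear_combination (-2 * c k + 2 * (x k).A 0 0) * e1 - 2 * (x k).A 1 0 * e0 + v 1 * hp
      have h2 : 2 * c k ^ 2 - a k = 0 := by
        rcases vec_ne_zero.1 hv with h | h
        · exact (mul_eq_zero.1 h0).resolve_right h
        · exact (mul_eq_zero.1 h1).resolve_right h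
      linear_combination 2 * h2 - hs k
    rcases mul_eq_zero.1 hsq with h | h
    · exact ⟨1, by push_cast; linear_combination -h⟩
    · exact ⟨-1, by push_cast; linear_combination -h⟩
  choose ε hε using hε
  refine ⟨ε, ?_⟩
  have h1 : (∑ k, c k) • v = 0 := by
    rw [Finset.sum_smul, ← Finset.sum_congr rfl fun k _ => hc k, ← Matrix.sum_mulVec, hsum,
      Matrix.zero_mulVec]
  have h2 : ∑ k, c k = 0 := (smul_eq_zero.1 h1).resolve_right hv
  rw [Finset.sum_congr rfl fun k _ => hε k, ← Finset.mul_sum, h2, mul_zero]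

/-- Every point of `M̃` belongs to the domain of a normal form. -/
lemma exists_mem_domain (hs : ∀ k, s k ^ 2 = 2 * a k) {x : QuadProd a}
    (hT : ¬Triangular fun k => (x k).A) (hsum : ∑ k, (x k).A = 0) :
    ∃ i j : Fin (n + 1), i ≠ 0 ∧ j ≠ 0 ∧ i ≠ j ∧ x ∈ domain a s i j := by
  have hl := fun k => exists_isLift (x k) (eig_sq hs k)
  choose v w hl using hl
  -- These numbers are linear in the matrix, so they sum to zero. That of `k = 0` vanishes as `v_0`
  -- is an eigenvector, and if all vanished, `v_0` would be a common eigenvector. So at least two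
  -- are non-zero, both with `k ≠ 0`.
  have hA : ∀ k, det₂ ((x k).A *ᵥ v 0) (v 0) = delta (v k) (w k) (v 0) := by
    intro k
    rw [(hl k).A_eq]
    simp [det₂, delta, mulVec_apply_zero, mulVec_apply_one]; ring
  have h0 : delta (v 0) (w 0) (v 0) = 0 := by simp [delta, det₂, mul_comm]
  have hsum' : ∑ k, delta (v k) (w k) (v 0) = 0 := by
    have e : ∑ k, det₂ ((x k).A *ᵥ v 0) (v 0) = det₂ ((∑ k, (x k).A) *ᵥ v 0) (v 0) := by
      rw [Matrix.sum_mulVec]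
      simp only [det₂, Finset.sum_apply, Finset.sum_sub_distrib, Finset.sum_mul]
    rw [Finset.sum_congr rfl fun k _ => (hA k).symm, e, hsum, Matrix.zero_mulVec]
    simp [det₂]
  obtain ⟨j, hj⟩ : ∃ j, delta (v j) (w j) (v 0) ≠ 0 := by
    by_contra! h
    exact hT (triangular_iff.2 ⟨v 0, (hl 0).ne_zero, fun k => (hA k).trans (h k)⟩)
  obtain ⟨i, hij, hi⟩ : ∃ i, i ≠ j ∧ delta (v i) (w i) (v 0) ≠ 0 := by
    by_contra! h
    rw [Finset.sum_eq_single j (fun b _ hb => h b hb) (by simp)] at hsum'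
    exact hj hsum'
  have hi0 : i ≠ 0 := by rintro rfl; exact hi h0
  have hj0 : j ≠ 0 := by rintro rfl; exact hj h0
  -- `det (v_i, v_0)` is a factor of the non-zero `delta` of the index `i`.
  obtain ⟨g, hg, -⟩ := isNormal_of_isLift hl (left_ne_zero_of_mul hi) hj
  exact ⟨i, j, hi0, hj0, hij, g, hg⟩

end Triangular

/-! ### The action of `SL(2, ℂ)` is holomorphic -/

section Action

variable {ι : Type} [Fintype ι] {a : ι → ℂ} {ET T : Type} [NormedAddCommGroup ET]
  [NormedSpace ℂ ET] [TopologicalSpace T] [ChartedSpace ET T] {t : T}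

/-- The natural lift `(g v, w g⁻¹)` is rescaled by `c⁻¹` so that only `H` enters; holomorphy in `H`
then requires nothing of `g` and `c`. -/
lemma IsLift.smul_of_eq {a ρ : ℂ} {x : Quad a} {v w : Fin 2 → ℂ} {H : Mat} {g : SL2} {c : ℂ}
    (hc : c ≠ 0) (hH : H = c • (g : Mat)) (h : IsLift ρ v w x) :
    IsLift ρ ((H.det)⁻¹ • (H *ᵥ v)) (w ᵥ* H.adjugate) (g • x) := by
  have hd : H.det = c ^ 2 := by rw [hH, Matrix.det_smul, g.det_coe]; simp
  have hadj : H.adjugate = c • ((g⁻¹ : SL2) : Mat) := by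
    rw [hH, Matrix.adjugate_smul, Matrix.SpecialLinearGroup.coe_inv]; simp
  have key := h.inv_smul (H := H.adjugate) (g := g⁻¹) (c := c) (v' := (H.det)⁻¹ • (H *ᵥ v))
    (w' := w ᵥ* H.adjugate) hc hadj ?_ rfl
  · rwa [inv_inv] at key
  · rw [Matrix.mulVec_smul, Matrix.mulVec_mulVec, Matrix.adjugate_mul, Matrix.smul_mulVec,
      Matrix.one_mulVec, smul_smul, inv_mul_cancel₀ (by rw [hd]; exact pow_ne_zero 2 hc), one_smul]

/-- The action of a family of elements of `SL(2, ℂ)` that is holomorphic up to scalar factors. -/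
lemma contMDiffAt_smul {F : T → QuadProd a} (hF : ContMDiffAt 𝓘(ℂ, ET) 𝓘(ℂ, ι → ℂ × ℂ) ∞ F t)
    {g : T → SL2} {c : T → ℂ} {H : T → Mat}
    (hH : ∀ p q, ContMDiffAt 𝓘(ℂ, ET) 𝓘(ℂ, ℂ) ∞ (fun u => H u p q) t)
    (h : ∀ᶠ u in 𝓝 t, c u ≠ 0 ∧ H u = c u • (g u : Mat)) :
    ContMDiffAt 𝓘(ℂ, ET) 𝓘(ℂ, ι → ℂ × ℂ) ∞ (fun u => g u • F u) t := by
  have hdet : ContMDiffAt 𝓘(ℂ, ET) 𝓘(ℂ, ℂ) ∞ (fun u => (H u).det) t := by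
    simp only [Matrix.det_fin_two]
    exact ((hH 0 0).mul (hH 1 1)).sub ((hH 0 1).mul (hH 1 0))
  have hd0 : (H t).det ≠ 0 := by
    obtain ⟨hc, e⟩ := h.self_of_nhds
    rw [e, Matrix.det_smul, (g t).det_coe]
    simpa using hc
  rw [contMDiffAt_quadProd] at hF ⊢
  intro k
  obtain ⟨v, w, hv, hw, hl⟩ := exists_isLift_of_contMDiffAt (hF k) (root_sq' (a k))
  refine contMDiffAt_of_isLift (ρ := root (a k)) (v := fun u => ((H u).det)⁻¹ • (H u *ᵥ v u))
    (w := fun u => w u ᵥ* (H u).adjugate) ?_ ?_ ?_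
  · refine contMDiffAt_pi_space.2 fun p => ?_
    have hmv : ∀ p, ContMDiffAt 𝓘(ℂ, ET) 𝓘(ℂ, ℂ) ∞ (fun u => (H u *ᵥ v u) p) t := by
      intro p
      fin_cases p
      · exact (((hH 0 0).mul (contMDiffAt_comp_vec hv 0)).add
          ((hH 0 1).mul (contMDiffAt_comp_vec hv 1))).congr_of_eventuallyEq
          (.of_forall fun u => mulVec_apply_zero _ _)
      · exact (((hH 1 0).mul (contMDiffAt_comp_vec hv 0)).add
          ((hH 1 1).mul (contMDiffAt_comp_vec hv 1))).congr_of_eventuallyEq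
          (.of_forall fun u => mulVec_apply_one _ _)
    refine ((hmv p).div₀ hdet hd0).congr_of_eventuallyEq (.of_forall fun u => ?_)
    simp only [Pi.smul_apply, smul_eq_mul]
    exact (div_eq_inv_mul _ _).symm
  · refine contMDiffAt_pi_space.2 fun p => ?_
    have w0 := contMDiffAt_comp_vec hw 0
    have w1 := contMDiffAt_comp_vec hw 1
    fin_cases p
    · refine ((w0.mul (hH 1 1)).sub (w1.mul (hH 1 0))).congr_of_eventuallyEq
        (.of_forall fun u => ?_)
      simp [vecMul_apply, Matrix.adjugate_fin_two]; ring
    · refine ((w1.mul (hH 0 0)).sub (w0.mul (hH 0 1))).congr_of_eventuallyEq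
        (.of_forall fun u => ?_)
      simp [vecMul_apply, Matrix.adjugate_fin_two]; ring
  · filter_upwards [h, hl] with u hu hlu
    exact hlu.smul_of_eq hu.1 hu.2

lemma contMDiff_const_smul (g : SL2) :
    ContMDiff 𝓘(ℂ, ι → ℂ × ℂ) 𝓘(ℂ, ι → ℂ × ℂ) ∞ (fun x : QuadProd a => g • x) := fun x =>
  contMDiffAt_smul (F := id) (g := fun _ => g) (c := fun _ => 1) (H := fun _ => (g : Mat))
    contMDiffAt_id (fun _ _ => contMDiffAt_const) (.of_forall fun _ => ⟨one_ne_zero, by simp⟩)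

instance : ContinuousConstSMul SL2 (QuadProd a) where
  continuous_const_smul g := (contMDiff_const_smul g).continuous

end Action

/-! ### The topology of the phase spaces -/

section Topology

variable {n : ℕ} {a : Fin (n + 1) → ℂ}

lemma incl_isInducing (a : Fin (n + 1) → ℂ) : Topology.IsInducing (MTilde.incl a) := ⟨rfl⟩

instance : MulAction SL2 (MTilde a) where
  smul g x := ⟨g • x.1, by rw [triangular_smul]; exact x.2.1, by rw [sum_smul_A, x.2.2, map_zero]⟩
  one_smul x := Subtype.ext (one_smul _ x.1)
  mul_smul g h x := Subtype.ext (mul_smul g h x.1)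

lemma MTilde.val_smul (g : SL2) (x : MTilde a) : (g • x).1 = g • x.1 := rfl

instance : ContinuousConstSMul SL2 (MTilde a) where
  continuous_const_smul g := (incl_isInducing a).continuous_iff.2
    ((continuous_const_smul g).comp (incl_isInducing a).continuous)

lemma proj_eq_iff {x y : MTilde a} : proj a x = proj a y ↔ ∃ g : SL2, g • y = x := by
  refine Quotient.eq.trans ?_
  change (∃ g : SL2, g • y.1 = x.1) ↔ _
  exact exists_congr fun g => (Subtype.ext_iff (a1 := g • y) (a2 := x)).symm

lemma proj_smul (g : SL2) (x : MTilde a) : proj a (g • x) = proj a x := proj_eq_iff.2 ⟨g, rfl⟩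

lemma proj_isOpenQuotientMap (a : Fin (n + 1) → ℂ) : IsOpenQuotientMap (proj a) where
  surjective := Quotient.mk_surjective
  continuous := continuous_coinduced_rng
  isOpenMap V hV := by
    rw [isOpen_coinduced]
    have : proj a ⁻¹' (proj a '' V) = ⋃ g : SL2, (fun x => g • x) ⁻¹' V := by
      ext x
      simp only [Set.mem_preimage, Set.mem_image, Set.mem_iUnion]
      constructor
      · rintro ⟨y, hy, h⟩
        obtain ⟨g, rfl⟩ := proj_eq_iff.1 h
        exact ⟨g, hy⟩
      · rintro ⟨g, hg⟩
        exact ⟨g • x, hg, proj_smul g x⟩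
    rw [this]
    exact isOpen_iUnion fun g => hV.preimage (continuous_const_smul g)

instance (a : ℂ) : SecondCountableTopology (Quad a) := by
  refine ChartedSpace.secondCountable_of_countable_cover (ℂ × ℂ) (s := {par₁ a 0, par₂ a 0}) ?_
    (Set.toFinite _).countable
  refine Set.eq_univ_of_forall fun x => ?_
  have h2 : par₂ a 0 ∉ Set.range (par₁ a) := by
    rintro ⟨z, hz⟩
    exact (par_ne hz).2 rfl
  rcases mem_range_par x with h | h
  · refine Set.mem_iUnion₂.2 ⟨par₁ a 0, Or.inl rfl, ?_⟩
    rw [chartAt_quad_pos ⟨0, rfl⟩]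
    exact h
  · refine Set.mem_iUnion₂.2 ⟨par₂ a 0, Or.inr rfl, ?_⟩
    rw [chartAt_quad_neg h2]
    exact h

instance : SecondCountableTopology (MTilde a) := (incl_isInducing a).secondCountableTopology

instance : SecondCountableTopology (M a) :=
  (proj_isOpenQuotientMap a).isQuotientMap.secondCountableTopology
    (proj_isOpenQuotientMap a).isOpenMap

/-! ### Intertwining operators and the Hausdorff property of `M` -/

/-- An irreducible family of matrices has no non-zero non-invertible intertwining operators. -/
lemma det_ne_zero_of_intertwine {ι : Type} {A B : ι → Mat} (hA : ¬Triangular A) {m : Mat}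
    (hm : m ≠ 0) (h : ∀ k, m * A k = B k * m) : m.det ≠ 0 := by
  intro hd
  obtain ⟨u, hu, hmu⟩ := Matrix.exists_mulVec_eq_zero_iff.2 hd
  refine hA (triangular_iff.2 ⟨u, hu, fun k => ?_⟩)
  -- The kernel of `m` is invariant under every `A k`. If `A k u` were independent of `u`, then `m`
  -- would kill a basis.
  by_contra hne
  have h2 : m *ᵥ (A k *ᵥ u) = 0 := by
    rw [Matrix.mulVec_mulVec, h k, ← Matrix.mulVec_mulVec, hmu, Matrix.mulVec_zero]
  set u' := A k *ᵥ u
  have e0 := congrFun hmu 0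
  have e1 := congrFun hmu 1
  have f0 := congrFun h2 0
  have f1 := congrFun h2 1
  rw [mulVec_apply_zero] at e0 f0
  rw [mulVec_apply_one] at e1 f1
  simp only [Pi.zero_apply] at e0 e1 f0 f1
  refine hm (mat_ext ?_ ?_ ?_ ?_) <;>
    refine (mul_eq_zero.1 (?_ : det₂ u' u * _ = 0)).resolve_left hne
  · simp only [det₂]; linear_combination u 1 * f0 - u' 1 * e0
  · simp only [det₂]; linear_combination u' 0 * e0 - u 0 * f0
  · simp only [det₂]; linear_combination u 1 * f1 - u' 1 * e1
  · simp only [det₂]; linear_combination u' 0 * e1 - u 0 * f1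

lemma exists_root_sq (a : Fin (n + 1) → ℂ) : ∃ s : Fin (n + 1) → ℂ, ∀ k, s k ^ 2 = 2 * a k :=
  ⟨fun k => 2 * root (a k), fun k => by linear_combination 2 * root_sq' (a k)⟩

/-- The points of one orbit are those related by an intertwining operator. -/
lemma proj_eq_of_intertwine {s : Fin (n + 1) → ℂ} {x y : MTilde a} {m : Mat} (hm : m ≠ 0)
    (h : ∀ k, m * (x.1 k).A = (y.1 k).A * m) {v w v' w' : Fin (n + 1) → Fin 2 → ℂ}
    (hx : ∀ k, IsLift (eig s k) (v k) (w k) (x.1 k))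
    (hy : ∀ k, IsLift (eig s k) (v' k) (w' k) (y.1 k))
    (hd : ∀ k, det₂ (m *ᵥ v k) (v' k) = 0) : proj a x = proj a y := by
  obtain ⟨g, c, hc, rfl⟩ := exists_sl_smul m (det_ne_zero_of_intertwine x.2.1 hm h)
  refine (proj_eq_iff.2 ⟨g, Subtype.ext (funext fun k => ?_)⟩).symm
  have hA : (g • x.1 k).A = (y.1 k).A := by
    refine (isUnit_coe g).mul_right_cancel ?_
    rw [smul_A, conj_mul_coe]
    have := h k
    rw [Matrix.smul_mul, Matrix.mul_smul] at this
    exact smul_right_injective _ hc this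
  -- Equality of matrices leaves the lines open where they vanish; there `hd`, which says that `m`
  -- carries the vectors of the lifts to multiples of each other, supplies the equality.
  obtain ⟨u, -, hu⟩ := exists_sl_lift (hx k) g
  have hgd : det₂ ((g : Mat) *ᵥ v k) (v' k) = 0 := by
    have := hd k
    rw [Matrix.smul_mulVec] at this
    refine (mul_eq_zero.1 (?_ : c * _ = 0)).resolve_left hc
    rw [← this]
    simp [det₂]; ring
  obtain ⟨d, hd⟩ := eq_smul_of_det₂_eq_zero (hy k).ne_zero hgd
  have hd0 : d ≠ 0 := by
    rintro rfl
    exact hu.ne_zero (by rw [hd, zero_smul])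
  have hu2 := hu.smul (inv_ne_zero hd0)
  rw [hd, smul_smul, inv_mul_cancel₀ hd0, one_smul] at hu2
  exact hu2.eq_of_A_eq (hy k) hA

/-- It suffices that the orbit relation is closed. Along an ultrafilter of equivalent pairs the
conjugating elements may diverge, but after division by their norms they lie on a compact sphere and
converge to some `m ≠ 0`. The limit still intertwines the matrices and carries the vectors of lifts
to multiples of each other, so by irreducibility it is invertible and relates the limit points. -/
instance : T2Space (M a) := by
  obtain ⟨s, hs⟩ := exists_root_sq a
  rw [t2Space_iff_of_isOpenQuotientMap (proj_isOpenQuotientMap a), isClosed_iff_ultrafilter]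
  rintro ⟨x, y⟩ 𝓕 h𝓕 hR
  have hm : ∀ q : MTilde a × MTilde a, ∃ m : Metric.sphere (0 : Fin 2 → Fin 2 → ℂ) 1,
      proj a q.1 = proj a q.2 → ∃ (g : SL2) (c : ℂ), q.2 = g • q.1 ∧
        Matrix.of m.1 = c • (g : Mat) := by
    intro q
    by_cases hq : proj a q.1 = proj a q.2
    · obtain ⟨g, hg⟩ := proj_eq_iff.1 hq.symm
      set e : Fin 2 → Fin 2 → ℂ := fun p q => (g : Mat) p q
      have he : e ≠ 0 := by
        intro h0
        have := g.det_coe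
        rw [Matrix.det_fin_two] at this
        have h1 : ∀ p q, (g : Mat) p q = 0 := fun p q => congrFun (congrFun h0 p) q
        simp [h1] at this
      refine ⟨⟨((‖e‖ : ℂ)⁻¹) • e, ?_⟩, fun _ => ⟨g, (‖e‖ : ℂ)⁻¹, hg.symm, rfl⟩⟩
      rw [mem_sphere_zero_iff_norm, norm_smul, norm_inv, Complex.norm_real, norm_norm,
        inv_mul_cancel₀ (norm_ne_zero_iff.2 he)]
    · obtain ⟨m, hm⟩ := (NormedSpace.sphere_nonempty (E := Fin 2 → Fin 2 → ℂ) (x := 0) (r := 1)).2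
        zero_le_one
      exact ⟨⟨m, hm⟩, fun h => absurd h hq⟩
  choose μ hμ using hm
  obtain ⟨m, -, hlim⟩ := isCompact_univ.ultrafilter_le_nhds (𝓕.map μ) (by simp)
  have hlim : Filter.Tendsto μ 𝓕 (𝓝 m) := hlim
  obtain ⟨v, w, hv, hw, hl⟩ := exists_lifts hs (F := id) (t := x.1) contMDiffAt_id
  obtain ⟨v', w', hv', hw', hl'⟩ := exists_lifts hs (F := id) (t := y.1) contMDiffAt_id
  have tx : Filter.Tendsto (fun q : MTilde a × MTilde a => q.1.1) 𝓕 (𝓝 x.1) :=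
    ((incl_isInducing a).continuous.tendsto x).comp
      ((continuous_fst.tendsto (x, y)).mono_left h𝓕)
  have ty : Filter.Tendsto (fun q : MTilde a × MTilde a => q.2.1) 𝓕 (𝓝 y.1) :=
    ((incl_isInducing a).continuous.tendsto y).comp
      ((continuous_snd.tendsto (x, y)).mono_left h𝓕)
  have tm : ∀ p q, Filter.Tendsto (fun z => (μ z).1 p q) 𝓕 (𝓝 (m.1 p q)) := fun p q =>
    tendsto_pi_nhds.1 (tendsto_pi_nhds.1 ((continuous_subtype_val.tendsto m).comp hlim) p) q
  have tA : ∀ {x : QuadProd a} {f : MTilde a × MTilde a → QuadProd a}, Filter.Tendsto f 𝓕 (𝓝 x) →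
      ∀ k p q, Filter.Tendsto (fun z => (f z k).A p q) 𝓕 (𝓝 ((x k).A p q)) := by
    intro x f hf k p q
    exact (contMDiffAt_A (contMDiffAt_quadProd.1 (contMDiffAt_id (x := x)) k)
      p q).continuousAt.tendsto.comp hf
  have tv : ∀ {u : QuadProd a → Fin 2 → ℂ} {x : QuadProd a} {f : MTilde a × MTilde a → QuadProd a},
      ContMDiffAt 𝓘(ℂ, Fin (n + 1) → ℂ × ℂ) 𝓘(ℂ, Fin 2 → ℂ) ∞ u x → Filter.Tendsto f 𝓕 (𝓝 x) →
      ∀ p, Filter.Tendsto (fun z => u (f z) p) 𝓕 (𝓝 (u x p)) := fun hu hf p =>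
    (contMDiffAt_comp_vec hu p).continuousAt.tendsto.comp hf
  -- Equations homogeneous in the operator survive its normalization and pass to the limit.
  have key : ∀ᶠ z in 𝓕, (∀ k, Matrix.of (μ z).1 * (z.1.1 k).A = (z.2.1 k).A * Matrix.of (μ z).1) ∧
      ∀ k, det₂ (Matrix.of (μ z).1 *ᵥ v k z.1.1) (v' k z.2.1) = 0 := by
    filter_upwards [hR, tx.eventually hl, ty.eventually hl'] with z hz h1 h2
    obtain ⟨g, c, hg, hc⟩ := hμ z hz
    have hgk : ∀ k, g • z.1.1 k = z.2.1 k := fun k =>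
      (congrFun (congrArg Subtype.val hg) k).symm
    rw [hc]
    refine ⟨fun k => ?_, fun k => ?_⟩
    · rw [← hgk k, smul_A, Matrix.mul_smul, conj_mul_coe, Matrix.smul_mul]
    · obtain ⟨u, -, hu⟩ := exists_sl_lift (h1 k) g
      have h2k := h2 k
      simp only [id] at hu h2k
      rw [hgk k] at hu
      obtain ⟨d, -, hd, -⟩ := hu.proportional h2k
      rw [hd, Matrix.smul_mulVec]
      simp [det₂]; ring
  refine proj_eq_of_intertwine (s := s) (m := Matrix.of m.1) ?_ ?_ hl.self_of_nhds
    hl'.self_of_nhds ?_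
  · intro h0
    exact ne_zero_of_mem_unit_sphere m h0
  · intro k
    have hx := tA tx k
    have hy := tA ty k
    have e : ∀ p q, ∑ r, m.1 p r * (x.1 k).A r q = ∑ r, (y.1 k).A p r * m.1 r q := by
      intro p q
      refine tendsto_nhds_unique_of_eventuallyEq
        (tendsto_finsetSum _ fun r _ => (tm p r).mul (hx r q))
        (tendsto_finsetSum _ fun r _ => (hy p r).mul (tm r q)) ?_
      filter_upwards [key] with z hz
      have := congrFun (congrFun (hz.1 k) p) q
      rwa [Matrix.mul_apply, Matrix.mul_apply] at this
    ext p q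
    rw [Matrix.mul_apply, Matrix.mul_apply]
    exact e p q
  · intro k
    have hx := tv (hv k) tx
    have hy := tv (hv' k) ty
    have hmv : ∀ p, Filter.Tendsto (fun z : MTilde a × MTilde a =>
        (μ z).1 p 0 * v k z.1.1 0 + (μ z).1 p 1 * v k z.1.1 1) 𝓕
        (𝓝 (m.1 p 0 * v k x.1 0 + m.1 p 1 * v k x.1 1)) := fun p =>
      ((tm p 0).mul (hx 0)).add ((tm p 1).mul (hx 1))
    have := ((hmv 0).mul (hy 1)).sub ((hmv 1).mul (hy 0))
    simp only [det₂, mulVec_apply_zero, mulVec_apply_one]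
    refine tendsto_nhds_unique_of_eventuallyEq this tendsto_const_nhds ?_
    filter_upwards [key] with z hz
    have := hz.2 k
    simp only [det₂, mulVec_apply_zero, mulVec_apply_one] at this
    exact this

end Topology

/-! ### Slices of `M` and `M̃` -/

section Param

variable {n : ℕ} {a : Fin (n + 1) → ℂ} {s : Fin (n + 1) → ℂ} {i j : Fin (n + 1)}

/-- Matrices with the upper left entry `1`. -/
def paramMat (t : ℂ × ℂ × ℂ) : Mat := !![1, t.2.2 * t.2.1; t.1, t.2.2]

/-- The coordinates of the accompanying basis of `ℂ²`. -/
def paramOf (vi v0 vj wj : Fin 2 → ℂ) : ℂ × ℂ × ℂ :=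
  (vi 1 / vi 0, v0 0 / v0 1, det₂ vi v0 / delta vj wj v0 * v0 1 / vi 0)

/-- The basis matters only up to scale. Dividing by `(v_i)₀` leaves three parameters: the directions
of `v_i` and `v_0`, and the relative length of the columns. They are local coordinates on `PGL(2,
ℂ)`. -/
lemma frameMat_eq {vi v0 vj wj : Fin 2 → ℂ} (hi : vi 0 ≠ 0) (h0 : v0 1 ≠ 0) :
    frameMat vi v0 vj wj = vi 0 • paramMat (paramOf vi v0 vj wj) := by
  refine mat_ext ?_ ?_ ?_ ?_ <;> simp [frameMat, paramMat, paramOf] <;> field_simp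

lemma det_paramMat_ne_zero {vi v0 vj wj : Fin 2 → ℂ} (hi : vi 0 ≠ 0) (h0 : v0 1 ≠ 0)
    (hD : det₂ vi v0 ≠ 0) (hδ : delta vj wj v0 ≠ 0) :
    (paramMat (paramOf vi v0 vj wj)).det ≠ 0 := by
  have h := frameMat_det vi v0 vj wj
  rw [frameMat_eq hi h0, Matrix.det_smul] at h
  intro h1
  rw [h1, mul_zero] at h
  exact div_ne_zero (pow_ne_zero 2 hD) hδ h.symm

/-- The points for which the accompanying basis of `ℂ²` has a matrix proportional to
`paramMat t`. -/
def paramDomain (a s : Fin (n + 1) → ℂ) (i j : Fin (n + 1)) : Set (QuadProd a) :=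
  {x | x ∈ domain a s i j ∧ ∃ v w : Fin (n + 1) → Fin 2 → ℂ,
    (∀ k, IsLift (eig s k) (v k) (w k) (x k)) ∧ v i 0 ≠ 0 ∧ v 0 1 ≠ 0}

open Classical in
/-- The coordinates of the accompanying basis of a point. -/
def param (s : Fin (n + 1) → ℂ) (i j : Fin (n + 1)) (x : QuadProd a) : ℂ × ℂ × ℂ :=
  if h : ∃ v w : Fin (n + 1) → Fin 2 → ℂ, ∀ k, IsLift (eig s k) (v k) (w k) (x k) then
    paramOf (h.choose i) (h.choose 0) (h.choose j) (h.choose_spec.choose j) else 0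

/-- The lifts of the indices `0, i, j` can be rescaled independently; invariance under this makes
the parameters functions of the point. -/
lemma paramOf_eq {x : QuadProd a} {v w v' w' : Fin (n + 1) → Fin 2 → ℂ}
    (h : ∀ k, IsLift (eig s k) (v k) (w k) (x k)) (h' : ∀ k, IsLift (eig s k) (v' k) (w' k) (x k)) :
    paramOf (v' i) (v' 0) (v' j) (w' j) = paramOf (v i) (v 0) (v j) (w j) := by
  obtain ⟨ci, hci, ei, -⟩ := (h i).proportional (h' i)
  obtain ⟨c0, hc0, e0, -⟩ := (h 0).proportional (h' 0)
  obtain ⟨cj, hcj, ej, fj⟩ := (h j).proportional (h' j)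
  have hD : det₂ (ci • v i) (c0 • v 0) = ci * c0 * det₂ (v i) (v 0) := by simp [det₂]; ring
  have hδ : delta (cj • v j) (cj⁻¹ • w j) (c0 • v 0) = c0 ^ 2 * delta (v j) (w j) (v 0) := by
    simp [delta, det₂]; field_simp
  rw [ei, e0, ej, fj]
  unfold paramOf
  rw [hD, hδ]
  refine Prod.ext ?_ (Prod.ext ?_ ?_)
  · simp only [Pi.smul_apply, smul_eq_mul]
    exact mul_div_mul_left _ _ hci
  · simp only [Pi.smul_apply, smul_eq_mul]
    exact mul_div_mul_left _ _ hc0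
  · simp only [Pi.smul_apply, smul_eq_mul]
    have e : ci * c0 * det₂ (v i) (v 0) / (c0 ^ 2 * delta (v j) (w j) (v 0)) * (c0 * v 0 1) =
        ci * (det₂ (v i) (v 0) / delta (v j) (w j) (v 0) * v 0 1) := by
      field_simp
    rw [e]
    exact mul_div_mul_left _ _ hci

lemma param_eq {x : QuadProd a} {v w : Fin (n + 1) → Fin 2 → ℂ}
    (h : ∀ k, IsLift (eig s k) (v k) (w k) (x k)) :
    param s i j x = paramOf (v i) (v 0) (v j) (w j) := by
  have hx : ∃ v w : Fin (n + 1) → Fin 2 → ℂ, ∀ k, IsLift (eig s k) (v k) (w k) (x k) := ⟨v, w, h⟩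
  rw [param, dif_pos hx]
  exact paramOf_eq h hx.choose_spec.choose_spec

lemma ne_zero_of_mem_paramDomain {x : QuadProd a} (hx : x ∈ paramDomain a s i j)
    {v w : Fin (n + 1) → Fin 2 → ℂ} (h : ∀ k, IsLift (eig s k) (v k) (w k) (x k)) :
    v i 0 ≠ 0 ∧ v 0 1 ≠ 0 := by
  obtain ⟨-, v', w', h', hi, h0⟩ := hx
  obtain ⟨ci, hci, ei, -⟩ := (h i).proportional (h' i)
  obtain ⟨c0, hc0, e0, -⟩ := (h 0).proportional (h' 0)
  rw [ei] at hi
  rw [e0] at h0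
  exact ⟨right_ne_zero_of_mul hi, right_ne_zero_of_mul h0⟩

lemma isOpen_paramDomain (hs : ∀ k, s k ^ 2 = 2 * a k) : IsOpen (paramDomain a s i j) := by
  rw [isOpen_iff_mem_nhds]
  intro x hx
  obtain ⟨v, w, hv, hw, h⟩ := exists_lifts hs (F := id) (t := x) contMDiffAt_id
  obtain ⟨hi, h0⟩ := ne_zero_of_mem_paramDomain hx h.self_of_nhds
  filter_upwards [h, (contMDiffAt_comp_vec (hv i) 0).continuousAt.eventually_ne hi,
    (contMDiffAt_comp_vec (hv 0) 1).continuousAt.eventually_ne h0,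
    (isOpen_domain hs).mem_nhds hx.1] with y hy hyi hy0 hyd
  exact ⟨hyd, fun k => v k y, fun k => w k y, hy, hyi, hy0⟩

lemma contMDiffAt_param (hs : ∀ k, s k ^ 2 = 2 * a k) {x : QuadProd a}
    (hx : x ∈ paramDomain a s i j) :
    ContMDiffAt 𝓘(ℂ, Fin (n + 1) → ℂ × ℂ) 𝓘(ℂ, ℂ × ℂ × ℂ) ∞ (param s i j) x := by
  obtain ⟨v, w, hv, hw, h⟩ := exists_lifts hs (F := id) (t := x) contMDiffAt_id
  obtain ⟨hi, h0⟩ := ne_zero_of_mem_paramDomain hx h.self_of_nhds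
  obtain ⟨hD, hδ⟩ := domain_ne_zero hx.1 h.self_of_nhds
  have vi0 := contMDiffAt_comp_vec (hv i) 0
  have v01 := contMDiffAt_comp_vec (hv 0) 1
  refine ContMDiffAt.congr_of_eventuallyEq (f := fun y =>
    paramOf (v i y) (v 0 y) (v j y) (w j y)) ?_ (h.mono fun y hy => param_eq hy)
  refine ((contMDiffAt_comp_vec (hv i) 1).div₀ vi0 hi).prodMk_space
    (((contMDiffAt_comp_vec (hv 0) 0).div₀ v01 h0).prodMk_space ?_)
  exact ((((contMDiffAt_det₂ (hv i) (hv 0)).div₀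
    (contMDiffAt_delta (hv j) (hw j) (hv 0)) hδ).mul v01).div₀ vi0 hi)

/-- In a normal form `v_i` and `v_0` lie along the first and the second axis, so both denominators
are non-zero. This provides the base points of the slices of `M̃`. -/
lemma mem_paramDomain_of_isNormal (hs : ∀ k, s k ^ 2 = 2 * a k) {x : QuadProd a}
    (hx : IsNormal s i j x) : x ∈ paramDomain a s i j := by
  have hl := fun k => exists_isLift (x k) (eig_sq hs k)
  choose v w hl using hl
  obtain ⟨w0, h0⟩ := hx.lift_zero
  obtain ⟨wi, hwi⟩ := hx.lift_i
  obtain ⟨c0, hc0, e0, -⟩ := h0.proportional (hl 0)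
  obtain ⟨ci, hci, ei, -⟩ := hwi.proportional (hl i)
  refine ⟨⟨1, by rwa [one_smul]⟩, v, w, hl, ?_, ?_⟩
  · rw [ei]; simpa using hci
  · rw [e0]; simpa using hc0

/-- An element of `SL(2, ℂ)` proportional to `paramMat t`. -/
lemma exists_paramSL (t : ℂ × ℂ × ℂ) : ∃ (g : SL2) (c : ℂ), (paramMat t).det ≠ 0 →
    c ≠ 0 ∧ paramMat t = c • (g : Mat) := by
  by_cases h : (paramMat t).det ≠ 0
  · obtain ⟨g, c, hc, e⟩ := exists_sl_smul _ h
    exact ⟨g, c, fun _ => ⟨hc, e⟩⟩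
  · exact ⟨1, 1, fun hne => absurd hne h⟩

/-- An element of `SL(2, ℂ)` proportional to `paramMat t`. -/
def paramSL (t : ℂ × ℂ × ℂ) : SL2 := (exists_paramSL t).choose

lemma paramSL_spec {t : ℂ × ℂ × ℂ} (ht : (paramMat t).det ≠ 0) :
    (exists_paramSL t).choose_spec.choose ≠ 0 ∧
      paramMat t = (exists_paramSL t).choose_spec.choose • (paramSL t : Mat) :=
  (exists_paramSL t).choose_spec.choose_spec ht

lemma det_paramMat_param (hs : ∀ k, s k ^ 2 = 2 * a k) {x : QuadProd a}
    (hx : x ∈ paramDomain a s i j) : (paramMat (param s i j x)).det ≠ 0 := by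
  have hl := fun k => exists_isLift (x k) (eig_sq hs k)
  choose v w hl using hl
  obtain ⟨hi, h0⟩ := ne_zero_of_mem_paramDomain hx hl
  obtain ⟨hD, hδ⟩ := domain_ne_zero hx.1 hl
  rw [param_eq hl]
  exact det_paramMat_ne_zero hi h0 hD hδ

/-- A point is restored from its normal form and the accompanying basis. -/
lemma paramSL_smul_normalize (hs : ∀ k, s k ^ 2 = 2 * a k) {x : QuadProd a}
    (hx : x ∈ paramDomain a s i j) : paramSL (param s i j x) • normalize s i j x = x := by
  have hl := fun k => exists_isLift (x k) (eig_sq hs k)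
  choose v w hl using hl
  obtain ⟨hi, h0⟩ := ne_zero_of_mem_paramDomain hx hl
  obtain ⟨hD, hδ⟩ := domain_ne_zero hx.1 hl
  obtain ⟨hc, e⟩ := paramSL_spec (det_paramMat_param hs hx)
  obtain ⟨g, hg, hV⟩ := isNormal_of_isLift hl hD hδ
  rw [normalize_eq hg]
  set t := param s i j x with ht
  set c := (exists_paramSL t).choose_spec.choose
  have hH : frameMat (v i) (v 0) (v j) (w j) = (v i 0 * c) • (paramSL t : Mat) := by
    rw [frameMat_eq hi h0, mul_smul, ← e, ht, param_eq hl]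
  have hc' : v i 0 * c ≠ 0 := mul_ne_zero hi hc
  set H := frameMat (v i) (v 0) (v j) (w j)
  have hdet : H.det ≠ 0 := by
    rw [hH, Matrix.det_smul, (paramSL t).det_coe]
    simpa using ⟨hi, hc⟩
  funext k
  have h1 := ((hV k).smul_of_eq hc' hH).smul hdet
  rw [← frameMat_mulVec hD hδ (v k), smul_smul, mul_inv_cancel₀ hdet, one_smul, frameMat_vecMul,
    Matrix.vecMul_vecMul, Matrix.mul_adjugate, Matrix.vecMul_smul, Matrix.vecMul_one, smul_smul,
    inv_mul_cancel₀ hdet, one_smul] at h1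
  exact h1.unique (hl k)

/-- The basis belonging to a normal form is the standard one up to scale, so that of its translate
consists of the columns of `paramMat t`, from which `t` is read off. -/
lemma param_smul_of_isNormal (hs : ∀ k, s k ^ 2 = 2 * a k) {x : QuadProd a}
    (hx : IsNormal s i j x) {t : ℂ × ℂ × ℂ} (ht : (paramMat t).det ≠ 0) :
    paramSL t • x ∈ paramDomain a s i j ∧ param s i j (paramSL t • x) = t := by
  have hl := fun k => exists_isLift (x k) (eig_sq hs k)
  choose V W hl using hl
  obtain ⟨w0, h0⟩ := hx.lift_zero
  obtain ⟨wi, hwi⟩ := hx.lift_i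
  obtain ⟨c0, hc0, e0, -⟩ := h0.proportional (hl 0)
  obtain ⟨ci, hci, ei, -⟩ := hwi.proportional (hl i)
  obtain ⟨hc, e⟩ := paramSL_spec ht
  obtain ⟨α, β, γ⟩ := t
  have hlift := fun k => (hl k).smul_of_eq hc e
  have hdet : (paramMat (α, β, γ)).det = γ * (1 - α * β) := by
    rw [paramMat, Matrix.det_fin_two_of]; ring
  have hγ : γ ≠ 0 := by
    intro h; apply ht; rw [hdet, h, zero_mul]
  set d := (paramMat (α, β, γ)).det with hd
  have hVi : d⁻¹ • (paramMat (α, β, γ) *ᵥ V i) = ![d⁻¹ * ci, d⁻¹ * ci * α] := by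
    rw [ei]
    ext p; fin_cases p
    · simp [paramMat]
    · simp [paramMat]; ring
  have hV0 : d⁻¹ • (paramMat (α, β, γ) *ᵥ V 0) = ![d⁻¹ * c0 * γ * β, d⁻¹ * c0 * γ] := by
    rw [e0]
    ext p; fin_cases p
    · simp [paramMat]; ring
    · simp [paramMat]; ring
  have hAj : V j 0 * W j 1 = 1 := by
    have := hx.A_j
    rw [(hl j).A_eq] at this
    simpa [Matrix.vecMulVec_apply] using this
  have hdi := inv_ne_zero ht
  have hδ : delta (d⁻¹ • (paramMat (α, β, γ) *ᵥ V j)) (W j ᵥ* (paramMat (α, β, γ)).adjugate)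
      ![d⁻¹ * c0 * γ * β, d⁻¹ * c0 * γ] = d⁻¹ * c0 ^ 2 := by
    have e1 : det₂ (d⁻¹ • (paramMat (α, β, γ) *ᵥ V j)) ![d⁻¹ * c0 * γ * β, d⁻¹ * c0 * γ] =
        d⁻¹ * c0 * V j 0 := by
      -- The product `d⁻¹ * d` is kept so that the identity is polynomial in `d⁻¹` and the
      -- parameters; cancellation comes afterwards.
      have : det₂ (d⁻¹ • (paramMat (α, β, γ) *ᵥ V j)) ![d⁻¹ * c0 * γ * β, d⁻¹ * c0 * γ] =
          d⁻¹ * (d⁻¹ * d) * c0 * V j 0 := by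
        rw [hdet]
        simp [det₂, paramMat, Matrix.vecHead]; ring
      rw [this, inv_mul_cancel₀ ht, mul_one]
    have e2 : (W j ᵥ* (paramMat (α, β, γ)).adjugate) 0 * (d⁻¹ * c0 * γ * β) +
        (W j ᵥ* (paramMat (α, β, γ)).adjugate) 1 * (d⁻¹ * c0 * γ) = c0 * W j 1 := by
      have : (W j ᵥ* (paramMat (α, β, γ)).adjugate) 0 * (d⁻¹ * c0 * γ * β) +
        (W j ᵥ* (paramMat (α, β, γ)).adjugate) 1 * (d⁻¹ * c0 * γ) = (d⁻¹ * d) * c0 * W j 1 := by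
        rw [hdet]
        simp [vecMul_apply, Matrix.adjugate_fin_two, paramMat]; ring
      rw [this, inv_mul_cancel₀ ht, one_mul]
    unfold delta
    rw [e1]
    simp only [Matrix.cons_val_zero, Matrix.cons_val_one]
    rw [e2]
    linear_combination d⁻¹ * c0 ^ 2 * hAj
  have hD : det₂ ![d⁻¹ * ci, d⁻¹ * ci * α] ![d⁻¹ * c0 * γ * β, d⁻¹ * c0 * γ] = d⁻¹ * ci * c0 := by
    have : det₂ ![d⁻¹ * ci, d⁻¹ * ci * α] ![d⁻¹ * c0 * γ * β, d⁻¹ * c0 * γ] =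
        d⁻¹ * (d⁻¹ * d) * ci * c0 := by
      rw [hdet]
      simp [det₂]; ring
    rw [this, inv_mul_cancel₀ ht, mul_one]
  refine ⟨⟨smul_mem_domain ⟨1, by rwa [one_smul]⟩ _, _, _, hlift, ?_, ?_⟩, ?_⟩
  · rw [hVi]
    simpa using ⟨ht, hci⟩
  · rw [hV0]
    simpa using ⟨⟨ht, hc0⟩, hγ⟩
  · rw [param_eq (x := paramSL (α, β, γ) • x) hlift, hVi, hV0]
    unfold paramOf
    rw [hδ, hD]
    simp only [Matrix.cons_val_zero, Matrix.cons_val_one]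
    refine Prod.ext ?_ (Prod.ext ?_ ?_)
    · exact mul_div_cancel_left₀ _ (mul_ne_zero hdi hci)
    · exact mul_div_cancel_left₀ _ (mul_ne_zero (mul_ne_zero hdi hc0) hγ)
    · simp only
      field_simp

end Param

/-! ### The slices built from normal forms -/

section Slices

variable {n : ℕ} {a : Fin (n + 1) → ℂ} {s : Fin (n + 1) → ℂ} {i j : Fin (n + 1)}

lemma card_rest (hi : i ≠ 0) (hj : j ≠ 0) (hij : i ≠ j) : Fintype.card (Rest i j) + 2 = n := by
  have := sum_eq_add_sum_rest hi hj hij (fun _ => 1)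
  simp only [Finset.sum_const, Finset.card_univ, Fintype.card_fin, smul_eq_mul, mul_one] at this
  omega

/-- The coordinates on the model space of `M`. -/
def modelEquiv (hi : i ≠ 0) (hj : j ≠ 0) (hij : i ≠ j) :
    (Rest i j → ℂ × ℂ) ≃L[ℂ] (Fin (2 * (n - 2)) → ℂ) :=
  ContinuousLinearEquiv.ofFinrankEq <| by
    have := card_rest hi hj hij
    rw [Module.finrank_pi_fintype]
    simp only [Module.finrank_prod, Module.finrank_self, Finset.sum_const, Finset.card_univ,
      Module.finrank_fin_fun, smul_eq_mul]
    omega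

/-- The coordinates on the model space of `M̃`. -/
def modelEquivTilde (hi : i ≠ 0) (hj : j ≠ 0) (hij : i ≠ j) :
    ((Rest i j → ℂ × ℂ) × (ℂ × ℂ × ℂ)) ≃L[ℂ] (Fin (2 * n - 1) → ℂ) :=
  ContinuousLinearEquiv.ofFinrankEq <| by
    have := card_rest hi hj hij
    rw [Module.finrank_prod, Module.finrank_pi_fintype]
    simp only [Module.finrank_prod, Module.finrank_self, Finset.sum_const, Finset.card_univ,
      Module.finrank_fin_fun, smul_eq_mul]
    omega

variable (hs : ∀ k, s k ^ 2 = 2 * a k) (hi : i ≠ 0) (hj : j ≠ 0) (hij : i ≠ j)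

/-- The image of the coordinate map. -/
def image (a s : Fin (n + 1) → ℂ) (i j : Fin (n + 1)) : Set (QuadProd (rest a i j)) :=
  {y | ¬Triangular (restore a s i j y)}

include hs hi hj hij in
lemma mem_image_iff {y : QuadProd (rest a i j)} :
    y ∈ image a s i j ↔ ¬Triangular fun k => (sectionMap hs y k).A := by
  simp only [sectionMap_A hs hi hj hij]
  rfl

include hs hi hj hij in
lemma isOpen_image : IsOpen (image a s i j) := by
  have : image a s i j = {y | ¬Triangular fun k => (sectionMap hs y k).A} :=
    Set.ext fun y => mem_image_iff hs hi hj hij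
  rw [this]
  refine isOpen_not_triangular fun k p q => ?_
  refine continuous_iff_continuousAt.2 fun y => ?_
  exact (contMDiffAt_A (contMDiffAt_quadProd.1
    (contMDiffAt_sectionMap hs (contMDiffAt_id (x := y))) k) p q).continuousAt

open Classical in
/-- The point of `M̃` in the normal form with the given coordinates (`x` if there is none). -/
def sectionPt (x : MTilde a) (y : QuadProd (rest a i j)) : MTilde a :=
  if h : y ∈ image a s i j then
    ⟨sectionMap hs y, (mem_image_iff hs hi hj hij).1 h, sum_sectionMap hs hi hj hij y⟩ else x

lemma sectionPt_val (x : MTilde a) {y : QuadProd (rest a i j)} (hy : y ∈ image a s i j) :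
    (sectionPt hs hi hj hij x y).1 = sectionMap hs y :=
  congrArg Subtype.val (dif_pos hy)

lemma isNormal_sectionPt (x : MTilde a) {y : QuadProd (rest a i j)} (hy : y ∈ image a s i j) :
    IsNormal s i j (sectionPt hs hi hj hij x y).1 := by
  rw [sectionPt_val hs hi hj hij x hy]
  exact isNormal_sectionMap hs hi hj hij y

/-- The coordinates of the normal form. -/
def coords (s : Fin (n + 1) → ℂ) (i j : Fin (n + 1)) (x : QuadProd a) : QuadProd (rest a i j) :=
  restrict i j (normalize s i j x)

lemma coords_sectionPt (x : MTilde a) {y : QuadProd (rest a i j)} (hy : y ∈ image a s i j) :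
    coords s i j (sectionPt hs hi hj hij x y).1 = y := by
  rw [coords, normalize_of_isNormal (isNormal_sectionPt hs hi hj hij x hy),
    sectionPt_val hs hi hj hij x hy, restrict_sectionMap]

lemma coords_smul {x : QuadProd a} (hx : x ∈ domain a s i j) (g : SL2) :
    coords s i j (g • x) = coords s i j x := by
  rw [coords, normalize_smul hx, coords]

/-- Zero sum lets `IsNormal.eq_sectionMap` restore the normal form `g • x` from its coordinates, so
the section returns a point of the orbit of `x`, not `x` itself. -/
lemma sectionPt_coords (x₀ x : MTilde a) {g : SL2} (hg : IsNormal s i j (g • x.1)) :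
    coords s i j x.1 ∈ image a s i j ∧ sectionPt hs hi hj hij x₀ (coords s i j x.1) = g • x := by
  have e : sectionMap hs (coords s i j x.1) = (g • x).1 := by
    rw [coords, normalize_eq hg]
    exact (hg.eq_sectionMap hs hi hj hij (g • x).2.2).symm
  have h : coords s i j x.1 ∈ image a s i j := by
    rw [mem_image_iff hs hi hj hij, e]
    exact (g • x).2.1
  exact ⟨h, Subtype.ext ((sectionPt_val hs hi hj hij x₀ h).trans e)⟩

include hs in
lemma contMDiffAt_coords {x : QuadProd a} (hx : x ∈ domain a s i j) :
    ContMDiffAt 𝓘(ℂ, Fin (n + 1) → ℂ × ℂ) 𝓘(ℂ, Rest i j → ℂ × ℂ) ∞ (coords s i j) x :=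
  contMDiffAt_restrict (contMDiffAt_normalize hs (F := id) contMDiffAt_id hx)

lemma contMDiffOn_sectionPt (x : MTilde a) :
    ContMDiffOn 𝓘(ℂ, Rest i j → ℂ × ℂ) 𝓘(ℂ, Fin (n + 1) → ℂ × ℂ) ∞
      (MTilde.incl a ∘ sectionPt hs hi hj hij x) (image a s i j) := by
  intro y hy
  refine ((contMDiffAt_sectionMap hs (contMDiffAt_id (x := y))).congr_of_eventuallyEq
    ?_).contMDiffWithinAt
  filter_upwards [(isOpen_image hs hi hj hij).mem_nhds hy] with u hu
  exact sectionPt_val hs hi hj hij x hu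

include hs in
lemma isOpen_domain_inter_coords {O : Set (QuadProd (rest a i j))} (hO : IsOpen O) :
    IsOpen (domain a s i j ∩ coords s i j ⁻¹' O) :=
  ContinuousOn.isOpen_inter_preimage
    (fun _ hx => (contMDiffAt_coords hs hx).continuousAt.continuousWithinAt) (isOpen_domain hs) hO

/-- The chart of the product of quadrics at the coordinates of a point. -/
abbrev coordChart (s : Fin (n + 1) → ℂ) (i j : Fin (n + 1)) (x : MTilde a) :
    OpenPartialHomeomorph (QuadProd (rest a i j)) (Rest i j → ℂ × ℂ) :=
  chartAt (Rest i j → ℂ × ℂ) (coords s i j x.1)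

lemma contMDiff_coordChart_symm (x : MTilde a) :
    ContMDiff 𝓘(ℂ, Rest i j → ℂ × ℂ) 𝓘(ℂ, Rest i j → ℂ × ℂ) ∞ (coordChart s i j x).symm :=
  contMDiff_atlas_symm (chart_mem_atlas _ _)

/-- The slice of `M` at the orbit of a point. -/
def slice {z₀ : M a} (x : MTilde a) (hx : x.1 ∈ domain a s i j) (hz₀ : proj a x = z₀) :
    Slice (Fin (2 * (n - 2)) → ℂ) (Fin (n + 1) → ℂ × ℂ) (MTilde.incl a) (proj a) z₀ where
  f z := sectionPt hs hi hj hij x ((coordChart s i j x).symm ((modelEquiv hi hj hij).symm z))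
  g y := modelEquiv hi hj hij (coordChart s i j x (coords s i j y))
  V := (modelEquiv hi hj hij).symm ⁻¹' ((coordChart s i j x).target ∩
    (coordChart s i j x).symm ⁻¹' image a s i j)
  O := domain a s i j ∩ coords s i j ⁻¹' (coordChart s i j x).source
  isOpen_V := ((coordChart s i j x).open_target.inter ((isOpen_image hs hi hj hij).preimage
    (contMDiff_coordChart_symm x).continuous)).preimage (modelEquiv hi hj hij).symm.continuous
  isOpen_O := isOpen_domain_inter_coords hs (coordChart s i j x).open_source
  smooth_f := (contMDiffOn_sectionPt hs hi hj hij x).comp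
    (((contMDiff_coordChart_symm x).comp
      (modelEquiv hi hj hij).symm.contDiff.contMDiff).contMDiffOn) fun z hz => hz.2
  smooth_g := by
    refine (modelEquiv hi hj hij).contDiff.contMDiff.comp_contMDiffOn ?_
    refine (contMDiffOn_of_mem_maximalAtlas (IsManifold.chart_mem_maximalAtlas _)).comp
      (fun y hy => (contMDiffAt_coords hs hy.1).contMDiffWithinAt) fun y hy => hy.2
  mem_O z hz := by
    refine ⟨⟨1, ?_⟩, ?_⟩
    · rw [one_smul]
      exact isNormal_sectionPt hs hi hj hij x hz.2
    · refine (congrArg (· ∈ (coordChart s i j x).source)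
        (coords_sectionPt hs hi hj hij x hz.2)).mpr ?_
      exact (coordChart s i j x).map_target hz.1
  g_f z hz := by
    rw [MTilde.incl, coords_sectionPt hs hi hj hij x hz.2, (coordChart s i j x).right_inv hz.1,
      ContinuousLinearEquiv.apply_symm_apply]
  mem_V y hy := by
    obtain ⟨⟨g, hg⟩, hy⟩ := hy
    rw [Set.mem_preimage, ContinuousLinearEquiv.symm_apply_apply]
    refine ⟨(coordChart s i j x).map_source hy, ?_⟩
    rw [Set.mem_preimage, (coordChart s i j x).left_inv hy]
    exact (sectionPt_coords hs hi hj hij x y hg).1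
  f_g y hy := by
    obtain ⟨⟨g, hg⟩, hy⟩ := hy
    rw [ContinuousLinearEquiv.symm_apply_apply, (coordChart s i j x).left_inv hy]
    refine (congrArg (proj a) (sectionPt_coords hs hi hj hij x y hg).2).trans (proj_smul g y)
  saturated y y' h hy := by
    obtain ⟨g, rfl⟩ := proj_eq_iff.1 h.symm
    exact ⟨smul_mem_domain hy.1 g, by
      rw [Set.mem_preimage]
      exact (congrArg (· ∈ (coordChart s i j x).source) (coords_smul hy.1 g)).mpr hy.2⟩
  invariant y y' h hy := by
    obtain ⟨g, rfl⟩ := proj_eq_iff.1 h.symm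
    exact congrArg (fun u => modelEquiv hi hj hij (coordChart s i j x u)) (coords_smul hy.1 g).symm
  base := ⟨x, hz₀, hx,
    mem_chart_source (Rest i j → ℂ × ℂ) (coords s i j x.1)⟩

/-- The slice of `M̃` (as a quotient of itself) at a point; `g₀` carries the point to its normal
form. -/
def sliceTilde (x : MTilde a) (g₀ : SL2) (hx : IsNormal s i j (g₀ • x.1)) :
    Slice (Fin (2 * n - 1) → ℂ) (Fin (n + 1) → ℂ × ℂ) (MTilde.incl a) (id : MTilde a → MTilde a)
      x where
  f z := g₀⁻¹ • paramSL ((modelEquivTilde hi hj hij).symm z).2 •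
    sectionPt hs hi hj hij x ((coordChart s i j x).symm ((modelEquivTilde hi hj hij).symm z).1)
  -- The coordinates are those of the orbit together with the parameters of the basis. Translation
  -- by `g₀` brings the base point to its normal form, where the parameters are defined.
  g y := modelEquivTilde hi hj hij
    (coordChart s i j x (coords s i j y), param s i j (g₀ • y))
  V := (modelEquivTilde hi hj hij).symm ⁻¹' (((coordChart s i j x).target ∩
    (coordChart s i j x).symm ⁻¹' image a s i j) ×ˢ {t | (paramMat t).det ≠ 0})
  O := (domain a s i j ∩ coords s i j ⁻¹' (coordChart s i j x).source) ∩
    (fun y => g₀ • y) ⁻¹' paramDomain a s i j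
  isOpen_V := by
    refine IsOpen.preimage (modelEquivTilde hi hj hij).symm.continuous (IsOpen.prod
      ((coordChart s i j x).open_target.inter ((isOpen_image hs hi hj hij).preimage
      (contMDiff_coordChart_symm x).continuous)) ?_)
    refine isOpen_ne_fun ?_ continuous_const
    simp only [paramMat, Matrix.det_fin_two_of]
    fun_prop
  isOpen_O := (isOpen_domain_inter_coords hs (coordChart s i j x).open_source).inter
    ((isOpen_paramDomain hs).preimage (continuous_const_smul g₀))
  smooth_f := by
    intro z hz
    obtain ⟨hz1, hz2⟩ := hz
    have hL1 : ContMDiff 𝓘(ℂ, Fin (2 * n - 1) → ℂ) 𝓘(ℂ, Rest i j → ℂ × ℂ) ∞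
        (fun z => ((modelEquivTilde hi hj hij).symm z).1) :=
      ((modelEquivTilde hi hj hij).symm.contDiff.fst).contMDiff
    have hopen : IsOpen {t | (paramMat t).det ≠ 0} := by
      refine isOpen_ne_fun ?_ continuous_const
      simp only [paramMat, Matrix.det_fin_two_of]
      fun_prop
    refine ContMDiffAt.contMDiffWithinAt ?_
    let F : (Fin (2 * n - 1) → ℂ) → QuadProd a := (MTilde.incl a ∘ sectionPt hs hi hj hij x) ∘
      fun z => (coordChart s i j x).symm ((modelEquivTilde hi hj hij).symm z).1
    refine (contMDiff_const_smul g₀⁻¹).contMDiffAt.comp z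
      (f := fun z => paramSL ((modelEquivTilde hi hj hij).symm z).2 • F z) ?_
    refine contMDiffAt_smul (c := fun z =>
      (exists_paramSL ((modelEquivTilde hi hj hij).symm z).2).choose_spec.choose)
      (H := fun z => paramMat ((modelEquivTilde hi hj hij).symm z).2) ?_ ?_ ?_
    · exact ((contMDiffOn_sectionPt hs hi hj hij x).contMDiffAt
        ((isOpen_image hs hi hj hij).mem_nhds hz1.2)).comp z
        (f := fun z => (coordChart s i j x).symm ((modelEquivTilde hi hj hij).symm z).1)
        ((contMDiff_coordChart_symm x).contMDiffAt.comp z hL1.contMDiffAt)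
    · intro p q
      have h2 := (modelEquivTilde hi hj hij).symm.contDiff (n := ∞)
      refine ContDiffAt.contMDiffAt (ContDiff.contDiffAt ?_)
      fin_cases p <;> fin_cases q <;> simp [paramMat] <;> fun_prop
    · have : (fun z => ((modelEquivTilde hi hj hij).symm z).2) ⁻¹' {t | (paramMat t).det ≠ 0} ∈ 𝓝 z :=
        (hopen.preimage (continuous_snd.comp (modelEquivTilde hi hj hij).symm.continuous)).mem_nhds
          hz2
      filter_upwards [this] with u hu
      exact paramSL_spec hu
  smooth_g := by
    refine (modelEquivTilde hi hj hij).contDiff.contMDiff.comp_contMDiffOn ?_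
    refine ContMDiffOn.prodMk_space ?_ ?_
    · refine (contMDiffOn_of_mem_maximalAtlas (IsManifold.chart_mem_maximalAtlas _)).comp
        (fun y hy => (contMDiffAt_coords hs hy.1.1).contMDiffWithinAt) fun y hy => hy.1.2
    · intro y hy
      exact ((contMDiffAt_param hs hy.2).comp y
        (contMDiff_const_smul g₀).contMDiffAt).contMDiffWithinAt
  mem_O z hz := by
    obtain ⟨hz1, hz2⟩ := hz
    have hN := isNormal_sectionPt hs hi hj hij x hz1.2
    have hd : (sectionPt hs hi hj hij x ((coordChart s i j x).symm
        ((modelEquivTilde hi hj hij).symm z).1)).1 ∈ domain a s i j := ⟨1, by rwa [one_smul]⟩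
    refine ⟨⟨smul_mem_domain (smul_mem_domain hd _) _, ?_⟩, ?_⟩
    · refine (congrArg (· ∈ (coordChart s i j x).source)
        ((coords_smul (smul_mem_domain hd _) _).trans ((coords_smul hd _).trans
        (coords_sectionPt hs hi hj hij x hz1.2)))).mpr ?_
      exact (coordChart s i j x).map_target hz1.1
    · rw [Set.mem_preimage, MTilde.incl, MTilde.val_smul, smul_inv_smul]
      exact (param_smul_of_isNormal hs hN hz2).1
  g_f z hz := by
    obtain ⟨hz1, hz2⟩ := hz
    have hN := isNormal_sectionPt hs hi hj hij x hz1.2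
    have hd : (sectionPt hs hi hj hij x ((coordChart s i j x).symm
        ((modelEquivTilde hi hj hij).symm z).1)).1 ∈ domain a s i j := ⟨1, by rwa [one_smul]⟩
    rw [MTilde.incl, MTilde.val_smul, smul_inv_smul, MTilde.val_smul,
      (param_smul_of_isNormal hs hN hz2).2, coords_smul (smul_mem_domain hd _), coords_smul hd,
      coords_sectionPt hs hi hj hij x hz1.2, (coordChart s i j x).right_inv hz1.1]
    exact ContinuousLinearEquiv.apply_symm_apply _ z
  mem_V y hy := by
    obtain ⟨⟨⟨g, hg⟩, hy⟩, hp⟩ := hy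
    rw [Set.mem_preimage, ContinuousLinearEquiv.symm_apply_apply]
    refine ⟨⟨(coordChart s i j x).map_source hy, ?_⟩, det_paramMat_param hs hp⟩
    rw [Set.mem_preimage, (coordChart s i j x).left_inv hy]
    exact (sectionPt_coords hs hi hj hij x y hg).1
  f_g y hy := by
    obtain ⟨⟨⟨g, hg⟩, hy⟩, hp⟩ := hy
    rw [ContinuousLinearEquiv.symm_apply_apply, (coordChart s i j x).left_inv hy]
    change g₀⁻¹ • paramSL (param s i j (g₀ • y.1)) •
      sectionPt hs hi hj hij x (coords s i j y.1) = y
    rw [(sectionPt_coords hs hi hj hij x y hg).2, inv_smul_eq_iff]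
    refine Subtype.ext ?_
    have e : normalize s i j (g₀ • y.1) = g • y.1 :=
      (normalize_smul ⟨g, hg⟩ g₀).trans (normalize_eq hg)
    exact (congrArg (paramSL (param s i j (g₀ • y.1)) • ·) e.symm).trans
      (paramSL_smul_normalize hs hp)
  saturated y y' h hy := by
    rw [id, id] at h
    rwa [← h]
  invariant y y' h hy := by
    rw [id, id] at h
    rw [h]
  base := ⟨x, rfl, ⟨⟨g₀, hx⟩, mem_chart_source (Rest i j → ℂ × ℂ) (coords s i j x.1)⟩,
    mem_paramDomain_of_isNormal hs hx⟩

end Slices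

/-! ### The complex manifolds `M̃` and `M` -/

section Manifolds

variable {n : ℕ} {a : Fin (n + 1) → ℂ}

lemma exists_isNormal {s : Fin (n + 1) → ℂ} (hs : ∀ k, s k ^ 2 = 2 * a k) (x : MTilde a) :
    ∃ i j : Fin (n + 1), i ≠ 0 ∧ j ≠ 0 ∧ i ≠ j ∧ ∃ g : SL2, IsNormal s i j (g • x.1) :=
  exists_mem_domain hs x.2.1 x.2.2

/-- The square roots of `2 a k` used in the construction of the manifold structures. -/
def baseRoot (a : Fin (n + 1) → ℂ) (k : Fin (n + 1)) : ℂ := 2 * root (a k)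

lemma baseRoot_sq (k : Fin (n + 1)) : baseRoot a k ^ 2 = 2 * a k := by
  rw [baseRoot]; linear_combination 2 * root_sq' (a k)

/-- The record of how the slice was built is kept, since the form in the resulting chart is computed
from it in `form_inChart`. -/
lemma exists_slice (z : M a) : ∃ c : Slice (Fin (2 * (n - 2)) → ℂ) (Fin (n + 1) → ℂ × ℂ)
    (MTilde.incl a) (proj a) z, ∃ (i j : Fin (n + 1)) (hi : i ≠ 0) (hj : j ≠ 0) (hij : i ≠ j)
      (x : MTilde a) (hx : x.1 ∈ domain a (baseRoot a) i j) (hz : proj a x = z),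
      c = slice baseRoot_sq hi hj hij x hx hz := by
  obtain ⟨x, hz⟩ := (proj_isOpenQuotientMap a).surjective z
  obtain ⟨i, j, hi, hj, hij, hx⟩ := exists_isNormal baseRoot_sq x
  exact ⟨slice baseRoot_sq hi hj hij x hx hz, i, j, hi, hj, hij, x, hx, hz, rfl⟩

/-- A slice of `M` at a point. -/
def sliceAt (z : M a) : Slice (Fin (2 * (n - 2)) → ℂ) (Fin (n + 1) → ℂ × ℂ) (MTilde.incl a)
    (proj a) z := (exists_slice z).choose

lemma nonempty_sliceTilde (x : MTilde a) : Nonempty (Slice (Fin (2 * n - 1) → ℂ)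
    (Fin (n + 1) → ℂ × ℂ) (MTilde.incl a) (id : MTilde a → MTilde a) x) := by
  obtain ⟨i, j, hi, hj, hij, g, hg⟩ := exists_isNormal baseRoot_sq x
  exact ⟨sliceTilde baseRoot_sq hi hj hij x g hg⟩

/-- A slice of `M̃` at a point. -/
def sliceTildeAt (x : MTilde a) : Slice (Fin (2 * n - 1) → ℂ) (Fin (n + 1) → ℂ × ℂ)
    (MTilde.incl a) (id : MTilde a → MTilde a) x := (nonempty_sliceTilde x).some

instance : ChartedSpace (Fin (2 * (n - 2)) → ℂ) (M a) :=
  Slice.chartedSpace (incl_isInducing a) (proj_isOpenQuotientMap a) sliceAt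

instance : ChartedSpace (Fin (2 * n - 1) → ℂ) (MTilde a) :=
  Slice.chartedSpace (incl_isInducing a) .id sliceTildeAt

instance : IsManifold 𝓘(ℂ, Fin (2 * (n - 2)) → ℂ) ∞ (M a) :=
  Slice.isManifold (incl_isInducing a) (proj_isOpenQuotientMap a) sliceAt

instance : IsManifold 𝓘(ℂ, Fin (2 * n - 1) → ℂ) ∞ (MTilde a) :=
  Slice.isManifold (incl_isInducing a) .id sliceTildeAt

lemma contMDiff_incl (a : Fin (n + 1) → ℂ) :
    ContMDiff 𝓘(ℂ, Fin (2 * n - 1) → ℂ) 𝓘(ℂ, Fin (n + 1) → ℂ × ℂ) ∞ (MTilde.incl a) := fun _ =>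
  Slice.contMDiffAt_source (incl_isInducing a) .id sliceTildeAt isOpen_univ
    (F' := id) contMDiffOn_id (fun _ _ => rfl) fun _ _ => Set.mem_univ _

lemma contMDiffAt_MTilde {ET T : Type} [NormedAddCommGroup ET] [NormedSpace ℂ ET]
    [TopologicalSpace T] [ChartedSpace ET T] {G : T → MTilde a} {t : T}
    (hG : ContMDiffAt 𝓘(ℂ, ET) 𝓘(ℂ, Fin (n + 1) → ℂ × ℂ) ∞ (MTilde.incl a ∘ G) t) :
    ContMDiffAt 𝓘(ℂ, ET) 𝓘(ℂ, Fin (2 * n - 1) → ℂ) ∞ G t :=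
  Slice.contMDiffAt_target (incl_isInducing a) .id sliceTildeAt hG (.of_forall fun _ => rfl)

lemma contMDiff_proj (a : Fin (n + 1) → ℂ) :
    ContMDiff 𝓘(ℂ, Fin (2 * n - 1) → ℂ) 𝓘(ℂ, Fin (2 * (n - 2)) → ℂ) ∞ (proj a) := fun x =>
  Slice.contMDiffAt_target (incl_isInducing a) (proj_isOpenQuotientMap a) sliceAt (G' := id)
    (contMDiff_incl a x) (.of_forall fun _ => rfl)

lemma inf_ne_zero : (∞ : WithTop ℕ∞) ≠ 0 := by simp

/-- The derivative of a map with a local left inverse is injective. -/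
lemma mfderiv_injective_of_leftInverse {E E' X Y : Type} [NormedAddCommGroup E] [NormedSpace ℂ E]
    [NormedAddCommGroup E'] [NormedSpace ℂ E'] [TopologicalSpace X] [ChartedSpace E X]
    [TopologicalSpace Y] [ChartedSpace E' Y] {f : X → Y} {g : Y → X} {x : X}
    (hf : MDifferentiableAt 𝓘(ℂ, E) 𝓘(ℂ, E') f x) (hg : MDifferentiableAt 𝓘(ℂ, E') 𝓘(ℂ, E) g (f x))
    (h : ∀ᶠ y in 𝓝 x, g (f y) = y) (u v : TangentSpace 𝓘(ℂ, E) x)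
    (huv : mfderiv 𝓘(ℂ, E) 𝓘(ℂ, E') f x u = mfderiv 𝓘(ℂ, E) 𝓘(ℂ, E') f x v) : u = v := by
  have key : (mfderiv 𝓘(ℂ, E') 𝓘(ℂ, E) g (f x)).comp (mfderiv 𝓘(ℂ, E) 𝓘(ℂ, E') f x) =
      ContinuousLinearMap.id ℂ E := by
    rw [← mfderiv_comp x hg hf]
    exact (Filter.EventuallyEq.mfderiv_eq h).trans mfderiv_id
  have hu := DFunLike.congr_fun key u
  have hv := DFunLike.congr_fun key v
  simp only [ContinuousLinearMap.comp_apply] at hu hv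
  rw [huv] at hu
  exact hu.symm.trans hv

/-- The derivative of a map with a local right inverse is surjective. -/
lemma mfderiv_surjective_of_rightInverse {E E' X Y : Type} [NormedAddCommGroup E] [NormedSpace ℂ E]
    [NormedAddCommGroup E'] [NormedSpace ℂ E'] [TopologicalSpace X] [ChartedSpace E X]
    [TopologicalSpace Y] [ChartedSpace E' Y] {f : X → Y} {g : Y → X} {x : X}
    (hf : MDifferentiableAt 𝓘(ℂ, E) 𝓘(ℂ, E') f x)
    (hg : MDifferentiableAt 𝓘(ℂ, E') 𝓘(ℂ, E) g (f x)) (hx : g (f x) = x)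
    (h : ∀ᶠ y in 𝓝 (f x), f (g y) = y) :
    Function.Surjective (mfderiv 𝓘(ℂ, E) 𝓘(ℂ, E') f x) := by
  have hf' : MDifferentiableAt 𝓘(ℂ, E) 𝓘(ℂ, E') f (g (f x)) := by rwa [hx]
  have key : (mfderiv 𝓘(ℂ, E) 𝓘(ℂ, E') f (g (f x))).comp (mfderiv 𝓘(ℂ, E') 𝓘(ℂ, E) g (f x)) =
      ContinuousLinearMap.id ℂ E' := by
    rw [← mfderiv_comp (f x) hf' hg]
    exact (Filter.EventuallyEq.mfderiv_eq h).trans mfderiv_id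
  have hs : Function.Surjective (mfderiv 𝓘(ℂ, E) 𝓘(ℂ, E') f (g (f x))) := fun u =>
    ⟨_, DFunLike.congr_fun key u⟩
  rw [hx] at hs
  exact hs

/-- The map `f ∘ g` of a slice is holomorphic on an open set of the product and restricts to the
identity on the points of `M̃` there, so it is a local left inverse of the inclusion. -/
lemma mfderiv_incl_injective (x : MTilde a) : Function.Injective
    (mfderiv 𝓘(ℂ, Fin (2 * n - 1) → ℂ) 𝓘(ℂ, Fin (n + 1) → ℂ × ℂ) (MTilde.incl a) x) := by
  obtain ⟨t, ht, hO⟩ := (sliceTildeAt x).base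
  obtain rfl : t = x := ht
  have hV := (sliceTildeAt t).mem_V t hO
  have hg := ((sliceTildeAt t).smooth_g.contMDiffAt ((sliceTildeAt t).isOpen_O.mem_nhds hO))
  have hf : ContMDiffAt 𝓘(ℂ, Fin (2 * n - 1) → ℂ) 𝓘(ℂ, Fin (2 * n - 1) → ℂ) ∞ (sliceTildeAt t).f
      ((sliceTildeAt t).g (MTilde.incl a t)) :=
    contMDiffAt_MTilde ((sliceTildeAt t).smooth_f.contMDiffAt
      ((sliceTildeAt t).isOpen_V.mem_nhds hV))
  refine fun u v => mfderiv_injective_of_leftInverse (g := (sliceTildeAt t).f ∘ (sliceTildeAt t).g)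
    ((contMDiff_incl a t).mdifferentiableAt inf_ne_zero)
    ((hf.comp _ hg).mdifferentiableAt inf_ne_zero) ?_ u v
  filter_upwards [((sliceTildeAt t).isOpen_O.preimage (incl_isInducing a).continuous).mem_nhds hO]
    with y hy
  exact (sliceTildeAt t).f_g y hy

/-! ### The coordinate maps -/

variable {s : Fin (n + 1) → ℂ} {i j : Fin (n + 1)}

/-- The coordinate map `π_{0ij}`. -/
def coordMap (s : Fin (n + 1) → ℂ) (i j : Fin (n + 1)) (z : M a) : QuadProd (rest a i j) :=
  coords s i j (Function.surjInv (proj_isOpenQuotientMap a).surjective z).1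

lemma coordMap_proj {x : MTilde a} (hx : x.1 ∈ domain a s i j) :
    coordMap s i j (proj a x) = coords s i j x.1 := by
  obtain ⟨g, hg⟩ := proj_eq_iff.1
    (Function.surjInv_eq (proj_isOpenQuotientMap a).surjective (proj a x))
  rw [coordMap, ← hg]
  exact coords_smul hx g

variable (hs : ∀ k, s k ^ 2 = 2 * a k) (hi : i ≠ 0) (hj : j ≠ 0) (hij : i ≠ j)

include hs in
lemma contMDiffAt_coordMap {x : MTilde a} (hx : x.1 ∈ domain a s i j) :
    ContMDiffAt 𝓘(ℂ, Fin (2 * (n - 2)) → ℂ) 𝓘(ℂ, Rest i j → ℂ × ℂ) ∞ (coordMap s i j)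
      (proj a x) := by
  refine Slice.contMDiffAt_source (incl_isInducing a) (proj_isOpenQuotientMap a) sliceAt
    (isOpen_domain hs) (F' := coords s i j)
    (fun y hy => (contMDiffAt_coords hs hy).contMDiffWithinAt) (fun t ht => coordMap_proj ht) ?_
  intro t ht
  obtain ⟨g, rfl⟩ := proj_eq_iff.1 ht
  exact smul_mem_domain hx g

lemma contMDiffAt_proj_sectionPt (x : MTilde a) {y : QuadProd (rest a i j)}
    (hy : y ∈ image a s i j) :
    ContMDiffAt 𝓘(ℂ, Rest i j → ℂ × ℂ) 𝓘(ℂ, Fin (2 * (n - 2)) → ℂ) ∞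
      (fun y => proj a (sectionPt hs hi hj hij x y)) y :=
  Slice.contMDiffAt_target (incl_isInducing a) (proj_isOpenQuotientMap a) sliceAt
    ((contMDiffOn_sectionPt hs hi hj hij x).contMDiffAt
      ((isOpen_image hs hi hj hij).mem_nhds hy)) (.of_forall fun _ => rfl)

include hs hi in
lemma proj_mem_U_iff {x : MTilde a} : proj a x ∈ U a s i j ↔ x.1 ∈ domain a s i j := by
  constructor
  · rintro ⟨y, hy, h⟩
    obtain ⟨g, rfl⟩ := proj_eq_iff.1 h.symm
    exact smul_mem_domain ((mem_UTilde_iff hs hi y).1 hy) g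
  · intro hx
    exact ⟨x, (mem_UTilde_iff hs hi x).2 hx, rfl⟩

include hs hi in
lemma isOpen_U : IsOpen (U a s i j) := by
  have : UTilde a s i j = MTilde.incl a ⁻¹' domain a s i j :=
    Set.ext fun x => mem_UTilde_iff hs hi x
  rw [U, this]
  exact (proj_isOpenQuotientMap a).isOpenMap _
    ((isOpen_domain hs).preimage (incl_isInducing a).continuous)

lemma coordMap_section (x : MTilde a) {y : QuadProd (rest a i j)} (hy : y ∈ image a s i j) :
    coordMap s i j (proj a (sectionPt hs hi hj hij x y)) = y := by
  have hN := isNormal_sectionPt hs hi hj hij x hy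
  rw [coordMap_proj ⟨1, by rwa [one_smul]⟩]
  exact coords_sectionPt hs hi hj hij x hy

lemma section_mem_U (x : MTilde a) {y : QuadProd (rest a i j)} (hy : y ∈ image a s i j) :
    proj a (sectionPt hs hi hj hij x y) ∈ U a s i j :=
  (proj_mem_U_iff hs hi).2 ⟨1, by rw [one_smul]; exact isNormal_sectionPt hs hi hj hij x hy⟩

lemma section_coordMap (x : MTilde a) {z : M a} (hz : z ∈ U a s i j) :
    coordMap s i j z ∈ image a s i j ∧
      proj a (sectionPt hs hi hj hij x (coordMap s i j z)) = z := by
  obtain ⟨t, rfl⟩ := (proj_isOpenQuotientMap a).surjective z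
  have ht := (proj_mem_U_iff hs hi).1 hz
  rw [coordMap_proj ht]
  obtain ⟨g, hg⟩ := ht
  obtain ⟨h1, h2⟩ := sectionPt_coords hs hi hj hij x t hg
  exact ⟨h1, by rw [h2, proj_smul]⟩

include hs hi hj hij in
-- The inverse is the orbit of the restored normal form, `y ↦ π̃ (sectionPt y)`; any left inverse
-- coincides with it on the image.
lemma coordMap_isBiholomorphicOn : IsBiholomorphicOn (E := Fin (2 * (n - 2)) → ℂ)
    (E' := Rest i j → ℂ × ℂ) (coordMap s i j) (U a s i j) (image a s i j) where
  isOpen_source := isOpen_U hs hi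
  isOpen_target := isOpen_image hs hi hj hij
  bijOn := by
    refine ⟨?_, ?_, ?_⟩
    · intro z hz
      -- Needed only as the default value of `sectionPt` off the image.
      obtain ⟨x, -⟩ := (proj_isOpenQuotientMap a).surjective z
      exact (section_coordMap hs hi hj hij x hz).1
    · intro z hz z' hz' h
      obtain ⟨x, -⟩ := (proj_isOpenQuotientMap a).surjective z
      rw [← (section_coordMap hs hi hj hij x hz).2, h, (section_coordMap hs hi hj hij x hz').2]
    · intro y hy
      let x : MTilde a := ⟨sectionMap hs y, (mem_image_iff hs hi hj hij).1 hy,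
        sum_sectionMap hs hi hj hij y⟩
      exact ⟨_, section_mem_U hs hi hj hij x hy, coordMap_section hs hi hj hij x hy⟩
  holomorphic z hz := by
    obtain ⟨x, rfl⟩ := (proj_isOpenQuotientMap a).surjective z
    exact (contMDiffAt_coordMap hs ((proj_mem_U_iff hs hi).1 hz)).contMDiffWithinAt
  holomorphic_inv ψ hψ y hy := by
    let x : MTilde a := ⟨sectionMap hs y, (mem_image_iff hs hi hj hij).1 hy,
      sum_sectionMap hs hi hj hij y⟩
    refine ((contMDiffAt_proj_sectionPt hs hi hj hij x hy).congr_of_eventuallyEq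
      ?_).contMDiffWithinAt
    filter_upwards [(isOpen_image hs hi hj hij).mem_nhds hy] with u hu
    have := hψ (section_mem_U hs hi hj hij x hu)
    rwa [coordMap_section hs hi hj hij x hu] at this

/-- A local holomorphic section of `π̃` through `x` is obtained by restoring normal forms from
coordinates and moving them back by the fixed element `g⁻¹`. -/
lemma mfderiv_proj_surjective (x : MTilde a) : Function.Surjective
    (mfderiv 𝓘(ℂ, Fin (2 * n - 1) → ℂ) 𝓘(ℂ, Fin (2 * (n - 2)) → ℂ) (proj a) x) := by
  obtain ⟨i, j, hi, hj, hij, g, hg⟩ := exists_isNormal baseRoot_sq x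
  have hd : x.1 ∈ domain a (baseRoot a) i j := ⟨g, hg⟩
  obtain ⟨h1, h2⟩ := sectionPt_coords baseRoot_sq hi hj hij x x hg
  refine mfderiv_surjective_of_rightInverse (g := fun z =>
    g⁻¹ • sectionPt baseRoot_sq hi hj hij x (coordMap (baseRoot a) i j z))
    ((contMDiff_proj a x).mdifferentiableAt inf_ne_zero) ?_ ?_ ?_
  · refine ContMDiffAt.mdifferentiableAt (n := ∞) (contMDiffAt_MTilde ?_) inf_ne_zero
    have hφ := contMDiffAt_coordMap baseRoot_sq hd
    refine (contMDiff_const_smul g⁻¹).contMDiffAt.comp (proj a x)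
      (f := (MTilde.incl a ∘ sectionPt baseRoot_sq hi hj hij x) ∘ coordMap (baseRoot a) i j) ?_
    refine ContMDiffAt.comp (proj a x) ?_ hφ
    refine (contMDiffOn_sectionPt baseRoot_sq hi hj hij x).contMDiffAt
      ((isOpen_image baseRoot_sq hi hj hij).mem_nhds ?_)
    rw [coordMap_proj hd]
    exact h1
  · rw [coordMap_proj hd, h2, inv_smul_smul]
  · filter_upwards [(isOpen_U baseRoot_sq hi).mem_nhds
      ((proj_mem_U_iff baseRoot_sq hi).2 hd)] with z hz
    rw [proj_smul]
    exact (section_coordMap baseRoot_sq hi hj hij x hz).2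

lemma coordMap_isCoordinateMap (hs : ∀ k, s k ^ 2 = 2 * a k) (hi : i ≠ 0) :
    IsCoordinateMap a s i j (coordMap s i j) := by
  intro x hx σ hσ k
  have hd := (mem_UTilde_iff hs hi x).1 hx
  rw [coordMap_proj hd]
  obtain ⟨g, hg⟩ := hd
  rw [(accompanying_iff hi hg).1 hσ, coords, normalize_eq hg]
  exact coord_eq_smul g (x.1 k)

end Manifolds

/-! ### The symplectic form of `M` -/

section PullbackLemmas

variable {E E' E'' X Y Z : Type} [NormedAddCommGroup E] [NormedSpace ℂ E] [NormedAddCommGroup E']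
  [NormedSpace ℂ E'] [NormedAddCommGroup E''] [NormedSpace ℂ E''] [TopologicalSpace X]
  [ChartedSpace E X] [TopologicalSpace Y] [ChartedSpace E' Y] [TopologicalSpace Z]
  [ChartedSpace E'' Z]

lemma TwoForm.pullback_apply (f : X → Y) (η : TwoForm E' Y) (x : X) (u v : TangentSpace 𝓘(ℂ, E) x) :
    η.pullback (E := E) f x ![u, v] =
      η (f x) ![mfderiv 𝓘(ℂ, E) 𝓘(ℂ, E') f x u, mfderiv 𝓘(ℂ, E) 𝓘(ℂ, E') f x v] := by
  rw [TwoForm.pullback, ContinuousAlternatingMap.compContinuousLinearMap_apply]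
  congr 1
  ext k
  fin_cases k <;> rfl

lemma TwoForm.pullback_comp (η : TwoForm E'' Z) {g : Y → Z} {f : X → Y} {x : X}
    (hg : MDifferentiableAt 𝓘(ℂ, E') 𝓘(ℂ, E'') g (f x))
    (hf : MDifferentiableAt 𝓘(ℂ, E) 𝓘(ℂ, E') f x) :
    η.pullback (E := E) (g ∘ f) x = (η.pullback (E := E') g).pullback (E := E) f x := by
  refine twoForm_ext (E := E) fun u v => ?_
  refine (TwoForm.pullback_apply (E := E) (g ∘ f) η x u v).trans ?_
  rw [mfderiv_comp x hg hf]
  refine Eq.trans ?_ (TwoForm.pullback_apply (E := E) f (η.pullback (E := E') g) x u v).symm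
  exact (TwoForm.pullback_apply (E := E') g η (f x) _ _).symm

lemma TwoForm.pullback_congr (η : TwoForm E' Y) {f g : X → Y} {x : X} (h : f =ᶠ[𝓝 x] g) :
    η.pullback (E := E) f x = η.pullback (E := E) g x := by
  refine twoForm_ext (E := E) fun u v => ?_
  refine (TwoForm.pullback_apply (E := E) f η x u v).trans ?_
  refine Eq.trans ?_ (TwoForm.pullback_apply (E := E) g η x u v).symm
  rw [h.mfderiv_eq, h.self_of_nhds]

lemma TwoForm.eq_of_pullback_eq {η θ : TwoForm E' Y} {f : X → Y} {x : X}
    (hf : Function.Surjective (mfderiv 𝓘(ℂ, E) 𝓘(ℂ, E') f x))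
    (h : η.pullback (E := E) f x = θ.pullback (E := E) f x) : η (f x) = θ (f x) := by
  refine twoForm_ext (E := E') fun u v => ?_
  obtain ⟨u, rfl⟩ := hf u
  obtain ⟨v, rfl⟩ := hf v
  refine (TwoForm.pullback_apply (E := E) f η x u v).symm.trans ?_
  rw [h]
  exact TwoForm.pullback_apply (E := E) f θ x u v

end PullbackLemmas

/-! ### The reduced form -/

section Forms

variable {n : ℕ} {a : Fin (n + 1) → ℂ} {s : Fin (n + 1) → ℂ} {i j : Fin (n + 1)}

/-- This is `prodForm_pullback_normalize` applied to the inverse of a chart of `M̃`. Nothing is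
lost, since the derivative of the inverse chart is onto and pullback by it is injective on forms. -/
lemma coordMap_pullback (hs : ∀ k, s k ^ 2 = 2 * a k) (hi : i ≠ 0) (hj : j ≠ 0) (hij : i ≠ j)
    {x : MTilde a} (hx : x.1 ∈ domain a s i j) :
    ((prodForm (rest a i j)).pullback (E := Fin (2 * (n - 2)) → ℂ) (coordMap s i j)).pullback
      (E := Fin (2 * n - 1) → ℂ) (proj a) x = (prodForm a).pullback (MTilde.incl a) x := by
  set e := chartAt (Fin (2 * n - 1) → ℂ) x
  have hxe : x ∈ e.source := mem_chart_source _ x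
  have he : e.symm (e x) = x := e.left_inv hxe
  have hsymm : ContMDiffAt 𝓘(ℂ, Fin (2 * n - 1) → ℂ) 𝓘(ℂ, Fin (2 * n - 1) → ℂ) ∞ e.symm (e x) :=
    (contMDiffOn_symm_of_mem_maximalAtlas (IsManifold.chart_mem_maximalAtlas x)).contMDiffAt
      (e.open_target.mem_nhds (e.map_source hxe))
  have hdsymm := hsymm.mdifferentiableAt inf_ne_zero
  have hde : MDifferentiableAt 𝓘(ℂ, Fin (2 * n - 1) → ℂ) 𝓘(ℂ, Fin (2 * n - 1) → ℂ) e
      (e.symm (e x)) := by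
    rw [he]
    exact mdifferentiableAt_atlas (chart_mem_atlas _ x) hxe
  have hsurj : Function.Surjective (mfderiv 𝓘(ℂ, Fin (2 * n - 1) → ℂ) 𝓘(ℂ, Fin (2 * n - 1) → ℂ)
      e.symm (e x)) := by
    refine mfderiv_surjective_of_rightInverse (g := e) hdsymm hde (by rw [he]) ?_
    rw [he]
    filter_upwards [e.open_source.mem_nhds hxe] with y hy
    exact e.left_inv hy
  have hφ := (contMDiffAt_coordMap hs hx).mdifferentiableAt inf_ne_zero
  have hπ := (contMDiff_proj a x).mdifferentiableAt inf_ne_zero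
  have hι := (contMDiff_incl a x).mdifferentiableAt inf_ne_zero
  have hF : ContMDiffAt 𝓘(ℂ, Fin (2 * n - 1) → ℂ) 𝓘(ℂ, Fin (n + 1) → ℂ × ℂ) ∞
      (MTilde.incl a ∘ e.symm) (e x) := (contMDiff_incl a).contMDiffAt.comp _ hsymm
  have key := prodForm_pullback_normalize hs hi hj hij hF (z := e x) (by
    rw [Function.comp_apply, he]; exact hx) (.of_forall fun y => (e.symm y).2.2)
  have h1 : ((prodForm (rest a i j)).pullback (E := Fin (2 * n - 1) → ℂ)
      (coordMap s i j ∘ proj a)).pullback (E := Fin (2 * n - 1) → ℂ) e.symm (e x) =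
      ((prodForm a).pullback (E := Fin (2 * n - 1) → ℂ) (MTilde.incl a)).pullback
        (E := Fin (2 * n - 1) → ℂ) e.symm (e x) := by
    rw [← TwoForm.pullback_comp _ (by rw [he]; exact hφ.comp x hπ) hdsymm,
      ← TwoForm.pullback_comp _ (by rw [he]; exact hι) hdsymm, key]
    refine TwoForm.pullback_congr _ ?_
    have : e.symm ⁻¹' (MTilde.incl a ⁻¹' domain a s i j) ∈ 𝓝 (e x) := by
      refine hsymm.continuousAt.preimage_mem_nhds (((isOpen_domain hs).preimage
        (incl_isInducing a).continuous).mem_nhds ?_)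
      rw [he]; exact hx
    filter_upwards [this] with y hy
    exact coordMap_proj hy
  have h2 := TwoForm.eq_of_pullback_eq hsurj h1
  rw [he] at h2
  rw [← h2]
  exact (TwoForm.pullback_comp _ hφ hπ).symm

/-- Every point of `M` belongs to the domain of a coordinate map. -/
lemma exists_base_index (z : M a) : ∃ i j : Fin (n + 1), i ≠ 0 ∧ j ≠ 0 ∧ i ≠ j ∧
    z ∈ U a (baseRoot a) i j := by
  obtain ⟨x, rfl⟩ := (proj_isOpenQuotientMap a).surjective z
  obtain ⟨i, j, hi, hj, hij, hx⟩ := exists_isNormal baseRoot_sq x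
  exact ⟨i, j, hi, hj, hij, (proj_mem_U_iff baseRoot_sq hi).2 hx⟩

/-- The symplectic form of `M`. -/
def form (a : Fin (n + 1) → ℂ) : TwoForm (Fin (2 * (n - 2)) → ℂ) (M a) := fun z =>
  (prodForm (rest a (exists_base_index z).choose (exists_base_index z).choose_spec.choose)).pullback
    (coordMap (baseRoot a) (exists_base_index z).choose
      (exists_base_index z).choose_spec.choose) z

lemma form_pullback_proj (a : Fin (n + 1) → ℂ) :
    (form a).pullback (E := Fin (2 * n - 1) → ℂ) (proj a) =
      (prodForm a).pullback (MTilde.incl a) := by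
  funext x
  obtain ⟨hi, hj, hij, hz⟩ := (exists_base_index (proj a x)).choose_spec.choose_spec
  exact coordMap_pullback baseRoot_sq hi hj hij ((proj_mem_U_iff baseRoot_sq hi).1 hz)

/-- Both sides have the same pullback to `M̃`, and `π̃` is a submersion. Hence neither the indices
chosen in `form` nor the choice of roots matters. -/
lemma pullback_coordMap_eq_form (hs : ∀ k, s k ^ 2 = 2 * a k) (hi : i ≠ 0) (hj : j ≠ 0)
    (hij : i ≠ j) {z : M a} (hz : z ∈ U a s i j) :
    (prodForm (rest a i j)).pullback (coordMap s i j) z = form a z := by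
  obtain ⟨x, rfl⟩ := (proj_isOpenQuotientMap a).surjective z
  refine TwoForm.eq_of_pullback_eq (mfderiv_proj_surjective x) ?_
  rw [coordMap_pullback hs hi hj hij ((proj_mem_U_iff hs hi).1 hz), form_pullback_proj]

/-- In the charts of `M` the form is constant. -/
lemma form_inChart {e : OpenPartialHomeomorph (M a) (Fin (2 * (n - 2)) → ℂ)}
    (he : e ∈ atlas (Fin (2 * (n - 2)) → ℂ) (M a)) :
    ∃ η : (Fin (2 * (n - 2)) → ℂ) [⋀^Fin 2]→L[ℂ] ℂ, ∀ z ∈ e.target, (form a).inChart e z = η := by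
  obtain ⟨z₀, rfl⟩ := he
  -- The chart comes from a normal form with some indices `i, j`, which may differ from those chosen
  -- in `form` at the points of the chart.
  obtain ⟨i, j, hi, hj, hij, x, hx, hz₀, hc⟩ := (exists_slice z₀).choose_spec
  change sliceAt z₀ = _ at hc
  set L := modelEquiv (n := n) hi hj hij
  set κ := coordChart (baseRoot a) i j x
  refine ⟨(flatForm (Rest i j)).compContinuousLinearMap (L.symm : _ →L[ℂ] _), ?_⟩
  set e := (sliceAt z₀).chart (incl_isInducing a) (proj_isOpenQuotientMap a) with he
  have hemem : e ∈ atlas (Fin (2 * (n - 2)) → ℂ) (M a) := ⟨z₀, rfl⟩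
  have htarget : e.target = L.symm ⁻¹' (κ.target ∩ κ.symm ⁻¹' image a (baseRoot a) i j) := by
    rw [he, hc]; rfl
  have hsymm : ∀ z, e.symm z = proj a (sectionPt baseRoot_sq hi hj hij x (κ.symm (L.symm z))) := by
    intro z; rw [he, hc]; rfl
  intro z hz
  have hW : κ.symm (L.symm z) ∈ image a (baseRoot a) i j := by
    rw [htarget] at hz; exact hz.2
  have hU : e.symm z ∈ U a (baseRoot a) i j := by
    rw [hsymm]; exact section_mem_U _ hi hj hij x hW
  have hde : MDifferentiableAt 𝓘(ℂ, Fin (2 * (n - 2)) → ℂ) 𝓘(ℂ, Fin (2 * (n - 2)) → ℂ) e.symm z :=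
    mdifferentiableAt_atlas_symm hemem hz
  have hφ : MDifferentiableAt 𝓘(ℂ, Fin (2 * (n - 2)) → ℂ) 𝓘(ℂ, Rest i j → ℂ × ℂ)
      (coordMap (baseRoot a) i j) (e.symm z) := by
    obtain ⟨t, ht⟩ := (proj_isOpenQuotientMap a).surjective (e.symm z)
    rw [← ht] at hU ⊢
    exact (contMDiffAt_coordMap baseRoot_sq
      ((proj_mem_U_iff baseRoot_sq hi).1 hU)).mdifferentiableAt inf_ne_zero
  have hκ := (contMDiff_coordChart_symm (s := baseRoot a) (i := i) (j := j)
    x).mdifferentiable inf_ne_zero (L.symm z)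
  have hL : MDifferentiableAt 𝓘(ℂ, Fin (2 * (n - 2)) → ℂ) 𝓘(ℂ, Rest i j → ℂ × ℂ) L.symm z :=
    L.symm.differentiableAt.mdifferentiableAt
  have e1 : (form a).inChart e z = ((prodForm (rest a i j)).pullback
      (E := Fin (2 * (n - 2)) → ℂ) (coordMap (baseRoot a) i j)).pullback
      (E := Fin (2 * (n - 2)) → ℂ) e.symm z := by
    unfold TwoForm.inChart
    unfold TwoForm.pullback
    rw [← pullback_coordMap_eq_form baseRoot_sq hi hj hij hU]
    rfl
  rw [e1, ← TwoForm.pullback_comp _ hφ hde]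
  -- Read through the coordinate map, the chart of `M` is a Darboux chart of the product of quadrics
  -- followed by a linear isomorphism.
  have e2 : coordMap (baseRoot a) i j ∘ e.symm =ᶠ[𝓝 z] κ.symm ∘ L.symm := by
    filter_upwards [e.open_target.mem_nhds hz] with u hu
    rw [htarget] at hu
    rw [Function.comp_apply, hsymm]
    exact coordMap_section _ hi hj hij x hu.2
  refine (TwoForm.pullback_congr _ e2).trans ?_
  refine (TwoForm.pullback_comp _ hκ hL).trans ?_
  refine twoForm_ext (E := Fin (2 * (n - 2)) → ℂ) fun u v => ?_
  refine (TwoForm.pullback_apply (E := Fin (2 * (n - 2)) → ℂ) L.symm _ z u v).trans ?_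
  rw [prodForm_pullback_chart_symm (chart_mem_atlas _ _), mfderiv_eq_fderiv, L.symm.fderiv,
    ContinuousAlternatingMap.compContinuousLinearMap_apply]
  congr 1
  ext k : 1
  fin_cases k <;> rfl

/-- Holomorphy and closedness follow from constant coefficients in the charts. Non-degeneracy is
carried over from the product of quadrics by a coordinate map, whose derivative is bijective. -/
theorem form_isSymplectic (a : Fin (n + 1) → ℂ) : (form a).IsSymplectic where
  holomorphic e he := by
    obtain ⟨η, hη⟩ := form_inChart he
    exact contDiffOn_const.congr hη
  closed e he z hz := by
    obtain ⟨η, hη⟩ := form_inChart he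
    have : (form a).inChart e =ᶠ[𝓝 z] fun _ => η := by
      filter_upwards [e.open_target.mem_nhds hz] with u hu using hη u hu
    rw [this.extDeriv_eq, extDeriv_const]
  nondegenerate z u hu := by
    obtain ⟨x, rfl⟩ := (proj_isOpenQuotientMap a).surjective z
    obtain ⟨i, j, hi, hj, hij, g, hg⟩ := exists_isNormal baseRoot_sq x
    have hx : x.1 ∈ domain a (baseRoot a) i j := ⟨g, hg⟩
    have hz := (proj_mem_U_iff baseRoot_sq hi).2 hx
    have hφ := (contMDiffAt_coordMap baseRoot_sq hx).mdifferentiableAt inf_ne_zero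
    obtain ⟨hW, hψφ⟩ := section_coordMap baseRoot_sq hi hj hij x hz
    have hψ := (contMDiffAt_proj_sectionPt baseRoot_sq hi hj hij x hW).mdifferentiableAt inf_ne_zero
    have hsurj := mfderiv_surjective_of_rightInverse hφ hψ hψφ (by
      filter_upwards [(isOpen_image baseRoot_sq hi hj hij).mem_nhds hW] with y hy
      exact coordMap_section baseRoot_sq hi hj hij x hy)
    refine mfderiv_injective_of_leftInverse hφ hψ ?_ u 0 ?_
    · filter_upwards [(isOpen_U baseRoot_sq hi).mem_nhds hz] with y hy
      exact (section_coordMap baseRoot_sq hi hj hij x hy).2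
    · rw [map_zero]
      refine (prodForm_isSymplectic (rest a i j)).nondegenerate _ _ fun v => ?_
      obtain ⟨v, rfl⟩ := hsurj v
      have := hu v
      rw [← pullback_coordMap_eq_form baseRoot_sq hi hj hij hz] at this
      exact (TwoForm.pullback_apply _ _ _ u v).symm.trans this

end Forms

end Garnier

end

/-! ### The theorem -/

theorem mainTheorem1 (n : ℕ) (hn : 2 ≤ n) (a : Fin (n + 1) → ℂ) :
    -- the form `∑ ω^{(k)}` on the product of the `n + 1` quadrics is symplectic
    (Garnier.prodForm a).IsSymplectic ∧
    -- `M̃` is a submanifold, `M` is a manifold with a form `Ω`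
    ∃ (_ : ChartedSpace (Fin (2 * n - 1) → ℂ) (Garnier.MTilde a))
      (_ : ChartedSpace (Fin (2 * (n - 2)) → ℂ) (Garnier.M a))
      (Ω : Garnier.TwoForm (Fin (2 * (n - 2)) → ℂ) (Garnier.M a)),
      -- the inclusion `M̃ ⊂ M̃̃` is an embedding of complex manifolds
      IsManifold 𝓘(ℂ, Fin (2 * n - 1) → ℂ) ∞ (Garnier.MTilde a) ∧
      ContMDiff 𝓘(ℂ, Fin (2 * n - 1) → ℂ) 𝓘(ℂ, Fin (n + 1) → ℂ × ℂ) ∞ (Garnier.MTilde.incl a) ∧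
      (∀ x, Function.Injective
        (mfderiv 𝓘(ℂ, Fin (2 * n - 1) → ℂ) 𝓘(ℂ, Fin (n + 1) → ℂ × ℂ) (Garnier.MTilde.incl a) x)) ∧
      -- `M` is a complex manifold and `π̃ : M̃ → M` is a submersion
      T2Space (Garnier.M a) ∧ SecondCountableTopology (Garnier.M a) ∧
      IsManifold 𝓘(ℂ, Fin (2 * (n - 2)) → ℂ) ∞ (Garnier.M a) ∧
      ContMDiff 𝓘(ℂ, Fin (2 * n - 1) → ℂ) 𝓘(ℂ, Fin (2 * (n - 2)) → ℂ) ∞ (Garnier.proj a) ∧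
      (∀ x, Function.Surjective
        (mfderiv 𝓘(ℂ, Fin (2 * n - 1) → ℂ) 𝓘(ℂ, Fin (2 * (n - 2)) → ℂ) (Garnier.proj a) x)) ∧
      -- `Ω` is symplectic, and its lifting is the restriction of `∑ ω^{(k)}` to `M̃`
      Ω.IsSymplectic ∧
      Ω.pullback (E := Fin (2 * n - 1) → ℂ) (Garnier.proj a) =
        (Garnier.prodForm a).pullback (Garnier.MTilde.incl a) ∧
      -- the charts, for any preassigned values `s k` of the square roots of `2 a_{kk}`
      ∀ s : Fin (n + 1) → ℂ, (∀ k, s k ^ 2 = 2 * a k) →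
        (∀ z : Garnier.M a, ∃ i j, i ≠ 0 ∧ j ≠ 0 ∧ i ≠ j ∧ z ∈ Garnier.U a s i j) ∧
        ∀ i j : Fin (n + 1), i ≠ 0 → j ≠ 0 → i ≠ j →
          (∀ x ∈ Garnier.UTilde a s i j, ∃! σ, Garnier.Accompanying s i j x.1 σ) ∧
          Garnier.proj a ⁻¹' Garnier.U a s i j = Garnier.UTilde a s i j ∧
          (Garnier.prodForm (Garnier.rest a i j)).IsSymplectic ∧
          -- if no `∑ ± s k` vanishes, the image of the chart is the whole product of quadrics
          ((∀ ε : Fin (n + 1) → ℤˣ, ∑ k, ((ε k : ℤ) : ℂ) * s k ≠ 0) →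
            {y | ¬ Garnier.Triangular (Garnier.restore a s i j y)} = Set.univ) ∧
          ∃ φ : Garnier.M a → Garnier.QuadProd (Garnier.rest a i j),
            Garnier.IsCoordinateMap a s i j φ ∧
            Garnier.IsBiholomorphicOn (E := Fin (2 * (n - 2)) → ℂ) (E' := Garnier.Rest i j → ℂ × ℂ)
              φ (Garnier.U a s i j) {y | ¬ Garnier.Triangular (Garnier.restore a s i j y)} ∧
            -- `π_{0ij}` is symplectic
            (∀ z ∈ Garnier.U a s i j,
              (Garnier.prodForm (Garnier.rest a i j)).pullback φ z = Ω z) ∧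
            -- `π̃^* π_{0ij}^* ω_{0ij}` is the restriction of `∑ ω^{(k)}` to `Ũ`
            ∀ x ∈ Garnier.UTilde a s i j,
              ((Garnier.prodForm (Garnier.rest a i j)).pullback
                (E := Fin (2 * (n - 2)) → ℂ) φ).pullback
                (E := Fin (2 * n - 1) → ℂ) (Garnier.proj a) x =
              (Garnier.prodForm a).pullback (Garnier.MTilde.incl a) x := by
  refine ⟨Garnier.prodForm_isSymplectic a, inferInstance, inferInstance, Garnier.form a,
    inferInstance, Garnier.contMDiff_incl a, Garnier.mfderiv_incl_injective, inferInstance,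
    inferInstance, inferInstance, Garnier.contMDiff_proj a, Garnier.mfderiv_proj_surjective,
    Garnier.form_isSymplectic a, Garnier.form_pullback_proj a, fun s hs => ⟨fun z => ?_,
    fun i j hi hj hij => ⟨fun x hx => ?_, ?_, Garnier.prodForm_isSymplectic _, fun hε => ?_,
    Garnier.coordMap s i j, Garnier.coordMap_isCoordinateMap hs hi,
    Garnier.coordMap_isBiholomorphicOn hs hi hj hij,
    fun z hz => Garnier.pullback_coordMap_eq_form hs hi hj hij hz,
    fun x hx => Garnier.coordMap_pullback hs hi hj hij ((Garnier.mem_UTilde_iff hs hi x).1 hx)⟩⟩⟩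
  · obtain ⟨x, rfl⟩ := (Garnier.proj_isOpenQuotientMap a).surjective z
    obtain ⟨i, j, hi, hj, hij, hx⟩ := Garnier.exists_isNormal hs x
    exact ⟨i, j, hi, hj, hij, (Garnier.proj_mem_U_iff hs hi).2 hx⟩
  · obtain ⟨g, hg⟩ := (Garnier.mem_UTilde_iff hs hi x).1 hx
    exact ⟨_, (Garnier.accompanying_iff hi hg).2 rfl,
      fun σ hσ => (Garnier.accompanying_iff hi hg).1 hσ⟩
  · ext x
    exact (Garnier.proj_mem_U_iff hs hi).trans (Garnier.mem_UTilde_iff hs hi x).symm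
  · refine Set.eq_univ_of_forall fun y => (Garnier.mem_image_iff hs hi hj hij).2 fun hT => ?_
    obtain ⟨ε, h⟩ := Garnier.exists_sum_eq_zero_of_triangular hs
      (Garnier.sum_sectionMap hs hi hj hij y) hT
    exact hε ε h
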